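/- **Setting.** $N$ agents communicate over a connected undirected graph on $\{1,\dots,N\}$, with neighbourhoods $\mathcal N(i)$ and edges $l=(i,j)$, $i<j$. Let $\gamma,\mu,\lambda,\rho>0$. At each time $t=1,2,\dots$ agent $i$ receives the training data $X_i^{(t)}$ of one task ($M$ labelled points of $\mathbb R^d\times\mathbb R$). The vectors $(X_1^{(t)},\dots,X_N^{(t)})$ are independent and identically distributed in $t$. The loss $\hat{\mathcal L}(X;\theta)$, $\theta\in\mathbb R^d$, is jointly continuous, and it is convex and $C^2$ in $\theta$ with jointly continuous Hessian. Put $$\alpha_i^{(t)}=\arg\min_\theta\big[\hat{\mathcal L}(X_i^{(t)};\theta)+\gamma\|\theta\|_2^2\big],\qquad \Gamma_i^{(t)}=\nabla_\theta^2\hat{\mathcal L}(X_i^{(t)};\alpha_i^{(t)}),$$ and, for $L\in\mathbb R^{d\times u}$ and $\|x\|_A^2=x^\top A x$, $$F_i^{(t)}(L)=\min_{s\in\mathbb R^u}\big[\|\alpha_i^{(t)}-Ls\|^2_{\Gamma_i^{(t)}}+\mu\|s\|_1\big],\qquad \hat{\mathcal R}_T(L)=\frac1T\sum_{t=1}^T\sum_{i=1}^N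 F_i^{(t)}(L)+\sum_{i=1}^N\lambda\|L\|_F^2,\qquad \mathcal R_T(L)=\mathbb E\,\hat{\mathcal R}_T(L).$$ **Algorithm (CoLLA).** Start from given dictionaries $L_i^{[0]}$ and a given dual variable $Z^{[0]}=(Z_l)_l$. At time $T\ge1$ agent $i$ computes a solution $s_i^{(T)}$ of the LASSO problem $\min_s\big[\|\alpha_i^{(T)}-L_i^{[T-1]}s\|^2_{\Gamma_i^{(T)}}+\mu\|s\|_1\big]$ with its current dictionary and keeps it from then on. With $$g_{i,T}(L)=\frac1T\sum_{t=1}^T\big[\|\alpha_i^{(t)}-Ls_i^{(t)}\|^2_{\Gamma_i^{(t)}}+\mu\|s_i^{(t)}\|_1\big]+\lambda\|L\|_F^2$$ and the augmented Lagrangian $$\mathcal J_T(L_1,\dots,L_N,Z)=\sum_i g_{i,T}(L_i)+\sum_{l=(i,j)}\langle Z_l,L_i-L_j\rangle+\frac\rho2\sum_{l=(i,j)}\|L_i-L_j\|_F^2,$$ the agents iterate over $k$, starting from $(L^{[T-1]},Z^{[T-1]})$: for $i=1,\dots,N$ in turn, $L_i^{k+1}=\arg\min_{L}\mathcal J_T(L_1^{k+1},\dots,L_{i-1}^{k+1},L,L_{i+1}^k,\dots,L_N^k,Z^k)$;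 then $Z_l^{k+1}=Z_l^k+\rho(L_i^{k+1}-L_j^{k+1})$ for each edge $l=(i,j)$. The limits as $k\to\infty$ are $L_i^{[T]}$ and $Z^{[T]}$. The penalty is in the range $3(N-1)|\mathcal N(i)|\,\rho<2\eta_i$ for all $i$, where $\eta_i$ are constants such that almost surely every $g_{i,T}$ ($T\ge1$) is strongly convex with modulus $\eta_i$ (for instance $\eta_i=2\lambda$). **Assumptions.** (A) There are compact sets $K_i$ with $X_i^{(t)}\in K_i$ almost surely, and for all data in $K_i$ the corresponding Hessian $\Gamma$ is positive definite. (B) Almost surely, for every agent $i$, every dictionary $L$ in the closure of $\{L_i^{[T]}:T\ge0\}$ and all data in $K_i$ (with the corresponding $\alpha,\Gamma$), the LASSO problem $\min_s[\|\alpha-Ls\|_\Gamma^2+\mu\|s\|_1]$ has a unique solution. (C) Almost surely, for all $T\ge0$ and all $i$, the matrix $(L_i^{[T]})^\top\Gamma_i^{(T+1)}L_i^{[T]}$ is positive definite. **Claim.** $\hat{\mathcal R}_T(L)$ is integrable for all $T$ and $L$, and the following hold almost surely. 1. For every $T\ge1$ the inner iterations converge, and to the same dictionary for all agents: $L_i^{k}\to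 L_i^{[T]}=:L_T$ as $k\to\infty$. 2. $\hat{\mathcal R}_T(L)-\mathcal R_T(L)\to0$ as $T\to\infty$, locally uniformly in $L\in\mathbb R^{d\times u}$. 3. The distance from $L_T$ to the set of stationary points of $\mathcal R_T$ (the points where $\mathcal R_T$ is differentiable with zero derivative) tends to $0$ as $T\to\infty$. -/

import Mathlib

open Filter Topology MeasureTheory ProbabilityTheory
open scoped Matrix Matrix.Norms.Frobenius

namespace CoLLA

/-- The training data of one task: `M` labelled instances `(x_m, y_m)` with `x_m ∈ ℝ^d`. -/
abbrev TaskData (d M : ℕ) := Fin M → (Fin d → ℝ) × ℝ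

/-- Dictionaries in `ℝ^{d × u}`; the norm is the Frobenius norm. -/
abbrev Dict (d u : ℕ) := Matrix (Fin d) (Fin u) ℝ

section SingleTask

variable {d u M : ℕ}

/-- The ridge estimator `α = argmin_θ loss(x; θ) + gam ‖θ‖₂²` of the task with data `x`. -/
noncomputable def ridgeEstimator (loss : TaskData d M → (Fin d → ℝ) → ℝ) (gam : ℝ)
    (x : TaskData d M) : Fin d → ℝ :=
  Classical.epsilon fun θ => ∀ θ', loss x θ + gam * (θ ⬝ᵥ θ) ≤ loss x θ' + gam * (θ' ⬝ᵥ θ')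

/-- The Hessian matrix of `f` at `θ`. -/
noncomputable def hessian (f : (Fin d → ℝ) → ℝ) (θ : Fin d → ℝ) : Matrix (Fin d) (Fin d) ℝ :=
  Matrix.of fun j k => iteratedFDeriv ℝ 2 f θ ![Pi.single j 1, Pi.single k 1]

/-- `Γ`: the Hessian of the loss of the task with data `x` at its ridge estimator. -/
noncomputable def lossHessian (loss : TaskData d M → (Fin d → ℝ) → ℝ) (gam : ℝ)
    (x : TaskData d M) : Matrix (Fin d) (Fin d) ℝ :=
  hessian (loss x) (ridgeEstimator loss gam x)

/-- The LASSO objective `‖α - L s‖²_Γ + mu ‖s‖₁`. -/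
def lassoObjective (mu : ℝ) (α : Fin d → ℝ) (Γ : Matrix (Fin d) (Fin d) ℝ) (L : Dict d u)
    (s : Fin u → ℝ) : ℝ :=
  (α - L *ᵥ s) ⬝ᵥ (Γ *ᵥ (α - L *ᵥ s)) + mu * ∑ j, |s j|

/-- `s` solves the LASSO problem `min_s ‖α - L s‖²_Γ + mu ‖s‖₁`. -/
def IsLassoSolution (mu : ℝ) (α : Fin d → ℝ) (Γ : Matrix (Fin d) (Fin d) ℝ) (L : Dict d u)
    (s : Fin u → ℝ) : Prop :=
  ∀ v, lassoObjective mu α Γ L s ≤ lassoObjective mu α Γ L v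

/-- `F(L) = min_s [‖α - L s‖²_Γ + mu ‖s‖₁]`. -/
noncomputable def taskLoss (mu : ℝ) (α : Fin d → ℝ) (Γ : Matrix (Fin d) (Fin d) ℝ)
    (L : Dict d u) : ℝ :=
  ⨅ s, lassoObjective mu α Γ L s

end SingleTask

section Risk

variable {N d u M : ℕ}

/-- The empirical risk `(1/T) ∑_{t=1}^T ∑_i F_i^{(t)}(L) + ∑_i lam ‖L‖_F²` of a common dictionary
`L`, for the sequence `x` of tasks (`x t i` is the data agent `i` receives at time `t`). -/
noncomputable def empiricalRisk (loss : TaskData d M → (Fin d → ℝ) → ℝ) (gam mu lam : ℝ)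
    (x : ℕ → Fin N → TaskData d M) (T : ℕ) (L : Dict d u) : ℝ :=
  (T : ℝ)⁻¹ * ∑ t ∈ Finset.Icc 1 T, ∑ i,
      taskLoss mu (ridgeEstimator loss gam (x t i)) (lossHessian loss gam (x t i)) L
    + ∑ _i : Fin N, lam * ‖L‖ ^ 2

/-- The true expected risk: the expectation of the empirical risk over the random tasks. -/
noncomputable def expectedRisk {Ω : Type*} [MeasurableSpace Ω] (P : Measure Ω)
    (loss : TaskData d M → (Fin d → ℝ) → ℝ) (gam mu lam : ℝ)
    (x : ℕ → Ω → Fin N → TaskData d M) (T : ℕ) (L : Dict d u) : ℝ :=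
  ∫ ω, empiricalRisk loss gam mu lam (fun t => x t ω) T L ∂P

/-- Stationary points of a real function on dictionaries: it is differentiable there, with
derivative zero. -/
def stationaryPoints (R : Dict d u → ℝ) : Set (Dict d u) :=
  {L | HasFDerivAt R (0 : Dict d u →L[ℝ] ℝ) L}

end Risk

section Algorithm

variable {N d u : ℕ}

/-- The edges `(i, j)` of the communication graph, oriented by `i < j`. -/
def Edge (G : SimpleGraph (Fin N)) : Type := {p : Fin N × Fin N // p.1 < p.2 ∧ G.Adj p.1 p.2}

noncomputable instance (G : SimpleGraph (Fin N)) : Fintype (Edge G) := by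
  unfold Edge
  exact Fintype.ofFinite _

/-- The arc-node incidence matrix of the graph: row `(i, j)` has `1` at `i` and `-1` at `j`. -/
def incidence (G : SimpleGraph (Fin N)) : Matrix (Edge G) (Fin N) ℝ :=
  Matrix.of fun l q => if q = l.1.1 then 1 else if q = l.1.2 then -1 else 0

/-- The blocks, indexed by edges, of `∑ i, E_i L_i = (H ⊗ I_d) L`. -/
noncomputable def constraint (G : SimpleGraph (Fin N)) (L : Fin N → Dict d u) (l : Edge G) :
    Dict d u :=
  ∑ i, incidence G l i • L i

/-- The local objective of agent `i` at time `T`, the sparse codes `s` being fixed: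
`(1/T) ∑_{t=1}^T [‖α_i^{(t)} - L s_i^{(t)}‖²_Γ + mu ‖s_i^{(t)}‖₁] + lam ‖L‖_F²`. -/
noncomputable def localObjective (mu lam : ℝ) (α : ℕ → Fin N → Fin d → ℝ)
    (Γ : ℕ → Fin N → Matrix (Fin d) (Fin d) ℝ) (s : ℕ → Fin N → Fin u → ℝ) (T : ℕ) (i : Fin N)
    (L : Dict d u) : ℝ :=
  (T : ℝ)⁻¹ * ∑ t ∈ Finset.Icc 1 T, lassoObjective mu (α t i) (Γ t i) L (s t i) + lam * ‖L‖ ^ 2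

/-- The augmented Lagrangian `J_T(L_1, …, L_N, Z)`. -/
noncomputable def augLagrangian (G : SimpleGraph (Fin N)) (mu lam rho : ℝ)
    (α : ℕ → Fin N → Fin d → ℝ) (Γ : ℕ → Fin N → Matrix (Fin d) (Fin d) ℝ)
    (s : ℕ → Fin N → Fin u → ℝ) (T : ℕ) (L : Fin N → Dict d u) (Z : Edge G → Dict d u) : ℝ :=
  ∑ i, localObjective mu lam α Γ s T i (L i)
    + ∑ l, ((Z l)ᵀ * constraint G L l).trace
    + rho / 2 * ∑ l, ‖constraint G L l‖ ^ 2

/-- The arguments seen by agent `i` in a sweep: agents before `i` are already updated, agents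
after `i` are not, and agent `i` itself uses `X`. -/
def sweepArg (Lnew Lold : Fin N → Dict d u) (i : Fin N) (X : Dict d u) : Fin N → Dict d u :=
  fun j => if j < i then Lnew j else if j = i then X else Lold j

/-- A run of the algorithm on the tasks `(α t i, Γ t i)`, `t ≥ 1`, from the initial dictionaries
`L₀` and the initial dual variable `Z₀`. Here `s t i` is the sparse code computed by agent `i` for
its task at time `t`, `Lk T k` and `Zk T k` are the primal and dual variables after `k` inner
(extended ADMM) iterations at time `T`, and `L T`, `Z T` are the stable values they reach. -/
structure IsRun (G : SimpleGraph (Fin N)) (mu lam rho : ℝ)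
    (L₀ : Fin N → Dict d u) (Z₀ : Edge G → Dict d u)
    (α : ℕ → Fin N → Fin d → ℝ) (Γ : ℕ → Fin N → Matrix (Fin d) (Fin d) ℝ)
    (s : ℕ → Fin N → Fin u → ℝ)
    (Lk : ℕ → ℕ → Fin N → Dict d u) (Zk : ℕ → ℕ → Edge G → Dict d u)
    (L : ℕ → Fin N → Dict d u) (Z : ℕ → Edge G → Dict d u) : Prop where
  init_dict : L 0 = L₀
  init_dual : Z 0 = Z₀
  code : ∀ T i, IsLassoSolution mu (α (T + 1) i) (Γ (T + 1) i) (L T i) (s (T + 1) i)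
  start_dict : ∀ T, Lk (T + 1) 0 = L T
  start_dual : ∀ T, Zk (T + 1) 0 = Z T
  primal_step : ∀ T k i X,
    augLagrangian G mu lam rho α Γ s (T + 1)
        (sweepArg (Lk (T + 1) (k + 1)) (Lk (T + 1) k) i (Lk (T + 1) (k + 1) i)) (Zk (T + 1) k)
      ≤ augLagrangian G mu lam rho α Γ s (T + 1)
        (sweepArg (Lk (T + 1) (k + 1)) (Lk (T + 1) k) i X) (Zk (T + 1) k)
  dual_step : ∀ T k l,
    Zk (T + 1) (k + 1) l = Zk (T + 1) k l + rho • constraint G (Lk (T + 1) (k + 1)) l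
  stable_dict : ∀ T i, L (T + 1) i = limUnder atTop fun k => Lk (T + 1) k i
  stable_dual : ∀ T l, Z (T + 1) l = limUnder atTop fun k => Zk (T + 1) k l

end Algorithm

end CoLLA

/-!
The inner loop is an extended alternating direction method for the consensus problem of minimizing
`∑ i, g i (L i)` subject to `L i = L j` along the edges. With the sparse codes fixed, every local
objective is a quadratic with the strong convexity modulus `η i`. A weighted sum of the squared
distances of the dual variables and of the dictionaries to a saddle point is a Lyapunov function:
in the admissible range of the penalty, every sweep decreases it by a multiple of the squared
distance of the new dictionaries to the minimizer (`tendsto_admm`). As the graph is connected, the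
limit is a dictionary common to all agents, and it minimizes the sum of the local objectives
(`CoLLA.IsRun.exists_tendsto`).

The outer iteration is thus online majorization-minimization. The dictionary `X T` minimizes the
regularized average over `t ≤ T` of surrogates `S t`, quadratic functions of the dictionary that lie
above the task losses `ℓ t` and touch them at `X (t - 1)`, where the code of time `t` was computed.
The point is that the gap between the averages of the surrogates and of the losses at `X T` tends to
`0` (`IsOnlineSurrogate.tendsto_gap`). No quasi-martingale is needed for this: over the block of
times between two consecutive `q`-th powers, the optimal value of the regularized averaged surrogate
drops by the relative length of the block times the gap (`IsOnlineSurrogate.descent`), up to an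
error summable over the blocks. The relative length of the `k`-th block is of the order of `1 / k`,
so the gaps are summable against a divergent series, and they vary slowly enough to tend to `0`. The
summable errors come from a law of large numbers with rate: the losses are bounded and Lipschitz in
the dictionary, their averages have variance `O(1 / T)`, and the sum of these variances over finer
and finer grids is summable along the `q`-th powers once `q` exceeds a multiple of the dimension
(`ae_exists_summable_bound`). The same rate, with the slow variation of averages of bounded
functions, gives the locally uniform convergence of the empirical risk.

For stationarity, let `x` be a limit point of the dictionaries. The averaged surrogate is a
paraboloid above the empirical risk, which touches it at `X T` up to the gap; in the limit, the
expected risk lies below a paraboloid touching it at `x` (`le_add_sq_of_tendsto`). The LASSO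
problems at `x` have unique solutions, so that the task losses, and by domination their
expectation, are differentiable at `x` by the envelope theorem
(`IsTaskProcess.differentiableAt_integral`). A differentiable function below a paraboloid touching
it at its vertex has derivative zero there. As the dictionaries are bounded, this forces their
distance to the stationary points to tend to `0`.
-/

/-! ### The multi-block ADMM -/

section ADMM

variable {E : Type*} [NormedAddCommGroup E] [InnerProductSpace ℝ E] {ι : Type*} [Fintype ι] {n : ℕ}

/-- The Gauss–Seidel cross terms `⟪p_i, p_j - r_j⟫`, `i < j`, are absorbed by the squares of the
blocks: each index belongs to at most `n - 1` pairs. -/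
theorem sum_lt_inner_sub_le (p r : Fin n → E) :
    ∑ i, ∑ j, (if i < j then inner ℝ (p j - r j) (p i) else 0)
      ≤ ((n : ℝ) - 1) * ∑ i, (‖p i‖ ^ 2 + ‖r i‖ ^ 2 / 2) := by
  have h1 : ∀ i j, (if i < j then inner ℝ (p j - r j) (p i) else 0)
      ≤ (if i < j then ‖p i‖ ^ 2 else 0)
        + (if i < j then ‖p j‖ ^ 2 / 2 + ‖r j‖ ^ 2 / 2 else 0) := by
    intro i j
    split_ifs with h
    · have h2 : inner ℝ (p j - r j) (p i) ≤ (‖p j‖ + ‖r j‖) * ‖p i‖ :=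
        (real_inner_le_norm _ _).trans
          (mul_le_mul_of_nonneg_right (norm_sub_le _ _) (norm_nonneg _))
      nlinarith [sq_nonneg (‖p j‖ - ‖p i‖), sq_nonneg (‖r j‖ - ‖p i‖)]
    · simp
  calc _ ≤ ∑ i, ∑ j, ((if i < j then ‖p i‖ ^ 2 else 0)
          + (if i < j then ‖p j‖ ^ 2 / 2 + ‖r j‖ ^ 2 / 2 else 0)) :=
        Finset.sum_le_sum fun i _ => Finset.sum_le_sum fun j _ => h1 i j
    _ = ∑ i, ∑ j, ((if i < j then ‖p i‖ ^ 2 else 0)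
          + (if j < i then ‖p i‖ ^ 2 / 2 + ‖r i‖ ^ 2 / 2 else 0)) := by
        simp_rw [Finset.sum_add_distrib]
        congr 1
        exact Finset.sum_comm
    _ ≤ ∑ i, ∑ j, (if j ∈ Finset.univ.erase i then ‖p i‖ ^ 2 + ‖r i‖ ^ 2 / 2 else 0) := by
        refine Finset.sum_le_sum fun i _ => Finset.sum_le_sum fun j _ => ?_
        rcases lt_trichotomy i j with h | h | h
        · simp [h, h.ne', not_lt.2 h.le]; positivity
        · simp [h]
        · simp only [h, h.ne, not_lt.2 h.le, if_true, if_false, Finset.mem_erase, ne_eq,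
            not_false_eq_true, Finset.mem_univ, and_self, zero_add]
          linarith [sq_nonneg ‖p i‖]
    _ = _ := by
        rw [Finset.mul_sum]
        refine Finset.sum_congr rfl fun i _ => ?_
        rw [Finset.sum_ite_mem, Finset.univ_inter, Finset.sum_const, Finset.card_erase_of_mem
          (Finset.mem_univ _), Finset.card_univ, Fintype.card_fin, nsmul_eq_mul,
          Nat.cast_sub (by have := i.2; omega)]
        simp

/-- One sweep of the multi-block ADMM, written in terms of the errors `e`, `e'` of the blocks and
`w`, `w'` of the dual variable before and after the sweep. `-∑_l H_li ⟪w'_l + ρ ∑_{j > i} H_lj (e_j - e'_j), ·⟫`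
is the difference of the gradients of the `i`-th objective at the new block and at the solution. -/
theorem admm_energy_decrease (H : ι → Fin n → ℝ) {rho : ℝ} (hrho : 0 < rho) (deg η : Fin n → ℝ)
    (hdeg : ∀ i, ∑ l, H l i ^ 2 ≤ deg i) (hn : 1 ≤ (n : ℝ)) (e e' : Fin n → E) (w w' : ι → E)
    (hw : ∀ l, w' l = w l + rho • ∑ j, H l j • e' j)
    (he : ∀ i, η i * ‖e' i‖ ^ 2 ≤
      -∑ l, H l i * inner ℝ (w l + rho • ∑ j, H l j • (if j ≤ i then e' j else e j)) (e' i)) :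
    (2 * rho)⁻¹ * ∑ l, ‖w' l‖ ^ 2 + rho * ((n : ℝ) - 1) / 2 * ∑ i, deg i * ‖e' i‖ ^ 2
        + ∑ i, (η i - 3 / 2 * rho * ((n : ℝ) - 1) * deg i) * ‖e' i‖ ^ 2
      ≤ (2 * rho)⁻¹ * ∑ l, ‖w l‖ ^ 2 + rho * ((n : ℝ) - 1) / 2 * ∑ i, deg i * ‖e i‖ ^ 2 := by
  have key : ∀ l, -∑ i, H l i *
      inner ℝ (w l + rho • ∑ j, H l j • (if j ≤ i then e' j else e j)) (e' i)
      ≤ (2 * rho)⁻¹ * (‖w l‖ ^ 2 - ‖w' l‖ ^ 2)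
        + rho * (((n : ℝ) - 1) * ∑ i, (H l i ^ 2 * ‖e' i‖ ^ 2 + H l i ^ 2 * ‖e i‖ ^ 2 / 2)) := by
    intro l
    have h1 : ∀ i, H l i * inner ℝ (w l + rho • ∑ j, H l j • (if j ≤ i then e' j else e j)) (e' i)
        = inner ℝ (w' l) (H l i • e' i) - rho * ∑ j, (if i < j then
          inner ℝ (H l j • e' j - H l j • e j) (H l i • e' i) else 0) := by
      intro i
      have h2 : ∑ j, H l j • (if j ≤ i then e' j else e j) = ∑ j, H l j • e' j
          - ∑ j, (if i < j then H l j • e' j - H l j • e j else 0) := by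
        rw [← Finset.sum_sub_distrib]
        refine Finset.sum_congr rfl fun j _ => ?_
        by_cases h : j ≤ i
        · simp [h, not_lt.2 h]
        · simp [h, not_le.1 h]
      have h3 : ∀ j, (if i < j then inner ℝ (H l j • e' j - H l j • e j) (H l i • e' i) else 0)
          = H l i * inner ℝ (if i < j then H l j • e' j - H l j • e j else 0) (e' i) := by
        intro j
        split_ifs
        · rw [inner_smul_right]
        · simp
      rw [h2, hw, inner_smul_right, smul_sub, ← add_sub_assoc, inner_sub_left, inner_smul_left
        (r := rho), sum_inner (f := fun j => if i < j then H l j • e' j - H l j • e j else 0)]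
      simp_rw [h3]
      rw [← Finset.mul_sum]
      simp
      ring
    have h4 : ∑ i, inner ℝ (w' l) (H l i • e' i) = inner ℝ (w' l) (∑ i, H l i • e' i) := by
      rw [inner_sum]
    have h5 : -inner ℝ (w' l) (∑ i, H l i • e' i) ≤ (2 * rho)⁻¹ * (‖w l‖ ^ 2 - ‖w' l‖ ^ 2) := by
      have h6 : w l = w' l - rho • ∑ i, H l i • e' i := by rw [hw]; abel
      rw [h6, norm_sub_sq_real, inner_smul_right, norm_smul, mul_pow]
      have : 0 ≤ (2 * rho)⁻¹ * (‖rho‖ ^ 2 * ‖∑ i, H l i • e' i‖ ^ 2) := by positivity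
      have h7 : (2 * rho)⁻¹ * (2 * (rho * inner ℝ (w' l) (∑ i, H l i • e' i)))
        = inner ℝ (w' l) (∑ i, H l i • e' i) := by field_simp
      linarith
    have h8 := sum_lt_inner_sub_le (fun i => H l i • e' i) (fun i => H l i • e i)
    simp only [norm_smul, mul_pow, Real.norm_eq_abs, sq_abs] at h8
    simp_rw [h1]
    rw [Finset.sum_sub_distrib, h4, ← Finset.mul_sum]
    have h9 := mul_le_mul_of_nonneg_left h8 hrho.le
    linarith
  have h1 : ∑ i, η i * ‖e' i‖ ^ 2 ≤ ∑ l, ((2 * rho)⁻¹ * (‖w l‖ ^ 2 - ‖w' l‖ ^ 2)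
        + rho * (((n : ℝ) - 1) * ∑ i, (H l i ^ 2 * ‖e' i‖ ^ 2 + H l i ^ 2 * ‖e i‖ ^ 2 / 2))) := by
    refine (Finset.sum_le_sum fun i _ => he i).trans ?_
    rw [Finset.sum_neg_distrib, Finset.sum_comm, ← Finset.sum_neg_distrib]
    exact Finset.sum_le_sum fun l _ => key l
  have h2 : ∑ l, ∑ i, (H l i ^ 2 * ‖e' i‖ ^ 2 + H l i ^ 2 * ‖e i‖ ^ 2 / 2)
      ≤ ∑ i, (deg i * ‖e' i‖ ^ 2 + deg i * ‖e i‖ ^ 2 / 2) := by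
    rw [Finset.sum_comm]
    refine Finset.sum_le_sum fun i _ => ?_
    have : ∑ l, (H l i ^ 2 * ‖e' i‖ ^ 2 + H l i ^ 2 * ‖e i‖ ^ 2 / 2)
      = (∑ l, H l i ^ 2) * (‖e' i‖ ^ 2 + ‖e i‖ ^ 2 / 2) := by
      rw [Finset.sum_mul]; exact Finset.sum_congr rfl fun l _ => by ring
    rw [this]
    have := mul_le_mul_of_nonneg_right (hdeg i)
      (by positivity : 0 ≤ ‖e' i‖ ^ 2 + ‖e i‖ ^ 2 / 2)
    linarith
  rw [Finset.sum_add_distrib, ← Finset.mul_sum, ← Finset.mul_sum, ← Finset.mul_sum,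
    Finset.sum_sub_distrib] at h1
  have h3 := mul_le_mul_of_nonneg_left (mul_le_mul_of_nonneg_left h2 (sub_nonneg.2 hn)) hrho.le
  have h4 : ∑ i, (deg i * ‖e' i‖ ^ 2 + deg i * ‖e i‖ ^ 2 / 2)
      = ∑ i, deg i * ‖e' i‖ ^ 2 + (∑ i, deg i * ‖e i‖ ^ 2) / 2 := by
    rw [Finset.sum_add_distrib, Finset.sum_div]
  have h5 : ∑ i, (η i - 3 / 2 * rho * ((n : ℝ) - 1) * deg i) * ‖e' i‖ ^ 2
      = ∑ i, η i * ‖e' i‖ ^ 2 - 3 / 2 * rho * ((n : ℝ) - 1) * ∑ i, deg i * ‖e' i‖ ^ 2 := by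
    rw [Finset.mul_sum, ← Finset.sum_sub_distrib]
    exact Finset.sum_congr rfl fun i _ => by ring
  rw [h4] at h3
  rw [h5]
  linarith

/-- Convergence of the primal blocks of the multi-block ADMM for the consensus problem
`min ∑ i, g i (x i)` subject to `∑ i, H l i • x i = 0`, from an arbitrary starting point.
`D i x` stands for the derivative of `g i` at `x`, which is strongly monotone with modulus `η i`;
`(x₀, Zs)` is a primal-dual solution. -/
theorem tendsto_admm (H : ι → Fin n → ℝ) {rho : ℝ} (hrho : 0 < rho) (deg η : Fin n → ℝ)
    (hdeg : ∀ i, ∑ l, H l i ^ 2 ≤ deg i)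
    (hη : ∀ i, 3 * ((n : ℝ) - 1) * deg i * rho < 2 * η i)
    (D : Fin n → E → E → ℝ)
    (hmono : ∀ i x y, η i * ‖x - y‖ ^ 2 ≤ D i x (x - y) - D i y (x - y))
    (x₀ : E) (Zs : ι → E) (hstar : ∀ i h, D i x₀ h + ∑ l, H l i * inner ℝ (Zs l) h = 0)
    (hH : ∀ l, ∑ i, H l i = 0) (x : ℕ → Fin n → E) (Z : ℕ → ι → E)
    (hopt : ∀ k i h, D i (x (k + 1) i) h + ∑ l, H l i *
      inner ℝ (Z k l + rho • ∑ j, H l j • (if j ≤ i then x (k + 1) j else x k j)) h = 0)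
    (hdual : ∀ k l, Z (k + 1) l = Z k l + rho • ∑ j, H l j • x (k + 1) j) (i : Fin n) :
    Tendsto (fun k => x k i) atTop (𝓝 x₀) := by
  have hn : 1 ≤ (n : ℝ) := by
    have : 1 ≤ n := by have := i.2; omega
    exact_mod_cast this
  have hcons : ∀ l (y : Fin n → E), ∑ j, H l j • (y j - x₀) = ∑ j, H l j • y j := by
    intro l y
    simp_rw [smul_sub]
    rw [Finset.sum_sub_distrib, ← Finset.sum_smul, hH, zero_smul, sub_zero]
  set V : ℕ → ℝ := fun k => (2 * rho)⁻¹ * ∑ l, ‖Z k l - Zs l‖ ^ 2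
    + rho * ((n : ℝ) - 1) / 2 * ∑ i, deg i * ‖x k i - x₀‖ ^ 2 with hV
  set W : ℕ → ℝ := fun k =>
    ∑ i, (η i - 3 / 2 * rho * ((n : ℝ) - 1) * deg i) * ‖x k i - x₀‖ ^ 2 with hW
  have hc : ∀ i, 0 < η i - 3 / 2 * rho * ((n : ℝ) - 1) * deg i := fun i => by linarith [hη i]
  have hstep : ∀ k, V (k + 1) + W (k + 1) ≤ V k := by
    intro k
    refine admm_energy_decrease H hrho deg η hdeg hn (fun i => x k i - x₀)
      (fun i => x (k + 1) i - x₀) (fun l => Z k l - Zs l) (fun l => Z (k + 1) l - Zs l) ?_ ?_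
    · intro l
      rw [hcons, hdual]; abel
    · intro i
      refine (hmono i _ _).trans (le_of_eq ?_)
      have h1 := hopt k i (x (k + 1) i - x₀)
      have h2 := hstar i (x (k + 1) i - x₀)
      have h3 : ∀ l, H l i * inner ℝ (Z k l - Zs l + rho • ∑ j, H l j •
            (if j ≤ i then x (k + 1) j - x₀ else x k j - x₀)) (x (k + 1) i - x₀)
          = H l i * inner ℝ (Z k l + rho • ∑ j, H l j •
            (if j ≤ i then x (k + 1) j else x k j)) (x (k + 1) i - x₀)
            - H l i * inner ℝ (Zs l) (x (k + 1) i - x₀) := by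
        intro l
        have : ∀ j, (if j ≤ i then x (k + 1) j - x₀ else x k j - x₀)
          = (if j ≤ i then x (k + 1) j else x k j) - x₀ := by intro j; split_ifs <;> rfl
        simp_rw [this]
        rw [hcons, sub_add_eq_add_sub, inner_sub_left, mul_sub]
      simp_rw [h3]
      rw [Finset.sum_sub_distrib]
      linarith
  have hW0 : ∀ k, 0 ≤ W k := fun k =>
    Finset.sum_nonneg fun i _ => mul_nonneg (hc i).le (sq_nonneg _)
  have hdeg0 : ∀ i, 0 ≤ deg i := fun i =>
    (Finset.sum_nonneg fun l _ => sq_nonneg (H l i)).trans (hdeg i)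
  have hV0 : ∀ k, 0 ≤ V k := fun k => by
    have := sub_nonneg.2 hn
    have : 0 ≤ ∑ i, deg i * ‖x k i - x₀‖ ^ 2 :=
      Finset.sum_nonneg fun i _ => mul_nonneg (hdeg0 i) (sq_nonneg _)
    positivity
  have hanti : Antitone V := antitone_nat_of_succ_le fun k => by linarith [hstep k, hW0 (k + 1)]
  have hlim := tendsto_atTop_ciInf hanti ⟨0, by rintro _ ⟨k, rfl⟩; exact hV0 k⟩
  have hW1 : Tendsto (fun k => W (k + 1)) atTop (𝓝 0) := by
    refine squeeze_zero (fun k => hW0 _) (fun k => (by linarith [hstep k] : _ ≤ V k - V (k + 1))) ?_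
    simpa using hlim.sub (hlim.comp (tendsto_add_atTop_nat 1))
  have hsq : Tendsto (fun k => ‖x (k + 1) i - x₀‖ ^ 2) atTop (𝓝 0) := by
    have h1 := hW1.const_mul (η i - 3 / 2 * rho * ((n : ℝ) - 1) * deg i)⁻¹
    rw [mul_zero] at h1
    refine squeeze_zero (fun k => sq_nonneg _) (fun k => ?_) h1
    rw [← div_eq_inv_mul, le_div_iff₀ (hc i), mul_comm]
    exact Finset.single_le_sum (f := fun i => (η i - 3 / 2 * rho * ((n : ℝ) - 1) * deg i)
      * ‖x (k + 1) i - x₀‖ ^ 2) (fun i _ => mul_nonneg (hc i).le (sq_nonneg _)) (Finset.mem_univ i)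
  rw [← tendsto_add_atTop_iff_nat 1, tendsto_iff_norm_sub_tendsto_zero]
  simpa [Real.sqrt_sq (norm_nonneg _)] using hsq.sqrt

end ADMM

/-! ### Dictionaries as a Euclidean space -/

section Frobenius

open CoLLA

variable {d u : ℕ}

theorem frobenius_norm_sq (A : Dict d u) : ‖A‖ ^ 2 = ∑ i, ∑ j, A i j ^ 2 := by
  rw [Matrix.frobenius_norm_def, ← Real.sqrt_eq_rpow, Real.sq_sqrt (by positivity)]
  simp

/-- The inner product `⟪A, B⟫ = tr (Aᵀ B)` of dictionaries. It extends the Frobenius normed space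
structure, so that its norm is the Frobenius norm by definition. -/
noncomputable instance frobeniusInnerProductSpace : InnerProductSpace ℝ (Dict d u) :=
  { Matrix.frobeniusNormedSpace with
    inner := fun A B => (Aᵀ * B).trace
    norm_sq_eq_re_inner := fun A => by
      rw [frobenius_norm_sq, Finset.sum_comm]
      simp [Matrix.trace, Matrix.mul_apply, sq]
    conj_inner_symm := fun A B => by simp [Matrix.trace, Matrix.mul_apply, mul_comm]
    add_left := fun A B C => by simp [Matrix.add_mul]
    smul_left := fun A B C => by simp }

theorem inner_eq_trace (A B : Dict d u) : inner ℝ A B = (Aᵀ * B).trace := rfl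

end Frobenius

/-! ### Quadratic functions -/

theorem eq_zero_of_forall_mul_add_sq_mul_nonneg {a b : ℝ}
    (h : ∀ t : ℝ, 0 ≤ t * a + t ^ 2 * b) : a = 0 := by
  by_contra ha
  have hb : 0 < |b| + 1 := by positivity
  have h1 := h (-(a / (|b| + 1)))
  have h2 : (-(a / (|b| + 1))) * a + (-(a / (|b| + 1))) ^ 2 * b
      = a ^ 2 / (|b| + 1) ^ 2 * (b - |b| - 1) := by field_simp; ring
  have h3 : 0 < a ^ 2 / (|b| + 1) ^ 2 := by positivity
  nlinarith [le_abs_self b]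

/-- `g` is a quadratic function with derivative `D x` at `x` and homogeneous quadratic part `q`. -/
structure IsQuadratic {E : Type*} [AddCommGroup E] [Module ℝ E] (g : E → ℝ) (D : E → E →ₗ[ℝ] ℝ)
    (q : E → ℝ) : Prop where
  add : ∀ x h, g (x + h) = g x + D x h + q h
  smul : ∀ (t : ℝ) h, q (t • h) = t ^ 2 * q h

namespace IsQuadratic

section Linear

variable {E : Type*} [AddCommGroup E] [Module ℝ E] {g : E → ℝ} {D : E → E →ₗ[ℝ] ℝ} {q : E → ℝ}

theorem deriv_eq_zero_of_isMin (hg : IsQuadratic g D q) {x : E} (hx : ∀ y, g x ≤ g y) (h : E) :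
    D x h = 0 := by
  refine eq_zero_of_forall_mul_add_sq_mul_nonneg (b := q h) fun t => ?_
  have h1 := hx (x + t • h)
  rw [hg.add, hg.smul, map_smul, smul_eq_mul] at h1
  linarith

protected theorem sum {ι : Type*} {s : Finset ι} {g : ι → E → ℝ} {D : ι → E → E →ₗ[ℝ] ℝ}
    {q : ι → E → ℝ} (hg : ∀ i ∈ s, IsQuadratic (g i) (D i) (q i)) :
    IsQuadratic (fun x => ∑ i ∈ s, g i x) (fun x => ∑ i ∈ s, D i x) (fun h => ∑ i ∈ s, q i h) where
  add x h := by
    rw [LinearMap.sum_apply, ← Finset.sum_add_distrib, ← Finset.sum_add_distrib]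
    exact Finset.sum_congr rfl fun i hi => (hg i hi).add x h
  smul t h := by
    rw [Finset.mul_sum]
    exact Finset.sum_congr rfl fun i hi => (hg i hi).smul t h

end Linear

variable {E : Type*} [NormedAddCommGroup E] [NormedSpace ℝ E] {g : E → ℝ} {D : E → E →ₗ[ℝ] ℝ}
  {q : E → ℝ}

theorem le_of_strongConvexOn (hg : IsQuadratic g D q) {η : ℝ}
    (hη : StrongConvexOn Set.univ η g) (h : E) : η / 2 * ‖h‖ ^ 2 ≤ q h := by
  have h1 : g ((1 / 2 : ℝ) • h + (1 / 2 : ℝ) • (0 : E)) ≤ _ :=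
    hη.2 (Set.mem_univ h) (Set.mem_univ (0 : E)) (by norm_num) (by norm_num) (by norm_num)
  have h2 := hg.add 0 h
  have h3 := hg.add 0 ((1 / 2 : ℝ) • h)
  rw [zero_add] at h2 h3
  rw [smul_zero, add_zero, h3, h2, hg.smul, map_smul] at h1
  simp only [smul_eq_mul, sub_zero] at h1
  linarith

theorem deriv_mono_of_strongConvexOn (hg : IsQuadratic g D q) {η : ℝ}
    (hη : StrongConvexOn Set.univ η g) (x y : E) :
    η * ‖x - y‖ ^ 2 ≤ D x (x - y) - D y (x - y) := by
  have h1 := hg.le_of_strongConvexOn hη (x - y)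
  have h2 := hg.add y (x - y)
  have h3 := hg.add x (-(x - y))
  have h4 : q (-(x - y)) = q (x - y) := by
    have := hg.smul (-1) (x - y)
    simpa using this
  rw [add_sub_cancel] at h2
  rw [h4, map_neg, show x + -(x - y) = y by abel] at h3
  linarith

end IsQuadratic

/-! ### The local objectives and the augmented Lagrangian -/

section Objectives

open CoLLA

variable {N d u : ℕ} {mu lam rho : ℝ}

theorem lassoObjective_nonneg (hmu : 0 ≤ mu) {α : Fin d → ℝ} {Γ : Matrix (Fin d) (Fin d) ℝ}
    (hΓ : Γ.PosSemidef) (L : Dict d u) (s : Fin u → ℝ) : 0 ≤ lassoObjective mu α Γ L s := by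
  have h1 := hΓ.dotProduct_mulVec_nonneg (α - L *ᵥ s)
  rw [star_trivial] at h1
  unfold lassoObjective
  have : 0 ≤ ∑ j, |s j| := Finset.sum_nonneg fun _ _ => abs_nonneg _
  positivity

/-- The derivative of `L ↦ lassoObjective mu α Γ L s` at `L`. -/
def lassoDeriv (α : Fin d → ℝ) (Γ : Matrix (Fin d) (Fin d) ℝ) (s : Fin u → ℝ) (L : Dict d u) :
    Dict d u →ₗ[ℝ] ℝ where
  toFun h := -(2 * ((h *ᵥ s) ⬝ᵥ (Γ *ᵥ (α - L *ᵥ s))))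
  map_add' h k := by simp [Matrix.add_mulVec]; ring
  map_smul' t h := by simp [Matrix.smul_mulVec]; ring

theorem isQuadratic_lassoObjective {α : Fin d → ℝ} {Γ : Matrix (Fin d) (Fin d) ℝ}
    (hΓ : Γ.PosSemidef) (s : Fin u → ℝ) :
    IsQuadratic (fun L => lassoObjective mu α Γ L s) (lassoDeriv α Γ s)
      (fun h => (h *ᵥ s) ⬝ᵥ (Γ *ᵥ (h *ᵥ s))) where
  add L h := by
    have hsym : Γᵀ = Γ := by simpa using hΓ.isHermitian.eq
    have h1 : (α - L *ᵥ s) ⬝ᵥ (Γ *ᵥ (h *ᵥ s)) = (h *ᵥ s) ⬝ᵥ (Γ *ᵥ (α - L *ᵥ s)) := by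
      rw [Matrix.dotProduct_mulVec, ← Matrix.mulVec_transpose, hsym, dotProduct_comm]
    have h2 : α - (L + h) *ᵥ s = (α - L *ᵥ s) - h *ᵥ s := by rw [Matrix.add_mulVec]; abel
    simp only [lassoObjective, lassoDeriv, LinearMap.coe_mk, AddHom.coe_mk]
    rw [h2]
    generalize α - L *ᵥ s = r at *
    generalize h *ᵥ s = v at *
    rw [Matrix.mulVec_sub, sub_dotProduct, dotProduct_sub, dotProduct_sub, h1]
    ring
  smul t h := by simp [Matrix.smul_mulVec, Matrix.mulVec_smul]; ring

variable {α : ℕ → Fin N → Fin d → ℝ} {Γ : ℕ → Fin N → Matrix (Fin d) (Fin d) ℝ}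
  {s : ℕ → Fin N → Fin u → ℝ}

/-- The derivative of `localObjective mu lam α Γ s T i` at `L`. -/
noncomputable def localDeriv (lam : ℝ) (α : ℕ → Fin N → Fin d → ℝ)
    (Γ : ℕ → Fin N → Matrix (Fin d) (Fin d) ℝ) (s : ℕ → Fin N → Fin u → ℝ) (T : ℕ) (i : Fin N)
    (L : Dict d u) : Dict d u →ₗ[ℝ] ℝ :=
  (T : ℝ)⁻¹ • ∑ t ∈ Finset.Icc 1 T, lassoDeriv (α t i) (Γ t i) (s t i) L
    + (2 * lam) • (innerₗ (Dict d u) L)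

/-- The homogeneous quadratic part of `localObjective mu lam α Γ s T i`. -/
noncomputable def localQuad (lam : ℝ) (Γ : ℕ → Fin N → Matrix (Fin d) (Fin d) ℝ)
    (s : ℕ → Fin N → Fin u → ℝ) (T : ℕ) (i : Fin N) (h : Dict d u) : ℝ :=
  (T : ℝ)⁻¹ * ∑ t ∈ Finset.Icc 1 T, (h *ᵥ s t i) ⬝ᵥ (Γ t i *ᵥ (h *ᵥ s t i)) + lam * ‖h‖ ^ 2

theorem isQuadratic_localObjective (hΓ : ∀ t i, (Γ t i).PosSemidef) (T : ℕ) (i : Fin N) :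
    IsQuadratic (localObjective mu lam α Γ s T i) (localDeriv lam α Γ s T i)
      (localQuad lam Γ s T i) where
  add L h := by
    have := (IsQuadratic.sum (s := Finset.Icc 1 T) fun t _ =>
      isQuadratic_lassoObjective (mu := mu) (α := α t i) (hΓ t i) (s t i)).add L h
    simp only [localObjective, localDeriv, localQuad, this, LinearMap.add_apply,
      LinearMap.smul_apply, smul_eq_mul, norm_add_sq_real, innerₗ_apply_apply]
    ring
  smul t h := by
    have := (IsQuadratic.sum (s := Finset.Icc 1 T) fun t _ =>
      isQuadratic_lassoObjective (mu := mu) (α := α t i) (hΓ t i) (s t i)).smul t h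
    simp only [localQuad, this, norm_smul, mul_pow, Real.norm_eq_abs, sq_abs]
    ring

theorem le_localObjective (hmu : 0 ≤ mu) (hΓ : ∀ t i, (Γ t i).PosSemidef) (T : ℕ) (i : Fin N)
    (L : Dict d u) : lam * ‖L‖ ^ 2 ≤ localObjective mu lam α Γ s T i L := by
  unfold localObjective
  have := Finset.sum_nonneg fun t (_ : t ∈ Finset.Icc 1 T) =>
    lassoObjective_nonneg (α := α t i) hmu (hΓ t i) L (s t i)
  have : 0 ≤ (T : ℝ)⁻¹ * ∑ t ∈ Finset.Icc 1 T, lassoObjective mu (α t i) (Γ t i) L (s t i) := by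
    positivity
  linarith

theorem le_localQuad (hΓ : ∀ t i, (Γ t i).PosSemidef) (T : ℕ) (i : Fin N)
    (h : Dict d u) : lam * ‖h‖ ^ 2 ≤ localQuad lam Γ s T i h := by
  unfold localQuad
  have := Finset.sum_nonneg fun t (_ : t ∈ Finset.Icc 1 T) =>
    (hΓ t i).dotProduct_mulVec_nonneg (h *ᵥ s t i)
  simp only [star_trivial] at this
  have : 0 ≤ (T : ℝ)⁻¹ * ∑ t ∈ Finset.Icc 1 T, (h *ᵥ s t i) ⬝ᵥ (Γ t i *ᵥ (h *ᵥ s t i)) := by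
    positivity
  linarith

theorem continuous_localObjective (T : ℕ) (i : Fin N) :
    Continuous (localObjective mu lam α Γ s T i) := by
  unfold localObjective
  have : ∀ t, Continuous fun L : Dict d u => lassoObjective mu (α t i) (Γ t i) L (s t i) :=
    fun t => by unfold lassoObjective; fun_prop
  exact (continuous_const.mul (continuous_finsetSum _ fun t _ => this t)).add
    (continuous_const.mul (continuous_norm.pow 2))

theorem exists_isMin_sum_localObjective (hN : 0 < N) (hmu : 0 ≤ mu) (hlam : 0 < lam)
    (hΓ : ∀ t i, (Γ t i).PosSemidef) (T : ℕ) :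
    ∃ X : Dict d u, ∀ Y, ∑ i, localObjective mu lam α Γ s T i X
      ≤ ∑ i, localObjective mu lam α Γ s T i Y := by
  refine Continuous.exists_forall_le
    (continuous_finsetSum _ fun i _ => continuous_localObjective T i) ?_
  have h1 : Tendsto (fun L : Dict d u => lam * ‖L‖ ^ 2) (cocompact _) atTop :=
    ((tendsto_pow_atTop two_ne_zero).comp tendsto_norm_cocompact_atTop).const_mul_atTop hlam
  refine tendsto_atTop_mono (fun L => ?_) h1
  refine (le_localObjective (α := α) (s := s) hmu hΓ T (⟨0, hN⟩ : Fin N) L).trans ?_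
  refine Finset.single_le_sum (f := fun i => localObjective mu lam α Γ s T i L) (fun i _ => ?_)
    (Finset.mem_univ _)
  exact le_trans (by positivity) (le_localObjective hmu hΓ T i L)

variable {G : SimpleGraph (Fin N)}

theorem constraint_sweepArg_add (A B : Fin N → Dict d u) (i : Fin N) (Y h : Dict d u)
    (l : Edge G) : constraint G (sweepArg A B i (Y + h)) l
      = constraint G (sweepArg A B i Y) l + incidence G l i • h := by
  have h1 : sweepArg A B i (Y + h) = sweepArg A B i Y + Pi.single i h := by
    ext1 j
    rcases lt_trichotomy j i with hj | rfl | hj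
    · simp [sweepArg, hj, hj.ne]
    · simp [sweepArg]
    · simp [sweepArg, hj.ne', not_lt.2 hj.le]
  simp [constraint, h1, Finset.sum_add_distrib, Pi.single_apply]

/-- The first-order condition for the update of the `i`-th block. -/
theorem localDeriv_add_eq_zero (hΓ : ∀ t i, (Γ t i).PosSemidef) {T : ℕ} {A B : Fin N → Dict d u}
    {Z : Edge G → Dict d u} {i : Fin N} {Y : Dict d u}
    (hY : ∀ X, augLagrangian G mu lam rho α Γ s T (sweepArg A B i Y) Z
      ≤ augLagrangian G mu lam rho α Γ s T (sweepArg A B i X) Z) (h : Dict d u) :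
    localDeriv lam α Γ s T i Y h + ∑ l, incidence G l i *
      inner ℝ (Z l + rho • constraint G (sweepArg A B i Y) l) h = 0 := by
  refine eq_zero_of_forall_mul_add_sq_mul_nonneg (b := localQuad lam Γ s T i h
    + rho / 2 * ∑ l, incidence G l i ^ 2 * ‖h‖ ^ 2) fun t => ?_
  have h1 := hY (Y + t • h)
  have h2 : ∑ j, localObjective mu lam α Γ s T j (sweepArg A B i (Y + t • h) j)
      = ∑ j, localObjective mu lam α Γ s T j (sweepArg A B i Y j)
        + (t * localDeriv lam α Γ s T i Y h + t ^ 2 * localQuad lam Γ s T i h) := by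
    have hq := isQuadratic_localObjective (mu := mu) (lam := lam) (α := α) (s := s) hΓ T i
    have : ∀ j, localObjective mu lam α Γ s T j (sweepArg A B i (Y + t • h) j)
      = localObjective mu lam α Γ s T j (sweepArg A B i Y j) + (if j = i then
        t * localDeriv lam α Γ s T i Y h + t ^ 2 * localQuad lam Γ s T i h else 0) := by
      intro j
      rcases eq_or_ne j i with rfl | hj
      · simp only [sweepArg, lt_irrefl, if_false, if_true]
        rw [hq.add, hq.smul, map_smul, smul_eq_mul, add_assoc]
      · simp [sweepArg, hj]
    rw [Finset.sum_congr rfl fun j _ => this j, Finset.sum_add_distrib]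
    simp
  have h3 : ∀ l : Edge G, (‖constraint G (sweepArg A B i Y) l + incidence G l i • t • h‖) ^ 2
      = ‖constraint G (sweepArg A B i Y) l‖ ^ 2
        + (t * (2 * (incidence G l i * inner ℝ (constraint G (sweepArg A B i Y) l) h))
          + t ^ 2 * (incidence G l i ^ 2 * ‖h‖ ^ 2)) := by
    intro l
    rw [norm_add_sq_real, norm_smul, norm_smul, mul_pow, mul_pow, Real.norm_eq_abs,
      Real.norm_eq_abs, sq_abs, sq_abs, inner_smul_right, inner_smul_right]
    ring
  simp only [augLagrangian, ← inner_eq_trace, h2, constraint_sweepArg_add, h3, inner_add_right,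
    inner_smul_right, Finset.sum_add_distrib, ← Finset.mul_sum] at h1
  have h4 : ∑ l : Edge G, incidence G l i *
      inner ℝ (Z l + rho • constraint G (sweepArg A B i Y) l) h
      = ∑ l : Edge G, incidence G l i * inner ℝ (Z l) h
        + rho * ∑ l : Edge G, incidence G l i * inner ℝ (constraint G (sweepArg A B i Y) l) h := by
    rw [Finset.mul_sum, ← Finset.sum_add_distrib]
    refine Finset.sum_congr rfl fun l _ => ?_
    rw [inner_add_left, inner_smul_left]
    simp only [conj_trivial]
    ring
  have h5 : ∑ l : Edge G, incidence G l i * (t * inner ℝ (Z l) h)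
      = t * ∑ l : Edge G, incidence G l i * inner ℝ (Z l) h := by
    rw [Finset.mul_sum]
    exact Finset.sum_congr rfl fun l _ => by ring
  rw [h4]
  rw [h5] at h1
  nlinarith [h1]

end Objectives

/-! ### The incidence matrix of the communication graph -/

section Graph

open CoLLA

variable {N : ℕ} {G : SimpleGraph (Fin N)}

theorem sum_incidence (l : Edge G) : ∑ i, incidence G l i = 0 := by
  have h := l.2.1.ne'
  have : ∀ i, incidence G l i
      = (if i = l.1.1 then 1 else 0) - (if i = l.1.2 then 1 else 0) := by
    intro i
    simp only [incidence, Matrix.of_apply]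
    split_ifs with h1 h2 <;> simp_all
  simp [this]

theorem sum_incidence_sq_le (i : Fin N) :
    ∑ l, incidence G l i ^ 2 ≤ ((G.neighborSet i).ncard : ℝ) := by
  classical
  have h1 : ∀ l : Edge G, incidence G l i ^ 2 = if i = l.1.1 ∨ i = l.1.2 then 1 else 0 := by
    intro l
    simp only [incidence, Matrix.of_apply]
    split_ifs <;> simp_all
  simp_rw [h1]
  rw [Finset.sum_boole, Set.ncard_eq_toFinset_card']
  norm_cast
  refine Finset.card_le_card_of_injOn (fun l => if i = l.1.1 then l.1.2 else l.1.1) ?_ ?_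
  · intro l hl
    simp only [Finset.coe_filter, Finset.mem_univ, true_and, Set.mem_ofPred_eq] at hl
    simp only [Set.coe_toFinset, SimpleGraph.mem_neighborSet]
    rcases eq_or_ne i l.1.1 with h | h
    · rw [if_pos h, h]; exact l.2.2
    · rw [if_neg h, hl.resolve_left h]; exact l.2.2.symm
  · intro l hl l' hl' heq
    simp only [Finset.coe_filter, Finset.mem_univ, true_and, Set.mem_ofPred_eq] at hl hl'
    have h2 := l.2.1
    have h3 := l'.2.1
    refine Subtype.ext (Prod.ext ?_ ?_)
    all_goals
      by_cases h4 : i = l.1.1 <;> by_cases h5 : i = l'.1.1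
      all_goals simp only [h4, h5, if_true, if_false] at heq hl hl'
      all_goals grind

/-- In a connected graph the range of the transposed incidence matrix is the space of vectors with
sum zero. -/
theorem exists_sum_incidence_smul_eq {E : Type*} [AddCommGroup E] [Module ℝ E] (hG : G.Connected)
    (c : Fin N → E) (hc : ∑ i, c i = 0) :
    ∃ Z : Edge G → E, ∀ i, ∑ l, incidence G l i • Z l = c i := by
  classical
  let Φ : (Edge G → E) →ₗ[ℝ] (Fin N → E) :=
    { toFun := fun Z i => ∑ l, incidence G l i • Z l
      map_add' := fun Z Z' => by ext i; simp [Finset.sum_add_distrib]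
      map_smul' := fun t Z => by
        ext i
        simp only [Pi.smul_apply, RingHom.id_apply, Finset.smul_sum]
        exact Finset.sum_congr rfl fun l _ => smul_comm _ _ _ }
  have hlt : ∀ i j, G.Adj i j → i < j → ∀ v : E,
      (Pi.single i v - Pi.single j v : Fin N → E) ∈ LinearMap.range Φ := by
    intro i j hij hlt v
    let l₀ : Edge G := ⟨(i, j), hlt, hij⟩
    refine ⟨Pi.single l₀ v, ?_⟩
    ext q
    have h1 : ∀ l, incidence G l q • (Pi.single l₀ v : Edge G → E) l
        = if l = l₀ then incidence G l₀ q • v else 0 := by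
      intro l
      by_cases h : l = l₀
      · subst h; simp
      · simp [h]
    simp only [Φ, LinearMap.coe_mk, AddHom.coe_mk, h1, Finset.sum_ite_eq', Finset.mem_univ, if_true]
    have h2 : incidence G l₀ q = if q = i then 1 else if q = j then -1 else 0 := rfl
    rw [h2]
    simp only [Pi.sub_apply, Pi.single_apply]
    have := hlt.ne
    split_ifs <;> simp_all
  have hadj : ∀ i j, G.Adj i j → ∀ v : E,
      (Pi.single i v - Pi.single j v : Fin N → E) ∈ LinearMap.range Φ := by
    intro i j hij v
    rcases lt_or_gt_of_ne hij.ne with h | h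
    · exact hlt i j hij h v
    · have := (LinearMap.range Φ).neg_mem (hlt j i hij.symm h v)
      rwa [neg_sub] at this
  have hreach : ∀ i j, ∀ v : E,
      (Pi.single i v - Pi.single j v : Fin N → E) ∈ LinearMap.range Φ := by
    intro i j v
    obtain ⟨p⟩ := hG.preconnected i j
    induction p with
    | nil => simp
    | cons h p ih =>
      have := (LinearMap.range Φ).add_mem (hadj _ _ h v) ih
      rwa [sub_add_sub_cancel] at this
  obtain ⟨i₀⟩ := hG.nonempty
  have hmem : c ∈ LinearMap.range Φ := by
    have h1 : c = ∑ i, (Pi.single i (c i) - Pi.single i₀ (c i)) := by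
      rw [Finset.sum_sub_distrib, Finset.univ_sum_single]
      have : ∑ i, (Pi.single i₀ (c i) : Fin N → E) = Pi.single i₀ (∑ i, c i) := by
        ext j
        rcases eq_or_ne j i₀ with rfl | h
        · simp
        · simp [h]
      rw [this, hc]
      simp
    rw [h1]
    exact Submodule.sum_mem _ fun i _ => hreach _ _ _
  obtain ⟨Z, hZ⟩ := hmem
  exact ⟨Z, fun i => congrFun hZ i⟩

end Graph

/-! ### Convergence of the inner loops -/

section InnerLoop

open CoLLA

variable {N d u : ℕ} {G : SimpleGraph (Fin N)} {mu lam rho : ℝ} {L₀ : Fin N → Dict d u}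
  {Z₀ : Edge G → Dict d u} {α : ℕ → Fin N → Fin d → ℝ}
  {Γ : ℕ → Fin N → Matrix (Fin d) (Fin d) ℝ} {s : ℕ → Fin N → Fin u → ℝ}
  {Lk : ℕ → ℕ → Fin N → Dict d u} {Zk : ℕ → ℕ → Edge G → Dict d u}
  {L : ℕ → Fin N → Dict d u} {Z : ℕ → Edge G → Dict d u}

/-- The inner loop at time `T + 1` drives all agents to a common minimizer of the sum of the local
objectives. -/
theorem CoLLA.IsRun.exists_tendsto (hG : G.Connected) (hmu : 0 ≤ mu) (hlam : 0 < lam)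
    (hrho : 0 < rho) (hΓ : ∀ t i, (Γ t i).PosSemidef)
    (hrun : IsRun G mu lam rho L₀ Z₀ α Γ s Lk Zk L Z) {η : Fin N → ℝ}
    (hη : ∀ T, 1 ≤ T → ∀ i, StrongConvexOn Set.univ (η i) (localObjective mu lam α Γ s T i))
    (hrho_small : ∀ i, 3 * ((N : ℝ) - 1) * ((G.neighborSet i).ncard : ℝ) * rho < 2 * η i) (T : ℕ) :
    ∃ X : Dict d u, (∀ i, Tendsto (fun k => Lk (T + 1) k i) atTop (𝓝 X)) ∧
      (∀ i, L (T + 1) i = X) ∧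
      ∀ Y, ∑ i, localObjective mu lam α Γ s (T + 1) i X
        ≤ ∑ i, localObjective mu lam α Γ s (T + 1) i Y := by
  have hN : 0 < N := by
    obtain ⟨i⟩ := hG.nonempty
    exact i.pos
  obtain ⟨X, hX⟩ := exists_isMin_sum_localObjective (α := α) (s := s) hN hmu hlam hΓ (T + 1)
  have hquad := fun i => isQuadratic_localObjective (mu := mu) (lam := lam) (α := α) (s := s) hΓ
    (T + 1) i
  have hsum := IsQuadratic.sum (s := Finset.univ) fun i _ => hquad i
  -- a dual solution exists since the gradients of the local objectives sum to zero at `X`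
  obtain ⟨Zs, hZs⟩ := exists_sum_incidence_smul_eq hG (fun i => -(InnerProductSpace.toDual ℝ
    (Dict d u)).symm (LinearMap.toContinuousLinearMap (localDeriv lam α Γ s (T + 1) i X))) (by
      refine ext_inner_right ℝ fun h => ?_
      simp only [sum_inner, inner_neg_left, InnerProductSpace.toDual_symm_apply, inner_zero_left,
        Finset.sum_neg_distrib, neg_eq_zero]
      have := hsum.deriv_eq_zero_of_isMin hX h
      rw [LinearMap.sum_apply] at this
      exact this)
  have hconv : ∀ i, Tendsto (fun k => Lk (T + 1) k i) atTop (𝓝 X) := by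
    refine tendsto_admm (incidence G) hrho (fun i => ((G.neighborSet i).ncard : ℝ)) η
      sum_incidence_sq_le hrho_small (fun i x h => localDeriv lam α Γ s (T + 1) i x h)
      (fun i => (hquad i).deriv_mono_of_strongConvexOn (hη (T + 1) (by omega) i)) X Zs
      (fun i h => ?_) sum_incidence (Lk (T + 1)) (Zk (T + 1)) (fun k i h => ?_)
      (hrun.dual_step T)
    · have : ∑ l, incidence G l i * inner ℝ (Zs l) h = inner ℝ (∑ l, incidence G l i • Zs l) h := by
        rw [sum_inner]
        exact Finset.sum_congr rfl fun l _ => by rw [inner_smul_left]; simp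
      rw [this, hZs, inner_neg_left, InnerProductSpace.toDual_symm_apply]
      simp
    · rw [← localDeriv_add_eq_zero hΓ (hrun.primal_step T k i) h]
      have : ∀ j, sweepArg (Lk (T + 1) (k + 1)) (Lk (T + 1) k) i (Lk (T + 1) (k + 1) i) j
          = if j ≤ i then Lk (T + 1) (k + 1) j else Lk (T + 1) k j := by
        intro j
        rcases lt_trichotomy j i with h | rfl | h
        · simp [sweepArg, h, h.le]
        · simp [sweepArg]
        · simp [sweepArg, not_lt.2 h.le, not_le.2 h, h.ne']
      simp only [constraint, this]
  exact ⟨X, hconv, fun i => by rw [hrun.stable_dict]; exact (hconv i).limUnder_eq, hX⟩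

end InnerLoop

/-! ### The LASSO problem -/

theorem differentiableAt_of_abs_sub_le {E : Type*} [NormedAddCommGroup E] [NormedSpace ℝ E]
    [FiniteDimensional ℝ E] {f : E → ℝ} {x : E} (D : E →ₗ[ℝ] ℝ) {ε : E → ℝ}
    (hε : Tendsto ε (𝓝 x) (𝓝 0)) (h : ∀ y, |f y - f x - D (y - x)| ≤ ε y * ‖y - x‖) :
    DifferentiableAt ℝ f x := by
  refine HasFDerivAt.differentiableAt (f' := LinearMap.toContinuousLinearMap D) ?_
  rw [hasFDerivAt_iff_isLittleO]
  refine Asymptotics.isLittleO_iff.2 fun c hc => ?_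
  filter_upwards [hε.eventually_le_const hc] with y hy
  exact (h y).trans (mul_le_mul_of_nonneg_right hy (norm_nonneg _))

section Lasso

open CoLLA

variable {d u : ℕ} {mu A B R S : ℝ} {α : Fin d → ℝ} {Γ : Matrix (Fin d) (Fin d) ℝ}

theorem abs_dotProduct_mulVec_le (Γ : Matrix (Fin d) (Fin d) ℝ) (v w : Fin d → ℝ) :
    |v ⬝ᵥ (Γ *ᵥ w)| ≤ (∑ i, ∑ j, |Γ i j|) * (‖v‖ * ‖w‖) := by
  have h1 : v ⬝ᵥ (Γ *ᵥ w) = ∑ i, ∑ j, Γ i j * (v i * w j) := by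
    simp only [dotProduct, Matrix.mulVec, Finset.mul_sum]
    exact Finset.sum_congr rfl fun i _ => Finset.sum_congr rfl fun j _ => by ring
  rw [h1, Finset.sum_mul]
  refine (Finset.abs_sum_le_sum_abs _ _).trans (Finset.sum_le_sum fun i _ => ?_)
  rw [Finset.sum_mul]
  refine (Finset.abs_sum_le_sum_abs _ _).trans (Finset.sum_le_sum fun j _ => ?_)
  rw [abs_mul, abs_mul]
  gcongr
  · exact norm_le_pi_norm v i
  · exact norm_le_pi_norm w j

theorem abs_entry_le_norm (L : Dict d u) (i : Fin d) (j : Fin u) : |L i j| ≤ ‖L‖ := by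
  refine abs_le_of_sq_le_sq ?_ (norm_nonneg _)
  rw [frobenius_norm_sq L]
  have h1 : L i j ^ 2 ≤ ∑ j, L i j ^ 2 :=
    Finset.single_le_sum (f := fun j => L i j ^ 2) (fun _ _ => sq_nonneg _) (Finset.mem_univ j)
  exact h1.trans (Finset.single_le_sum (f := fun i => ∑ j, L i j ^ 2)
    (fun _ _ => Finset.sum_nonneg fun _ _ => sq_nonneg _) (Finset.mem_univ i))

theorem norm_mulVec_le_norm_mul_sum_abs (L : Dict d u) (s : Fin u → ℝ) :
    ‖L *ᵥ s‖ ≤ ‖L‖ * ∑ j, |s j| := by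
  refine (pi_norm_le_iff_of_nonneg (by positivity)).2 fun i => ?_
  rw [Finset.mul_sum, Real.norm_eq_abs]
  change |∑ j, L i j * s j| ≤ _
  refine (Finset.abs_sum_le_sum_abs _ _).trans (Finset.sum_le_sum fun j _ => ?_)
  rw [abs_mul]
  gcongr
  exact abs_entry_le_norm L i j

/-- Quantitative bounds on the ridge estimator `α` and the Hessian `Γ` of a task. -/
structure IsBoundedTask (A B : ℝ) (α : Fin d → ℝ) (Γ : Matrix (Fin d) (Fin d) ℝ) : Prop where
  posSemidef : Γ.PosSemidef
  norm_le : ‖α‖ ≤ A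
  sum_abs_le : ∑ i, ∑ j, |Γ i j| ≤ B

namespace IsBoundedTask

theorem nonneg_left (h : IsBoundedTask A B α Γ) : 0 ≤ A := (norm_nonneg _).trans h.norm_le

theorem nonneg_right (h : IsBoundedTask A B α Γ) : 0 ≤ B :=
  le_trans (by positivity) h.sum_abs_le

theorem abs_dotProduct_le (h : IsBoundedTask A B α Γ) {v w : Fin d → ℝ} {a b : ℝ} (hv : ‖v‖ ≤ a)
    (hw : ‖w‖ ≤ b) : |v ⬝ᵥ (Γ *ᵥ w)| ≤ B * (a * b) :=
  (abs_dotProduct_mulVec_le Γ v w).trans (mul_le_mul h.sum_abs_le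
    (mul_le_mul hv hw (norm_nonneg _) ((norm_nonneg _).trans hv)) (by positivity) h.nonneg_right)

theorem norm_residual_le (h : IsBoundedTask A B α Γ) {L : Dict d u} (hL : ‖L‖ ≤ R)
    {s : Fin u → ℝ} (hs : ∑ j, |s j| ≤ S) : ‖α - L *ᵥ s‖ ≤ A + R * S :=
  (norm_sub_le _ _).trans (add_le_add h.norm_le ((norm_mulVec_le_norm_mul_sum_abs L s).trans
    (mul_le_mul hL hs (by positivity) ((norm_nonneg _).trans hL))))

theorem quad_le (h : IsBoundedTask A B α Γ) (k : Dict d u) {s : Fin u → ℝ} (hs : ∑ j, |s j| ≤ S) :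
    (k *ᵥ s) ⬝ᵥ (Γ *ᵥ (k *ᵥ s)) ≤ B * S ^ 2 * ‖k‖ ^ 2 := by
  have h1 : ‖k *ᵥ s‖ ≤ ‖k‖ * S := (norm_mulVec_le_norm_mul_sum_abs k s).trans (by gcongr)
  exact (le_abs_self _).trans ((h.abs_dotProduct_le h1 h1).trans (le_of_eq (by ring)))

theorem lassoObjective_le (h : IsBoundedTask A B α Γ) (hmu : 0 ≤ mu) {L : Dict d u} (hL : ‖L‖ ≤ R)
    {s : Fin u → ℝ} (hs : ∑ j, |s j| ≤ S) :
    lassoObjective mu α Γ L s ≤ B * (A + R * S) ^ 2 + mu * S := by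
  have h1 := h.norm_residual_le hL hs
  have h2 := (le_abs_self _).trans (h.abs_dotProduct_le h1 h1)
  have h3 := mul_le_mul_of_nonneg_left hs hmu
  unfold lassoObjective
  linarith

theorem abs_lassoObjective_sub_le (h : IsBoundedTask A B α Γ) {L L' : Dict d u} (hL : ‖L‖ ≤ R)
    (hL' : ‖L'‖ ≤ R) {s : Fin u → ℝ} (hs : ∑ j, |s j| ≤ S) :
    |lassoObjective mu α Γ L s - lassoObjective mu α Γ L' s|
      ≤ 2 * B * S * (A + R * S) * ‖L - L'‖ := by
  have hsym : Γᵀ = Γ := by simpa using h.posSemidef.isHermitian.eq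
  have h1 : ∀ v w : Fin d → ℝ, v ⬝ᵥ (Γ *ᵥ w) = w ⬝ᵥ (Γ *ᵥ v) := by
    intro v w
    rw [Matrix.dotProduct_mulVec, ← Matrix.mulVec_transpose, hsym, dotProduct_comm]
  have h2 : lassoObjective mu α Γ L s - lassoObjective mu α Γ L' s
      = -(((L - L') *ᵥ s) ⬝ᵥ (Γ *ᵥ ((α - L *ᵥ s) + (α - L' *ᵥ s)))) := by
    have h3 : (L - L') *ᵥ s = (α - L' *ᵥ s) - (α - L *ᵥ s) := by rw [Matrix.sub_mulVec]; abel
    rw [h3]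
    unfold lassoObjective
    generalize α - L *ᵥ s = v
    generalize α - L' *ᵥ s = w
    rw [Matrix.mulVec_add, sub_dotProduct, dotProduct_add, dotProduct_add, h1 v w]
    ring
  have h3 : ‖(L - L') *ᵥ s‖ ≤ ‖L - L'‖ * S :=
    (norm_mulVec_le_norm_mul_sum_abs _ s).trans (by gcongr)
  have h4 := (norm_add_le _ _).trans (add_le_add (h.norm_residual_le hL hs)
    (h.norm_residual_le hL' hs))
  rw [h2, abs_neg]
  exact (h.abs_dotProduct_le h3 h4).trans (le_of_eq (by ring))

theorem lassoObjective_zero_le (h : IsBoundedTask A B α Γ) (L : Dict d u) :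
    lassoObjective mu α Γ L 0 ≤ B * A ^ 2 := by
  have h1 := (le_abs_self _).trans (h.abs_dotProduct_le h.norm_le h.norm_le)
  simpa [lassoObjective, sq] using h1

/-- The `ℓ¹` penalty bounds the sparse codes, whatever the dictionary. -/
theorem sum_abs_solution_le (h : IsBoundedTask A B α Γ) (hmu : 0 < mu) {L : Dict d u}
    {s : Fin u → ℝ} (hs : IsLassoSolution mu α Γ L s) : ∑ j, |s j| ≤ B * A ^ 2 / mu := by
  rw [le_div_iff₀ hmu, mul_comm]
  have h1 := (hs 0).trans (h.lassoObjective_zero_le L)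
  have h2 := h.posSemidef.dotProduct_mulVec_nonneg (α - L *ᵥ s)
  rw [star_trivial] at h2
  unfold lassoObjective at h1
  linarith

end IsBoundedTask

theorem exists_isLassoSolution (hmu : 0 < mu) (hΓ : Γ.PosSemidef) (L : Dict d u) :
    ∃ s, IsLassoSolution mu α Γ L s := by
  refine Continuous.exists_forall_le (by unfold lassoObjective; fun_prop) ?_
  refine tendsto_atTop_mono (fun s => ?_)
    ((tendsto_norm_cocompact_atTop (E := Fin u → ℝ)).const_mul_atTop hmu)
  have h1 := hΓ.dotProduct_mulVec_nonneg (α - L *ᵥ s)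
  rw [star_trivial] at h1
  have h2 : ‖s‖ ≤ ∑ j, |s j| := (pi_norm_le_iff_of_nonneg (by positivity)).2 fun j =>
    Finset.single_le_sum (f := fun j => |s j|) (fun _ _ => abs_nonneg _) (Finset.mem_univ j)
  have h3 := mul_le_mul_of_nonneg_left h2 hmu.le
  unfold lassoObjective
  linarith

theorem bddBelow_lassoObjective (hmu : 0 ≤ mu) (hΓ : Γ.PosSemidef) (L : Dict d u) :
    BddBelow (Set.range (lassoObjective mu α Γ L)) :=
  ⟨0, by rintro _ ⟨s, rfl⟩; exact lassoObjective_nonneg hmu hΓ L s⟩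

theorem taskLoss_le (hmu : 0 ≤ mu) (hΓ : Γ.PosSemidef) (L : Dict d u) (s : Fin u → ℝ) :
    taskLoss mu α Γ L ≤ lassoObjective mu α Γ L s :=
  ciInf_le (bddBelow_lassoObjective hmu hΓ L) s

theorem CoLLA.IsLassoSolution.taskLoss_eq {L : Dict d u} {s : Fin u → ℝ}
    (hs : IsLassoSolution mu α Γ L s) : taskLoss mu α Γ L = lassoObjective mu α Γ L s :=
  le_antisymm (ciInf_le ⟨_, by rintro _ ⟨v, rfl⟩; exact hs v⟩ s) (le_ciInf hs)

theorem taskLoss_nonneg (hmu : 0 ≤ mu) (hΓ : Γ.PosSemidef) (L : Dict d u) :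
    0 ≤ taskLoss mu α Γ L :=
  le_ciInf fun s => lassoObjective_nonneg hmu hΓ L s

namespace IsBoundedTask

theorem taskLoss_le_const (h : IsBoundedTask A B α Γ) (hmu : 0 ≤ mu) (L : Dict d u) :
    taskLoss mu α Γ L ≤ B * A ^ 2 :=
  (taskLoss_le hmu h.posSemidef L 0).trans (h.lassoObjective_zero_le L)

theorem taskLoss_sub_le (h : IsBoundedTask A B α Γ) (hmu : 0 < mu) {L L' : Dict d u}
    (hL : ‖L‖ ≤ R) (hL' : ‖L'‖ ≤ R) : taskLoss mu α Γ L - taskLoss mu α Γ L'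
      ≤ 2 * B * (B * A ^ 2 / mu) * (A + R * (B * A ^ 2 / mu)) * ‖L - L'‖ := by
  obtain ⟨s, hs⟩ := exists_isLassoSolution (α := α) hmu h.posSemidef L'
  have h1 := taskLoss_le (α := α) hmu.le h.posSemidef L s
  have h2 := (le_abs_self _).trans
    (h.abs_lassoObjective_sub_le (mu := mu) hL hL' (h.sum_abs_solution_le hmu hs))
  rw [hs.taskLoss_eq]
  linarith

theorem abs_taskLoss_sub_le (h : IsBoundedTask A B α Γ) (hmu : 0 < mu) {L L' : Dict d u}
    (hL : ‖L‖ ≤ R) (hL' : ‖L'‖ ≤ R) : |taskLoss mu α Γ L - taskLoss mu α Γ L'|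
      ≤ 2 * B * (B * A ^ 2 / mu) * (A + R * (B * A ^ 2 / mu)) * ‖L - L'‖ := by
  refine abs_le.2 ⟨?_, h.taskLoss_sub_le hmu hL hL'⟩
  have := h.taskLoss_sub_le hmu hL' hL
  rw [norm_sub_rev] at this
  linarith

/-- Stability of the LASSO: where the solution is unique, solutions for nearby dictionaries are
close to it. -/
theorem tendsto_solution (h : IsBoundedTask A B α Γ) (hmu : 0 < mu) {L : Dict d u}
    {s : Fin u → ℝ} (huniq : ∀ v, IsLassoSolution mu α Γ L v → v = s) {σ : Dict d u → Fin u → ℝ}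
    (hσ : ∀ X, IsLassoSolution mu α Γ X (σ X)) : Tendsto σ (𝓝 L) (𝓝 s) := by
  have hcomp : IsCompact (Metric.closedBall (0 : Fin u → ℝ) (B * A ^ 2 / mu)) :=
    isCompact_closedBall _ _
  refine hcomp.tendsto_nhds_of_unique_mapClusterPt (Eventually.of_forall fun X => ?_) ?_
  · rw [mem_closedBall_zero_iff]
    refine (pi_norm_le_iff_of_nonneg ?_).2 fun j => ?_
    · exact le_trans (by positivity) (h.sum_abs_solution_le hmu (hσ X))
    · exact (Finset.single_le_sum (f := fun j => |σ X j|) (fun _ _ => abs_nonneg _)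
        (Finset.mem_univ j)).trans (h.sum_abs_solution_le hmu (hσ X))
  · intro v _ hv
    refine huniq v fun w => ?_
    -- the objectives at the perturbed solutions tend to the optimal value
    have hlim : Tendsto (fun X => lassoObjective mu α Γ L (σ X)) (𝓝 L)
        (𝓝 (taskLoss mu α Γ L)) := by
      have hC := fun X (hX : ‖X‖ ≤ ‖L‖ + 1) => h.abs_lassoObjective_sub_le (mu := mu)
        (by linarith : ‖L‖ ≤ ‖L‖ + 1) hX (h.sum_abs_solution_le hmu (hσ X))
      have hF := fun X (hX : ‖X‖ ≤ ‖L‖ + 1) => h.taskLoss_sub_le hmu hX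
        (by linarith : ‖L‖ ≤ ‖L‖ + 1)
      set C := 2 * B * (B * A ^ 2 / mu) * (A + (‖L‖ + 1) * (B * A ^ 2 / mu))
      have hball : ∀ᶠ X in 𝓝 L, ‖X‖ ≤ ‖L‖ + 1 :=
        (continuous_norm.tendsto L).eventually_le_const (by linarith)
      have hup : Tendsto (fun X => taskLoss mu α Γ L + 2 * C * ‖X - L‖) (𝓝 L)
          (𝓝 (taskLoss mu α Γ L)) := by
        have : Tendsto (fun X => taskLoss mu α Γ L + 2 * C * ‖X - L‖) (𝓝 L)
          (𝓝 (taskLoss mu α Γ L + 2 * C * ‖L - L‖)) := by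
          refine Continuous.tendsto ?_ L
          fun_prop
        simpa using this
      refine tendsto_of_tendsto_of_tendsto_of_le_of_le' tendsto_const_nhds hup
        (Eventually.of_forall fun X => taskLoss_le hmu.le h.posSemidef L (σ X)) ?_
      filter_upwards [hball] with X hX
      have h1 := (le_abs_self _).trans (hC X hX)
      have h2 := hF X hX
      rw [(hσ X).taskLoss_eq] at h2
      rw [norm_sub_rev] at h1
      linarith
    have hcl : MapClusterPt (lassoObjective mu α Γ L v) (𝓝 L)
        (fun X => lassoObjective mu α Γ L (σ X)) :=
      hv.continuousAt_comp (f := lassoObjective mu α Γ L)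
        (by unfold lassoObjective; fun_prop)
    have heq : lassoObjective mu α Γ L v = taskLoss mu α Γ L :=
      eq_of_nhds_neBot (ClusterPt.mono hcl hlim)
    rw [heq]
    exact taskLoss_le hmu.le h.posSemidef L w

/-- The derivative of the objective in the dictionary depends continuously on the code. -/
theorem abs_lassoDeriv_sub_le (h : IsBoundedTask A B α Γ) (L k : Dict d u) {s v : Fin u → ℝ}
    (hs : ∑ j, |s j| ≤ S) (hv : ∑ j, |v j| ≤ S) :
    |lassoDeriv α Γ v L k - lassoDeriv α Γ s L k|
      ≤ 2 * B * (A + 2 * ‖L‖ * S) * (∑ j, |v j - s j|) * ‖k‖ := by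
  have h1 : lassoDeriv α Γ v L k - lassoDeriv α Γ s L k
      = 2 * ((k *ᵥ s) ⬝ᵥ (Γ *ᵥ (L *ᵥ (v - s)))) - 2 * ((k *ᵥ (v - s)) ⬝ᵥ (Γ *ᵥ (α - L *ᵥ v))) := by
    have h2 : L *ᵥ (v - s) = (α - L *ᵥ s) - (α - L *ᵥ v) := by rw [Matrix.mulVec_sub]; abel
    rw [h2, Matrix.mulVec_sub k, Matrix.mulVec_sub Γ, dotProduct_sub, sub_dotProduct]
    simp only [lassoDeriv, LinearMap.coe_mk, AddHom.coe_mk]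
    ring
  have hk : ‖k *ᵥ s‖ ≤ ‖k‖ * S := (norm_mulVec_le_norm_mul_sum_abs _ _).trans (by gcongr)
  have h2 := h.abs_dotProduct_le hk (norm_mulVec_le_norm_mul_sum_abs L (v - s))
  have h3 := h.abs_dotProduct_le (norm_mulVec_le_norm_mul_sum_abs k (v - s))
    (h.norm_residual_le (le_refl ‖L‖) hv)
  simp only [Pi.sub_apply] at h2 h3
  rw [h1]
  refine (abs_sub _ _).trans ?_
  rw [abs_mul, abs_mul, abs_two]
  linarith

/-- Danskin's theorem for the LASSO: `taskLoss` is differentiable at every dictionary at which the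
sparse code is unique. -/
theorem differentiableAt_taskLoss (h : IsBoundedTask A B α Γ) (hmu : 0 < mu) {L : Dict d u}
    {s : Fin u → ℝ} (hs : IsLassoSolution mu α Γ L s)
    (huniq : ∀ v, IsLassoSolution mu α Γ L v → v = s) :
    DifferentiableAt ℝ (taskLoss mu α Γ) L := by
  choose σ hσ using exists_isLassoSolution (α := α) (u := u) hmu h.posSemidef
  have hσs := h.tendsto_solution hmu huniq hσ
  set S := B * A ^ 2 / mu with hS
  have hB := h.nonneg_right
  have hA := h.nonneg_left
  have hS0 : 0 ≤ S := by positivity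
  set C := 2 * B * (A + 2 * ‖L‖ * S) with hC
  have hC0 : 0 ≤ C := by positivity
  refine differentiableAt_of_abs_sub_le (lassoDeriv α Γ s L)
    (ε := fun X => C * (∑ j, |σ X j - s j|) + B * S ^ 2 * ‖X - L‖) ?_ fun X => ?_
  · have h1 : Tendsto (fun X => C * ∑ j, |σ X j - s j|) (𝓝 L) (𝓝 (C * ∑ j, |s j - s j|)) :=
      ((by fun_prop : Continuous fun v : Fin u → ℝ => C * ∑ j, |v j - s j|).tendsto s).comp hσs
    have h2 : Tendsto (fun X => B * S ^ 2 * ‖X - L‖) (𝓝 L) (𝓝 (B * S ^ 2 * ‖L - L‖)) := by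
      refine Continuous.tendsto ?_ L
      fun_prop
    have h3 : Tendsto (fun X => C * (∑ j, |σ X j - s j|) + B * S ^ 2 * ‖X - L‖) (𝓝 L) (𝓝 0) := by
      simpa using h1.add h2
    exact h3
  have hup : taskLoss mu α Γ X - taskLoss mu α Γ L - lassoDeriv α Γ s L (X - L)
      ≤ B * S ^ 2 * ‖X - L‖ ^ 2 := by
    have h1 := taskLoss_le (α := α) hmu.le h.posSemidef X s
    have h2 := (isQuadratic_lassoObjective (mu := mu) (α := α) h.posSemidef s).add L (X - L)
    rw [add_sub_cancel] at h2
    have h3 := h.quad_le (X - L) (h.sum_abs_solution_le hmu hs)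
    rw [hs.taskLoss_eq]
    linarith
  have hlow : -(C * (∑ j, |σ X j - s j|) * ‖X - L‖)
      ≤ taskLoss mu α Γ X - taskLoss mu α Γ L - lassoDeriv α Γ s L (X - L) := by
    have h1 := taskLoss_le (α := α) hmu.le h.posSemidef L (σ X)
    have h2 := (isQuadratic_lassoObjective (mu := mu) (α := α) h.posSemidef (σ X)).add L (X - L)
    rw [add_sub_cancel] at h2
    have h3 := h.posSemidef.dotProduct_mulVec_nonneg ((X - L) *ᵥ σ X)
    rw [star_trivial] at h3
    have h4 := (neg_le_of_abs_le (h.abs_lassoDeriv_sub_le L (X - L)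
      (h.sum_abs_solution_le hmu hs) (h.sum_abs_solution_le hmu (hσ X))))
    rw [(hσ X).taskLoss_eq]
    linarith
  have h6 : 0 ≤ B * S ^ 2 * ‖X - L‖ ^ 2 := by positivity
  have h7 : 0 ≤ C * (∑ j, |σ X j - s j|) * ‖X - L‖ := by positivity
  refine abs_le.2 ⟨?_, ?_⟩ <;> nlinarith

end IsBoundedTask

end Lasso

/-! ### The ridge estimator -/

section Ridge

open CoLLA

variable {d M : ℕ}

theorem norm_sq_le_dotProduct (θ : Fin d → ℝ) : ‖θ‖ ^ 2 ≤ θ ⬝ᵥ θ := by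
  have h0 : ∀ i, 0 ≤ θ i * θ i := fun i => mul_self_nonneg _
  refine (Real.le_sqrt (norm_nonneg _) (Finset.sum_nonneg fun i _ => h0 i)).1 ?_
  refine (pi_norm_le_iff_of_nonneg (Real.sqrt_nonneg _)).2 fun i => ?_
  refine (Real.le_sqrt (norm_nonneg _) (Finset.sum_nonneg fun i _ => h0 i)).2 ?_
  rw [Real.norm_eq_abs, sq_abs, sq]
  exact Finset.single_le_sum (f := fun i => θ i * θ i) (fun i _ => h0 i) (Finset.mem_univ i)

/-- A continuous convex function decreases at most linearly. -/
theorem ConvexOn.exists_neg_mul_le {E : Type*} [NormedAddCommGroup E] [NormedSpace ℝ E]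
    [ProperSpace E] {f : E → ℝ} (hf : ConvexOn ℝ Set.univ f) (hcont : Continuous f) :
    ∃ C, ∀ θ, -(C * (1 + ‖θ‖)) ≤ f θ := by
  obtain ⟨θ₀, -, hθ₀⟩ := (isCompact_closedBall (0 : E) 1).exists_isMinOn
    ⟨0, by simp⟩ hcont.continuousOn
  refine ⟨|f θ₀| + |f 0|, fun θ => ?_⟩
  have h1 := neg_abs_le (f θ₀)
  have h2 := abs_nonneg (f 0)
  rcases le_or_gt ‖θ‖ 1 with h | h
  · have h3 : f θ₀ ≤ f θ := hθ₀ (by simpa using h)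
    nlinarith [norm_nonneg θ, abs_nonneg (f θ₀)]
  · have hr : 0 < ‖θ‖ := by linarith
    have h3 : f θ₀ ≤ f (‖θ‖⁻¹ • θ) := hθ₀ (by simp [norm_smul, hr.ne'])
    have h4 := hf.2 (Set.mem_univ θ) (Set.mem_univ 0) (inv_nonneg.2 hr.le)
      (sub_nonneg.2 (inv_le_one_of_one_le₀ h.le)) (by ring)
    rw [smul_zero, add_zero] at h4
    simp only [smul_eq_mul] at h4
    have h5 : ‖θ‖ * f (‖θ‖⁻¹ • θ) ≤ f θ + (‖θ‖ - 1) * f 0 := by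
      have := mul_le_mul_of_nonneg_left h4 hr.le
      have h6 : ‖θ‖ * (‖θ‖⁻¹ * f θ + (1 - ‖θ‖⁻¹) * f 0) = f θ + (‖θ‖ - 1) * f 0 := by
        field_simp
      linarith
    nlinarith [le_abs_self (f 0), abs_nonneg (f θ₀), mul_le_mul_of_nonneg_left h3 hr.le]

variable {loss : TaskData d M → (Fin d → ℝ) → ℝ} {gam : ℝ}

theorem ridgeEstimator_spec (hgam : 0 < gam) (hconv : ∀ x, ConvexOn ℝ Set.univ (loss x))
    (hcont : ∀ x, Continuous (loss x)) (x : TaskData d M) (θ : Fin d → ℝ) :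
    loss x (ridgeEstimator loss gam x)
        + gam * (ridgeEstimator loss gam x ⬝ᵥ ridgeEstimator loss gam x)
      ≤ loss x θ + gam * (θ ⬝ᵥ θ) := by
  have hex : ∃ θ, ∀ θ', loss x θ + gam * (θ ⬝ᵥ θ) ≤ loss x θ' + gam * (θ' ⬝ᵥ θ') := by
    refine Continuous.exists_forall_le ((hcont x).add (by fun_prop)) ?_
    obtain ⟨C, hC⟩ := (hconv x).exists_neg_mul_le (hcont x)
    have h1 : Tendsto (fun r : ℝ => r * (gam * r - C) - C) atTop atTop :=
      tendsto_atTop_add_const_right _ _ (tendsto_id.atTop_mul_atTop₀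
        (tendsto_atTop_add_const_right _ _ (tendsto_id.const_mul_atTop hgam)))
    refine tendsto_atTop_mono (fun θ => ?_)
      (h1.comp (tendsto_norm_cocompact_atTop (E := Fin d → ℝ)))
    have h2 := hC θ
    have h3 := mul_le_mul_of_nonneg_left (norm_sq_le_dotProduct θ) hgam.le
    simp only [Function.comp_apply]
    nlinarith
  exact Classical.epsilon_spec hex θ

/-- Quadratic growth of the regularized loss at its minimizer. -/
theorem ridgeEstimator_growth (hgam : 0 < gam) (hconv : ∀ x, ConvexOn ℝ Set.univ (loss x))
    (hcont : ∀ x, Continuous (loss x)) (x : TaskData d M) (θ : Fin d → ℝ) :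
    loss x (ridgeEstimator loss gam x)
        + gam * (ridgeEstimator loss gam x ⬝ᵥ ridgeEstimator loss gam x)
        + gam / 2 * ‖θ - ridgeEstimator loss gam x‖ ^ 2
      ≤ loss x θ + gam * (θ ⬝ᵥ θ) := by
  have h1 := ridgeEstimator_spec hgam hconv hcont x
  generalize ridgeEstimator loss gam x = θ₀ at *
  have h2 := h1 ((1 / 2 : ℝ) • θ₀ + (1 / 2 : ℝ) • θ)
  have h3 := (hconv x).2 (Set.mem_univ θ₀) (Set.mem_univ θ) (by norm_num : (0 : ℝ) ≤ 1 / 2)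
    (by norm_num : (0 : ℝ) ≤ 1 / 2) (by norm_num)
  have h4 := mul_le_mul_of_nonneg_left (norm_sq_le_dotProduct (θ - θ₀)) hgam.le
  simp only [smul_eq_mul] at h3
  have h5 : ((1 / 2 : ℝ) • θ₀ + (1 / 2 : ℝ) • θ) ⬝ᵥ ((1 / 2 : ℝ) • θ₀ + (1 / 2 : ℝ) • θ)
      = (θ₀ ⬝ᵥ θ₀) / 2 + (θ ⬝ᵥ θ) / 2 - ((θ - θ₀) ⬝ᵥ (θ - θ₀)) / 4 := by
    simp only [add_dotProduct, dotProduct_add, smul_dotProduct, dotProduct_smul, sub_dotProduct,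
      dotProduct_sub, smul_eq_mul, dotProduct_comm θ θ₀]
    ring
  rw [h5] at h2
  linarith

theorem continuous_ridgeEstimator (hgam : 0 < gam) (hconv : ∀ x, ConvexOn ℝ Set.univ (loss x))
    (hcont : Continuous fun p : TaskData d M × (Fin d → ℝ) => loss p.1 p.2) :
    Continuous (ridgeEstimator loss gam) := by
  have hcont' : ∀ x, Continuous (loss x) := fun x =>
    hcont.comp (by fun_prop : Continuous fun θ : Fin d → ℝ => (x, θ))
  let f : TaskData d M → (Fin d → ℝ) → ℝ := fun x θ => loss x θ + gam * (θ ⬝ᵥ θ)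
  have hf : Continuous fun p : TaskData d M × (Fin d → ℝ) => f p.1 p.2 :=
    hcont.add (by fun_prop)
  have hfconv : ∀ x θ θ' (t : ℝ), 0 ≤ t → t ≤ 1 →
      f x ((1 - t) • θ + t • θ') ≤ (1 - t) * f x θ + t * f x θ' := by
    intro x θ θ' t h0 h1
    have h3 := (hconv x).2 (Set.mem_univ θ) (Set.mem_univ θ') (sub_nonneg.2 h1) h0 (by ring)
    have h5 : ((1 - t) • θ + t • θ') ⬝ᵥ ((1 - t) • θ + t • θ')
        = (1 - t) * (θ ⬝ᵥ θ) + t * (θ' ⬝ᵥ θ') - t * (1 - t) * ((θ' - θ) ⬝ᵥ (θ' - θ)) := by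
      simp only [add_dotProduct, dotProduct_add, smul_dotProduct, dotProduct_smul, sub_dotProduct,
        dotProduct_sub, smul_eq_mul, dotProduct_comm θ' θ]
      ring
    have h6 : 0 ≤ gam * (t * (1 - t) * ((θ' - θ) ⬝ᵥ (θ' - θ))) := by
      have := (sq_nonneg _).trans (norm_sq_le_dotProduct (θ' - θ))
      have := sub_nonneg.2 h1
      positivity
    simp only [smul_eq_mul] at h3
    simp only [f]
    rw [h5]
    linarith
  refine continuous_iff_continuousAt.2 fun x₀ => Metric.tendsto_nhds.2 fun ε hε => ?_
  set θ₀ := ridgeEstimator loss gam x₀ with hθ₀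
  -- on the sphere of radius `ε` around `θ₀`, the objective stays above its value at `θ₀`
  have hsphere : ∀ᶠ x in 𝓝 x₀, ∀ θ ∈ Metric.sphere θ₀ ε, f x θ₀ < f x θ := by
    refine (isCompact_sphere θ₀ ε).eventually_forall_of_forall_eventually fun θ hθ => ?_
    have h1 : f x₀ θ₀ < f x₀ θ := by
      have h2 := ridgeEstimator_growth hgam hconv hcont' x₀ θ
      rw [← hθ₀, ← dist_eq_norm, Metric.mem_sphere.1 hθ] at h2
      have h3 : 0 < gam / 2 * ε ^ 2 := by positivity
      simp only [f]
      linarith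
    have h2 : Continuous fun p : TaskData d M × (Fin d → ℝ) => f p.1 θ₀ :=
      hf.comp (by fun_prop : Continuous fun p : TaskData d M × (Fin d → ℝ) => (p.1, θ₀))
    exact h2.continuousAt.eventually_lt hf.continuousAt h1
  filter_upwards [hsphere] with x hx
  by_contra! hfar
  set θ₁ := ridgeEstimator loss gam x with hθ₁
  have hpos : 0 < dist θ₁ θ₀ := hε.trans_le hfar
  have ht0 : 0 ≤ ε / dist θ₁ θ₀ := by positivity
  have ht1 : ε / dist θ₁ θ₀ ≤ 1 := (div_le_one hpos).2 hfar
  have h1 := hx ((1 - ε / dist θ₁ θ₀) • θ₀ + (ε / dist θ₁ θ₀) • θ₁) (by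
    rw [Metric.mem_sphere, dist_eq_norm]
    have : (1 - ε / dist θ₁ θ₀) • θ₀ + (ε / dist θ₁ θ₀) • θ₁ - θ₀
        = (ε / dist θ₁ θ₀) • (θ₁ - θ₀) := by
      rw [sub_smul, smul_sub, one_smul]; abel
    rw [this, norm_smul, ← dist_eq_norm, Real.norm_of_nonneg ht0, div_mul_cancel₀ _ hpos.ne'])
  have h2 := hfconv x θ₀ θ₁ _ ht0 ht1
  have h3 : f x θ₁ ≤ f x θ₀ := ridgeEstimator_spec hgam hconv hcont' x θ₀
  nlinarith

theorem continuous_lossHessian (hgam : 0 < gam) (hconv : ∀ x, ConvexOn ℝ Set.univ (loss x))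
    (hcont : Continuous fun p : TaskData d M × (Fin d → ℝ) => loss p.1 p.2)
    (hhess : Continuous fun p : TaskData d M × (Fin d → ℝ) => iteratedFDeriv ℝ 2 (loss p.1) p.2) :
    Continuous (lossHessian loss gam) := by
  refine continuous_matrix fun j k => ?_
  have h1 := hhess.comp (continuous_id.prodMk (continuous_ridgeEstimator hgam hconv hcont))
  exact (ContinuousMultilinearMap.apply ℝ (fun _ : Fin 2 => Fin d → ℝ) ℝ
    ![Pi.single j 1, Pi.single k 1]).continuous.comp h1

/-- The tasks with data in a compact set on which the Hessians are positive semidefinite are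
uniformly bounded. -/
theorem exists_isBoundedTask {N : ℕ} (hgam : 0 < gam)
    (hconv : ∀ x, ConvexOn ℝ Set.univ (loss x))
    (hcont : Continuous fun p : TaskData d M × (Fin d → ℝ) => loss p.1 p.2)
    (hhess : Continuous fun p : TaskData d M × (Fin d → ℝ) => iteratedFDeriv ℝ 2 (loss p.1) p.2)
    {K : Fin N → Set (TaskData d M)} (hK : ∀ i, IsCompact (K i))
    (hΓ : ∀ i, ∀ y ∈ K i, (lossHessian loss gam y).PosSemidef) :
    ∃ A B, ∀ i, ∀ y ∈ K i,
      IsBoundedTask A B (ridgeEstimator loss gam y) (lossHessian loss gam y) := by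
  have hKc : IsCompact (⋃ i, K i) := isCompact_iUnion hK
  have hα := continuous_ridgeEstimator hgam hconv hcont
  have hH := continuous_lossHessian hgam hconv hcont hhess
  have hsum : Continuous fun y => ∑ i, ∑ j, |lossHessian loss gam y i j| :=
    continuous_finsetSum _ fun i _ => continuous_finsetSum _ fun j _ => (hH.matrix_elem i j).abs
  obtain ⟨A, hA⟩ := hKc.exists_bound_of_continuousOn hα.continuousOn
  obtain ⟨B, hB⟩ := hKc.exists_bound_of_continuousOn hsum.continuousOn
  refine ⟨A, B, fun i y hy => ⟨hΓ i y hy, hA y (Set.mem_iUnion.2 ⟨i, hy⟩), ?_⟩⟩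
  exact (le_abs_self _).trans (hB y (Set.mem_iUnion.2 ⟨i, hy⟩))

/-- On the tasks with positive semidefinite Hessian, `taskLoss` is a measurable function of the
data. -/
theorem exists_measurable_taskLoss {u : ℕ} {mu : ℝ} (hmu : 0 ≤ mu) (hgam : 0 < gam)
    (hconv : ∀ x, ConvexOn ℝ Set.univ (loss x))
    (hcont : Continuous fun p : TaskData d M × (Fin d → ℝ) => loss p.1 p.2)
    (hhess : Continuous fun p : TaskData d M × (Fin d → ℝ) => iteratedFDeriv ℝ 2 (loss p.1) p.2)
    (L : Dict d u) :
    ∃ g : TaskData d M → ℝ, Measurable g ∧ ∀ y, (lossHessian loss gam y).PosSemidef →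
      taskLoss mu (ridgeEstimator loss gam y) (lossHessian loss gam y) L = g y := by
  have hα := continuous_ridgeEstimator hgam hconv hcont
  have hH := continuous_lossHessian hgam hconv hcont hhess
  refine ⟨fun y => ⨅ n : ℕ, lassoObjective mu (ridgeEstimator loss gam y)
    (lossHessian loss gam y) L (TopologicalSpace.denseSeq (Fin u → ℝ) n), ?_, fun y hy => ?_⟩
  · refine Measurable.iInf fun n => Continuous.measurable ?_
    unfold lassoObjective
    have h1 : Continuous fun y => ridgeEstimator loss gam y
        - L *ᵥ TopologicalSpace.denseSeq (Fin u → ℝ) n := hα.sub continuous_const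
    exact (h1.dotProduct (hH.matrix_mulVec h1)).add continuous_const
  · have hbdd := bddBelow_lassoObjective (α := ridgeEstimator loss gam y) hmu hy L
    refine le_antisymm (le_ciInf fun n => ciInf_le hbdd _) (le_ciInf fun s => ?_)
    have hclosed : IsClosed {s | ⨅ n : ℕ, lassoObjective mu (ridgeEstimator loss gam y)
        (lossHessian loss gam y) L (TopologicalSpace.denseSeq (Fin u → ℝ) n)
        ≤ lassoObjective mu (ridgeEstimator loss gam y) (lossHessian loss gam y) L s} :=
      isClosed_le continuous_const (by unfold lassoObjective; fun_prop)
    have hrange : Set.range (TopologicalSpace.denseSeq (Fin u → ℝ)) ⊆ {s | ⨅ n : ℕ,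
        lassoObjective mu (ridgeEstimator loss gam y) (lossHessian loss gam y) L
          (TopologicalSpace.denseSeq (Fin u → ℝ) n)
        ≤ lassoObjective mu (ridgeEstimator loss gam y) (lossHessian loss gam y) L s} := by
      rintro _ ⟨n, rfl⟩
      exact ciInf_le (hbdd.mono (Set.range_subset_iff.2 fun n => Set.mem_range_self _)) n
    exact closure_minimal hrange hclosed (TopologicalSpace.denseRange_denseSeq (Fin u → ℝ) s)

end Ridge

/-! ### Rates in the uniform law of large numbers -/

section Probability

open CoLLA

variable {Ω : Type*} [MeasurableSpace Ω] {P : Measure Ω}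

/-- The mean squared error of the empirical mean of `T` bounded i.i.d. variables is `O(1 / T)`. -/
theorem integral_sq_mean_sub_le [IsProbabilityMeasure P] {X : ℕ → Ω → ℝ}
    (hX : ∀ t, AEMeasurable (X t) P) (hindep : iIndepFun X P)
    (hident : ∀ t, IdentDistrib (X t) (X 1) P P) {C : ℝ}
    (hC : ∀ t, ∀ᵐ ω ∂P, |X t ω| ≤ C) {T : ℕ} (hT : 1 ≤ T) :
    Integrable (fun ω => ((T : ℝ)⁻¹ * ∑ t ∈ Finset.Icc 1 T, X t ω - ∫ ω, X 1 ω ∂P) ^ 2) P ∧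
      ∫ ω, ((T : ℝ)⁻¹ * ∑ t ∈ Finset.Icc 1 T, X t ω - ∫ ω, X 1 ω ∂P) ^ 2 ∂P ≤ C ^ 2 / T := by
  have hT0 : (0 : ℝ) < T := by exact_mod_cast hT
  have hL2 : ∀ t, MemLp (X t) 2 P := fun t =>
    MemLp.of_bound (hX t).aestronglyMeasurable C (by simpa using hC t)
  have hsum2 : MemLp (fun ω => ∑ t ∈ Finset.Icc 1 T, X t ω) 2 P :=
    memLp_finsetSum _ fun t _ => hL2 t
  have hmean2 : MemLp (fun ω => (T : ℝ)⁻¹ * ∑ t ∈ Finset.Icc 1 T, X t ω) 2 P :=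
    hsum2.const_mul _
  have hmean : ∫ ω, (T : ℝ)⁻¹ * ∑ t ∈ Finset.Icc 1 T, X t ω ∂P = ∫ ω, X 1 ω ∂P := by
    rw [integral_const_mul, integral_finsetSum _ fun t _ => (hL2 t).integrable one_le_two]
    simp only [fun t => (hident t).integral_eq, Finset.sum_const, Nat.card_Icc, nsmul_eq_mul]
    simp
    field_simp
  refine ⟨(hmean2.sub (memLp_const _)).integrable_sq, ?_⟩
  have hvar1 : ∀ t, Var[X t; P] ≤ C ^ 2 := by
    intro t
    refine (variance_le_expectation_sq (hX t).aestronglyMeasurable).trans ?_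
    calc ∫ ω, (X t ^ 2) ω ∂P ≤ ∫ _, C ^ 2 ∂P := by
          refine integral_mono_ae (hL2 t).integrable_sq (integrable_const _) ?_
          filter_upwards [hC t] with ω hω
          exact sq_le_sq' (by linarith [neg_abs_le (X t ω)]) ((le_abs_self _).trans hω)
      _ = C ^ 2 := by simp
  have hvar : Var[fun ω => ∑ t ∈ Finset.Icc 1 T, X t ω; P] = ∑ t ∈ Finset.Icc 1 T, Var[X t; P] := by
    have := IndepFun.variance_sum (s := Finset.Icc 1 T) (fun t _ => hL2 t)
      (fun i _ j _ hij => hindep.indepFun hij)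
    rw [← this]
    congr 1
    ext ω
    simp
  have h1 := variance_eq_integral (μ := P) hmean2.aestronglyMeasurable.aemeasurable
  rw [hmean, variance_const_mul, hvar] at h1
  rw [← h1]
  calc (T : ℝ)⁻¹ ^ 2 * ∑ t ∈ Finset.Icc 1 T, Var[X t; P]
      ≤ (T : ℝ)⁻¹ ^ 2 * ∑ t ∈ Finset.Icc 1 T, C ^ 2 := by
        gcongr with t
        exact hvar1 t
    _ = C ^ 2 / T := by
        simp
        field_simp

theorem ae_summable_of_summable_integral {f : ℕ → Ω → ℝ} (hf0 : ∀ k ω, 0 ≤ f k ω)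
    (hf : ∀ k, Integrable (f k) P) (hsum : Summable fun k => ∫ ω, f k ω ∂P) :
    ∀ᵐ ω ∂P, Summable fun k => f k ω := by
  have hmeas : ∀ k, AEMeasurable (fun ω => ENNReal.ofReal (f k ω)) P := fun k =>
    (hf k).aestronglyMeasurable.aemeasurable.ennreal_ofReal
  have h1 : ∫⁻ ω, ∑' k, ENNReal.ofReal (f k ω) ∂P ≠ ⊤ := by
    rw [lintegral_tsum hmeas]
    simp_rw [fun k => (ofReal_integral_eq_lintegral_ofReal (hf k)
      (Eventually.of_forall (hf0 k))).symm]
    exact hsum.tsum_ofReal_ne_top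
  filter_upwards [ae_lt_top' (AEMeasurable.tsum hmeas) h1] with ω hω
  have h2 := ENNReal.summable_toReal hω.ne
  simpa [ENNReal.toReal_ofReal, hf0] using h2

variable {d u : ℕ}

theorem frobenius_norm_le_sum_abs (A : Dict d u) : ‖A‖ ≤ ∑ i, ∑ j, |A i j| := by
  rcases (norm_nonneg A).eq_or_lt with h | h
  · rw [← h]; positivity
  · refine le_of_mul_le_mul_left ?_ h
    rw [← sq, frobenius_norm_sq, Finset.mul_sum]
    refine Finset.sum_le_sum fun i _ => ?_
    rw [Finset.mul_sum]
    refine Finset.sum_le_sum fun j _ => ?_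
    rw [← sq_abs, sq]
    exact mul_le_mul_of_nonneg_right (abs_entry_le_norm A i j) (abs_nonneg _)

/-- The point with index `σ` of the grid of mesh `1 / n` in the cube `[-R, R]^{d × u}`. -/
noncomputable def gridPoint (R n : ℕ) (σ : Fin d → Fin u → Fin (2 * R * n + 1)) : Dict d u :=
  Matrix.of fun i j => (σ i j : ℝ) / n - R

theorem norm_gridPoint_le {R n : ℕ} (hn : 0 < n) (σ : Fin d → Fin u → Fin (2 * R * n + 1)) :
    ‖gridPoint R n σ‖ ≤ d * u * R := by
  refine (frobenius_norm_le_sum_abs _).trans ?_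
  have hn' : (0 : ℝ) < n := by exact_mod_cast hn
  have h1 : ∀ i j, |gridPoint R n σ i j| ≤ R := by
    intro i j
    have h2 : ((σ i j : ℕ) : ℝ) ≤ 2 * R * n := by exact_mod_cast Nat.lt_succ_iff.1 (σ i j).2
    have h3 : ((σ i j : ℕ) : ℝ) / n ≤ 2 * R := (div_le_iff₀ hn').2 h2
    have h4 : 0 ≤ ((σ i j : ℕ) : ℝ) / n := by positivity
    simp only [gridPoint, Matrix.of_apply]
    exact abs_le.2 ⟨by linarith, by linarith⟩
  calc _ ≤ ∑ _i : Fin d, ∑ _j : Fin u, (R : ℝ) :=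
        Finset.sum_le_sum fun i _ => Finset.sum_le_sum fun j _ => h1 i j
    _ = d * u * R := by simp [mul_assoc]

theorem exists_gridPoint_near {R n : ℕ} (hn : 0 < n) {L : Dict d u} (hL : ‖L‖ ≤ R) :
    ∃ σ, ‖L - gridPoint R n σ‖ ≤ d * u / n := by
  have hn' : (0 : ℝ) < n := by exact_mod_cast hn
  have h0 : ∀ i j, 0 ≤ (L i j + R) * n := fun i j => by
    have := neg_le_of_abs_le ((abs_entry_le_norm L i j).trans hL)
    have : 0 ≤ L i j + R := by linarith
    positivity
  have h1 : ∀ i j, ⌊(L i j + R) * n⌋₊ < 2 * R * n + 1 := by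
    intro i j
    rw [Nat.lt_succ_iff]
    refine Nat.floor_le_of_le ?_
    push_cast
    have := (le_abs_self _).trans ((abs_entry_le_norm L i j).trans hL)
    exact mul_le_mul_of_nonneg_right (by linarith) hn'.le
  refine ⟨fun i j => ⟨⌊(L i j + R) * n⌋₊, h1 i j⟩, (frobenius_norm_le_sum_abs _).trans ?_⟩
  calc _ ≤ ∑ _i : Fin d, ∑ _j : Fin u, (n : ℝ)⁻¹ := by
        refine Finset.sum_le_sum fun i _ => Finset.sum_le_sum fun j _ => ?_
        simp only [gridPoint, Matrix.of_apply, Matrix.sub_apply]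
        have h2 := Nat.floor_le (h0 i j)
        have h3 := (Nat.lt_floor_add_one ((L i j + R) * n)).le
        have h4 : L i j - ((⌊(L i j + R) * n⌋₊ : ℝ) / n - R)
            = ((L i j + R) * n - ⌊(L i j + R) * n⌋₊) * (n : ℝ)⁻¹ := by field_simp; ring
        rw [h4, abs_mul, abs_of_pos (inv_pos.2 hn')]
        refine mul_le_of_le_one_left (inv_pos.2 hn').le (abs_le.2 ⟨by linarith, by linarith⟩)
    _ = d * u / n := by simp [div_eq_mul_inv, mul_assoc]

/-- A chaining-free uniform rate. If the random functions `a T` are locally Lipschitz, uniformly in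
`T`, with second moments `O(1 / T)` at every point, then along the sequence `(k + 1) ^ (2du + 4)`
they are almost surely summable, locally uniformly: at step `k` it suffices to control them on a
grid of mesh `(k + 1)⁻²`, which has `O((k + 1) ^ (2du))` points. -/
theorem ae_exists_summable_bound {a : ℕ → Ω → Dict d u → ℝ} {C : ℝ}
    (hint : ∀ T, 1 ≤ T → ∀ L, Integrable (fun ω => a T ω L ^ 2) P)
    (hvar : ∀ T, 1 ≤ T → ∀ L, ∫ ω, a T ω L ^ 2 ∂P ≤ C / T)
    (hlip : ∀ R : ℝ, ∃ Λ, 0 ≤ Λ ∧ ∀ᵐ ω ∂P, ∀ T, 1 ≤ T → ∀ L L', ‖L‖ ≤ R → ‖L'‖ ≤ R →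
      |a T ω L - a T ω L'| ≤ Λ * ‖L - L'‖) :
    ∀ᵐ ω ∂P, ∀ R : ℕ, ∃ β : ℕ → ℝ, Summable β ∧
      ∀ k L, ‖L‖ ≤ R → |a ((k + 1) ^ (2 * (d * u) + 4)) ω L| ≤ β k := by
  refine ae_all_iff.2 fun R => ?_
  obtain ⟨Λ, hΛ0, hΛ⟩ := hlip (max R (d * u * R))
  set q := 2 * (d * u) + 4 with hq
  have hT : ∀ k : ℕ, 1 ≤ (k + 1) ^ q := fun k => Nat.one_le_pow _ _ (Nat.succ_pos _)
  have hC0 : 0 ≤ C := by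
    have := (integral_nonneg fun ω => sq_nonneg _).trans (hvar 1 le_rfl 0)
    simpa using this
  let f : ℕ → Ω → ℝ := fun k ω =>
    ((k : ℝ) + 1) ^ 2 * ∑ σ, a ((k + 1) ^ q) ω (gridPoint R ((k + 1) ^ 2) σ) ^ 2
  have hsq : Summable fun k : ℕ => (((k : ℝ) + 1) ^ 2)⁻¹ := by
    have := (summable_nat_add_iff 1).2 (Real.summable_nat_pow_inv.2 one_lt_two)
    simpa using this
  have hfint : ∀ k, Integrable (f k) P := fun k =>
    (integrable_finsetSum _ fun σ _ => hint _ (hT k) _).const_mul _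
  have hfle : ∀ k, ∫ ω, f k ω ∂P ≤ ((2 * R + 1 : ℝ) ^ (d * u) * C) * (((k : ℝ) + 1) ^ 2)⁻¹ := by
    intro k
    have hk : (0 : ℝ) < (k : ℝ) + 1 := by positivity
    have hk1 : (1 : ℝ) ≤ (k : ℝ) + 1 := by linarith [k.cast_nonneg (α := ℝ)]
    have hcard : ((2 * R * ((k : ℝ) + 1) ^ 2 + 1 : ℝ)) ^ (d * u)
        ≤ (2 * R + 1 : ℝ) ^ (d * u) * (((k : ℝ) + 1) ^ 2) ^ (d * u) := by
      rw [← mul_pow]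
      gcongr
      nlinarith [one_le_pow₀ (n := 2) hk1]
    calc ∫ ω, f k ω ∂P
        = ((k : ℝ) + 1) ^ 2 * ∑ σ, ∫ ω, a ((k + 1) ^ q) ω (gridPoint R ((k + 1) ^ 2) σ) ^ 2 ∂P := by
          simp only [f]
          rw [integral_const_mul, integral_finsetSum _ fun σ _ => hint _ (hT k) _]
      _ ≤ ((k : ℝ) + 1) ^ 2 * ∑ _σ : Fin d → Fin u → Fin (2 * R * (k + 1) ^ 2 + 1),
            C / ((k : ℝ) + 1) ^ q := by
          gcongr with σ
          have := hvar _ (hT k) (gridPoint R ((k + 1) ^ 2) σ)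
          push_cast at this
          exact this
      _ = ((k : ℝ) + 1) ^ 2 * (((2 * R * ((k : ℝ) + 1) ^ 2 + 1 : ℝ)) ^ (d * u)
            * (C / ((k : ℝ) + 1) ^ q)) := by
          rw [Finset.sum_const, Finset.card_univ, nsmul_eq_mul]
          simp [pow_mul, mul_comm d u]
      _ ≤ ((k : ℝ) + 1) ^ 2 * (((2 * R + 1 : ℝ) ^ (d * u) * (((k : ℝ) + 1) ^ 2) ^ (d * u))
            * (C / ((k : ℝ) + 1) ^ q)) := by gcongr
      _ = _ := by
          rw [hq, pow_add, ← pow_mul]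
          field_simp
  have hfsum : ∀ᵐ ω ∂P, Summable fun k => f k ω :=
    ae_summable_of_summable_integral (fun k ω => by positivity) hfint
      (Summable.of_nonneg_of_le (fun k => integral_nonneg fun ω => by positivity) hfle
        (hsq.mul_left _))
  filter_upwards [hΛ, hfsum] with ω hω hfω
  refine ⟨fun k => (((k : ℝ) + 1) ^ 2)⁻¹ + f k ω + Λ * (d * u) * (((k : ℝ) + 1) ^ 2)⁻¹,
    (hsq.add hfω).add (hsq.mul_left _), fun k L hL => ?_⟩
  have hk : (0 : ℝ) < (k : ℝ) + 1 := by positivity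
  have hn : 0 < (k + 1) ^ 2 := by positivity
  obtain ⟨σ, hσ⟩ := exists_gridPoint_near hn hL
  have h1 := hω _ (hT k) L (gridPoint R ((k + 1) ^ 2) σ) (hL.trans (le_max_left _ _))
    ((norm_gridPoint_le hn σ).trans (le_max_right _ _))
  have h2 : a ((k + 1) ^ q) ω (gridPoint R ((k + 1) ^ 2) σ) ^ 2
      ≤ ∑ σ, a ((k + 1) ^ q) ω (gridPoint R ((k + 1) ^ 2) σ) ^ 2 :=
    Finset.single_le_sum (f := fun σ => a ((k + 1) ^ q) ω (gridPoint R ((k + 1) ^ 2) σ) ^ 2)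
      (fun _ _ => sq_nonneg _) (Finset.mem_univ σ)
  have h3 : |a ((k + 1) ^ q) ω (gridPoint R ((k + 1) ^ 2) σ)|
      ≤ (((k : ℝ) + 1) ^ 2)⁻¹ + f k ω := by
    set b := |a ((k + 1) ^ q) ω (gridPoint R ((k + 1) ^ 2) σ)| with hb
    -- `b ≤ κ⁻¹ + κ b²` with `κ = (k + 1)²`
    have h4 : b ≤ (((k : ℝ) + 1) ^ 2)⁻¹ + ((k : ℝ) + 1) ^ 2 * b ^ 2 := by
      have h5 : 0 ≤ (((k : ℝ) + 1) ^ 2)⁻¹ * (((k : ℝ) + 1) ^ 2 * b - 1) ^ 2 := by positivity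
      have h6 : (((k : ℝ) + 1) ^ 2)⁻¹ * (((k : ℝ) + 1) ^ 2 * b - 1) ^ 2
          = ((k : ℝ) + 1) ^ 2 * b ^ 2 - 2 * b + (((k : ℝ) + 1) ^ 2)⁻¹ := by field_simp; ring
      have : 0 ≤ b := abs_nonneg _
      linarith
    rw [hb, sq_abs] at h4
    exact h4.trans (by simp only [f]; gcongr)
  have h7 : Λ * ‖L - gridPoint R ((k + 1) ^ 2) σ‖ ≤ Λ * (d * u) * (((k : ℝ) + 1) ^ 2)⁻¹ := by
    refine (mul_le_mul_of_nonneg_left hσ hΛ0).trans (le_of_eq ?_)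
    push_cast
    ring
  have h8 := abs_sub_abs_le_abs_sub (a ((k + 1) ^ q) ω L)
    (a ((k + 1) ^ q) ω (gridPoint R ((k + 1) ^ 2) σ))
  linarith

end Probability

/-! ### Averages and polynomial blocks -/

section Averages

/-- The average `(v 1 + ⋯ + v T) / T`. -/
noncomputable def avg (v : ℕ → ℝ) (T : ℕ) : ℝ := (T : ℝ)⁻¹ * ∑ t ∈ Finset.Icc 1 T, v t

theorem avg_sub (v w : ℕ → ℝ) (T : ℕ) : avg (fun t => v t - w t) T = avg v T - avg w T := by
  simp only [avg, Finset.sum_sub_distrib, mul_sub]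

theorem avg_mono {v w : ℕ → ℝ} {T : ℕ} (h : ∀ t, 1 ≤ t → v t ≤ w t) : avg v T ≤ avg w T :=
  mul_le_mul_of_nonneg_left (Finset.sum_le_sum fun t ht => h t (Finset.mem_Icc.1 ht).1)
    (by positivity)

theorem avg_const (c : ℝ) {T : ℕ} (hT : 1 ≤ T) : avg (fun _ => c) T = c := by
  have : (T : ℝ) ≠ 0 := by positivity
  simp [avg, this]

theorem abs_avg_le {v : ℕ → ℝ} {B : ℝ} {T : ℕ} (hT : 1 ≤ T) (h : ∀ t, 1 ≤ t → |v t| ≤ B) :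
    |avg v T| ≤ B := by
  refine abs_le.2 ⟨?_, ?_⟩
  · rw [← avg_const (-B) hT]
    exact avg_mono fun t ht => neg_le_of_abs_le (h t ht)
  · rw [← avg_const B hT]
    exact avg_mono fun t ht => (le_abs_self _).trans (h t ht)

theorem avg_eq_add_sum_Ioc (v : ℕ → ℝ) {n m : ℕ} (hn : 1 ≤ n) (hnm : n ≤ m) :
    avg v m = (n : ℝ) / m * avg v n + (m : ℝ)⁻¹ * ∑ t ∈ Finset.Ioc n m, v t := by
  have hn0 : (n : ℝ) ≠ 0 := by positivity
  have h1 : ∑ t ∈ Finset.Icc 1 m, v t = ∑ t ∈ Finset.Icc 1 n, v t + ∑ t ∈ Finset.Ioc n m, v t := by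
    rw [← Finset.sum_union]
    · congr 1
      ext t
      simp only [Finset.mem_Icc, Finset.mem_union, Finset.mem_Ioc]
      omega
    · rw [Finset.disjoint_left]
      intro t
      simp only [Finset.mem_Icc, Finset.mem_Ioc]
      omega
  simp only [avg]
  rw [h1]
  field_simp

theorem abs_avg_sub_avg_le {v : ℕ → ℝ} {B : ℝ} (h : ∀ t, 1 ≤ t → |v t| ≤ B) {n m : ℕ}
    (hn : 1 ≤ n) (hnm : n ≤ m) : |avg v m - avg v n| ≤ 2 * B * (1 - (n : ℝ) / m) := by
  have hm0 : (0 : ℝ) < m := by exact_mod_cast hn.trans hnm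
  have hθ : 0 ≤ 1 - (n : ℝ) / m := sub_nonneg.2 ((div_le_one hm0).2 (by exact_mod_cast hnm))
  have h1 : |(m : ℝ)⁻¹ * ∑ t ∈ Finset.Ioc n m, v t| ≤ (1 - (n : ℝ) / m) * B := by
    rw [abs_mul, abs_of_pos (inv_pos.2 hm0)]
    have h2 : |∑ t ∈ Finset.Ioc n m, v t| ≤ ((m : ℝ) - n) * B := by
      refine (Finset.abs_sum_le_sum_abs _ _).trans ((Finset.sum_le_sum fun t ht =>
        h t (by have := Finset.mem_Ioc.1 ht; omega)).trans (le_of_eq ?_))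
      rw [Finset.sum_const, Nat.card_Ioc, nsmul_eq_mul, Nat.cast_sub hnm]
    refine (mul_le_mul_of_nonneg_left h2 (inv_pos.2 hm0).le).trans (le_of_eq ?_)
    field_simp
  have h3 : |(1 - (n : ℝ) / m) * avg v n| ≤ (1 - (n : ℝ) / m) * B := by
    rw [abs_mul, abs_of_nonneg hθ]
    exact mul_le_mul_of_nonneg_left (abs_avg_le hn h) hθ
  have h4 : avg v m - avg v n
      = (m : ℝ)⁻¹ * ∑ t ∈ Finset.Ioc n m, v t - (1 - (n : ℝ) / m) * avg v n := by
    rw [avg_eq_add_sum_Ioc v hn hnm]; ring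
  rw [h4]
  exact (abs_sub _ _).trans (by linarith)

theorem one_sub_pow_div_pow_le (q k : ℕ) :
    1 - (((k + 1) ^ q : ℕ) : ℝ) / (((k + 1 + 1) ^ q : ℕ) : ℝ) ≤ q / ((k : ℝ) + 2) := by
  have hk : (0 : ℝ) < (k : ℝ) + 2 := by positivity
  have h1 := one_add_mul_le_pow (a := -((k : ℝ) + 2)⁻¹) (by
    have : ((k : ℝ) + 2)⁻¹ ≤ 1 := inv_le_one_of_one_le₀ (by linarith [k.cast_nonneg (α := ℝ)])
    linarith) q
  have h2 : (1 + -((k : ℝ) + 2)⁻¹) ^ q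
      = (((k + 1) ^ q : ℕ) : ℝ) / (((k + 1 + 1) ^ q : ℕ) : ℝ) := by
    push_cast
    rw [← div_pow]
    congr 1
    field_simp
    ring
  rw [h2] at h1
  rw [div_eq_mul_inv (q : ℝ)]
  linarith

theorem inv_le_one_sub_pow_div_pow {q : ℕ} (hq : 1 ≤ q) (k : ℕ) :
    ((k : ℝ) + 2)⁻¹ ≤ 1 - (((k + 1) ^ q : ℕ) : ℝ) / (((k + 1 + 1) ^ q : ℕ) : ℝ) := by
  have hk : (0 : ℝ) < (k : ℝ) + 2 := by positivity
  have h1 : (((k : ℝ) + 1) / ((k : ℝ) + 2)) ^ q ≤ ((k : ℝ) + 1) / ((k : ℝ) + 2) :=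
    pow_le_of_le_one (by positivity) ((div_le_one hk).2 (by linarith)) (by omega)
  have h2 : (((k : ℝ) + 1) / ((k : ℝ) + 2)) ^ q
      = (((k + 1) ^ q : ℕ) : ℝ) / (((k + 1 + 1) ^ q : ℕ) : ℝ) := by
    push_cast
    rw [← div_pow]
    congr 2
    ring
  have h3 : ((k : ℝ) + 2)⁻¹ = 1 - ((k : ℝ) + 1) / ((k : ℝ) + 2) := by field_simp; ring
  rw [h2] at h1
  linarith

/-- The blocks between consecutive `q`-th powers cover all large integers. -/
theorem eventually_of_eventually_block {q : ℕ} (hq : 1 ≤ q) {p : ℕ → Prop}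
    (h : ∀ᶠ k in atTop, ∀ T, (k + 1) ^ q ≤ T → T ≤ (k + 1 + 1) ^ q → p T) :
    ∀ᶠ T in atTop, p T := by
  obtain ⟨K, hK⟩ := eventually_atTop.1 h
  refine eventually_atTop.2 ⟨(K + 1) ^ q, fun T hT => ?_⟩
  have hle : ∀ k, (k + 1) ^ q ≤ T → k ≤ T := fun k hk =>
    (Nat.le_succ k).trans ((Nat.le_self_pow (by omega) _).trans hk)
  have h1 := Nat.findGreatest_spec (P := fun k => (k + 1) ^ q ≤ T) (hle K hT) hT
  have h2 := Nat.le_findGreatest (P := fun k => (k + 1) ^ q ≤ T) (hle K hT) hT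
  refine hK _ h2 T h1 ?_
  by_contra! hlt
  have h3 := Nat.le_findGreatest (P := fun k => (k + 1) ^ q ≤ T) (hle _ hlt.le) hlt.le
  omega

/-- Uniform convergence of averages of bounded functions along the `q`-th powers implies uniform
convergence: over a block between consecutive powers the averages change by `O(1 / k)`. -/
theorem eventually_forall_abs_avg_sub_lt {E : Type*} [NormedAddCommGroup E] {ℓ : ℕ → E → ℝ}
    {e : E → ℝ} {C R : ℝ} (hC : ∀ t L, 1 ≤ t → |ℓ t L| ≤ C) {q : ℕ} (hq : 1 ≤ q) {β : ℕ → ℝ}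
    (hβ : Summable β)
    (hβe : ∀ k L, ‖L‖ ≤ R → |avg (fun t => ℓ t L) ((k + 1) ^ q) - e L| ≤ β k) {ε : ℝ}
    (hε : 0 < ε) : ∀ᶠ T in atTop, ∀ L, ‖L‖ ≤ R → |avg (fun t => ℓ t L) T - e L| < ε := by
  have hC0 : 0 ≤ C := (abs_nonneg _).trans (hC 1 0 le_rfl)
  have hsmall : Tendsto (fun k : ℕ => 2 * C * (q / ((k : ℝ) + 2))) atTop (𝓝 0) := by
    have h1 : Tendsto (fun k : ℕ => (q : ℝ) / ((k : ℝ) + 2)) atTop (𝓝 0) :=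
      tendsto_const_nhds.div_atTop
        (tendsto_atTop_add_const_right _ _ tendsto_natCast_atTop_atTop)
    simpa using h1.const_mul (2 * C)
  refine eventually_of_eventually_block hq ?_
  filter_upwards [hβ.tendsto_atTop_zero.eventually_lt_const (half_pos hε),
    hsmall.eventually_lt_const (half_pos hε)] with k hk1 hk2 T hT1 hT2 L hL
  have hn : 1 ≤ (k + 1) ^ q := Nat.one_le_pow _ _ (Nat.succ_pos _)
  have hT0 : (0 : ℝ) < T := by exact_mod_cast hn.trans hT1
  have h1 := abs_avg_sub_avg_le (v := fun t => ℓ t L) (fun t ht => hC t L ht) hn hT1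
  have h2 : 1 - (((k + 1) ^ q : ℕ) : ℝ) / T ≤ q / ((k : ℝ) + 2) := by
    refine le_trans ?_ (one_sub_pow_div_pow_le q k)
    have : (T : ℝ) ≤ (((k + 1 + 1) ^ q : ℕ) : ℝ) := by exact_mod_cast hT2
    gcongr
  have h3 := mul_le_mul_of_nonneg_left h2 (by positivity : 0 ≤ 2 * C)
  have h4 := abs_sub_le (avg (fun t => ℓ t L) T) (avg (fun t => ℓ t L) ((k + 1) ^ q)) (e L)
  have h5 := hβe k L hL
  linarith

/-- A nonnegative sequence that is summable against the harmonic weights and whose increments are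
`O(1 / k)` tends to zero: the increments of its square are summable. -/
theorem tendsto_zero_of_summable_div {a : ℕ → ℝ} {B : ℝ} (ha : ∀ k, 0 ≤ a k)
    (hinc : ∀ k, |a (k + 1) - a k| ≤ B / ((k : ℝ) + 2))
    (hsum : Summable fun k => a k / ((k : ℝ) + 2)) : Tendsto a atTop (𝓝 0) := by
  have hB : 0 ≤ B := by
    have := (abs_nonneg _).trans (hinc 0)
    have h2 : (0 : ℝ) < ((0 : ℕ) : ℝ) + 2 := by positivity
    simpa using (le_div_iff₀ h2).1 this
  have hsq : Summable fun k : ℕ => (((k : ℝ) + 2) ^ 2)⁻¹ := by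
    have := (summable_nat_add_iff 2).2 (Real.summable_nat_pow_inv.2 one_lt_two)
    simpa using this
  have hdist : Summable fun k => dist (a k ^ 2) (a (k + 1) ^ 2) := by
    refine Summable.of_nonneg_of_le (fun k => dist_nonneg) (fun k => ?_)
      ((hsum.mul_left (2 * B)).add (hsq.mul_left (B ^ 2)))
    have hk : (0 : ℝ) < (k : ℝ) + 2 := by positivity
    rw [dist_comm, Real.dist_eq, sq_sub_sq, abs_mul, abs_of_nonneg (add_nonneg (ha _) (ha _))]
    have h1 : a (k + 1) + a k ≤ 2 * a k + B / ((k : ℝ) + 2) := by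
      linarith [(le_abs_self _).trans (hinc k)]
    refine (mul_le_mul h1 (hinc k) (abs_nonneg _) ?_).trans (le_of_eq ?_)
    · have := ha k
      positivity
    · field_simp
  obtain ⟨b, hb⟩ := cauchySeq_tendsto_of_complete (cauchySeq_of_summable_dist hdist)
  have hlim : Tendsto a atTop (𝓝 (√b)) := by
    have := hb.sqrt
    simpa [Real.sqrt_sq (ha _)] using this
  rcases (Real.sqrt_nonneg b).eq_or_lt with h | h
  · rwa [← h] at hlim
  · exfalso
    have hev : ∀ᶠ k in atTop, √b / 2 ≤ a k := hlim.eventually_const_le (by linarith)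
    have h2 : Summable fun k : ℕ => ((k : ℝ) + 2)⁻¹ := by
      refine Summable.of_norm_bounded_eventually_nat (hsum.mul_left (2 / √b)) ?_
      filter_upwards [hev] with k hk
      have hk0 : (0 : ℝ) < (k : ℝ) + 2 := by positivity
      rw [Real.norm_of_nonneg (by positivity), ← mul_div_assoc, inv_eq_one_div]
      gcongr
      rw [div_mul_eq_mul_div, le_div_iff₀ h]
      linarith
    have h3 : Summable fun k : ℕ => ((k : ℝ))⁻¹ := by
      refine (summable_nat_add_iff 2).1 ?_
      simpa using h2
    exact Real.not_summable_natCast_inv h3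

end Averages

/-! ### Online minimization of surrogates -/

section Surrogate

variable {E : Type*} [NormedAddCommGroup E] {ℓ S : ℕ → E → ℝ} {X : ℕ → E} {r e : E → ℝ}
  {C c R : ℝ}

/-- The data of an online majorization-minimization scheme on the ball of radius `R`: the loss
`ℓ t` of the `t`-th task is majorized by the surrogate `S t`, which is exact at the preceding
iterate; the iterate `X T` minimizes the regularized average of the surrogates up to time `T`, with
quadratic growth. -/
structure IsOnlineSurrogate (ℓ S : ℕ → E → ℝ) (X : ℕ → E) (r : E → ℝ) (C c R : ℝ) : Prop where
  c_pos : 0 < c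
  C_nonneg : 0 ≤ C
  norm_le : ∀ T, 1 ≤ T → ‖X T‖ ≤ R
  loss_nonneg : ∀ t L, 1 ≤ t → ‖L‖ ≤ R → 0 ≤ ℓ t L
  loss_le : ∀ t L, 1 ≤ t → ‖L‖ ≤ R → ℓ t L ≤ S t L
  surrogate_le : ∀ t L, 1 ≤ t → ‖L‖ ≤ R → S t L ≤ C
  lip_loss : ∀ t L L', 1 ≤ t → ‖L‖ ≤ R → ‖L'‖ ≤ R → |ℓ t L - ℓ t L'| ≤ C * ‖L - L'‖
  lip_surrogate : ∀ t L L', 1 ≤ t → ‖L‖ ≤ R → ‖L'‖ ≤ R → |S t L - S t L'| ≤ C * ‖L - L'‖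
  tight : ∀ t, 1 ≤ t → S (t + 1) (X t) = ℓ (t + 1) (X t)
  reg_nonneg : ∀ L, 0 ≤ r L
  growth : ∀ T L, 1 ≤ T → ‖L‖ ≤ R → avg (fun t => S t (X T)) T + r (X T) + c * ‖L - X T‖ ^ 2
    ≤ avg (fun t => S t L) T + r L

namespace IsOnlineSurrogate

theorem loss_le_const (h : IsOnlineSurrogate ℓ S X r C c R) {t : ℕ} {L : E} (ht : 1 ≤ t)
    (hL : ‖L‖ ≤ R) : |ℓ t L| ≤ C := by
  rw [abs_of_nonneg (h.loss_nonneg t L ht hL)]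
  exact (h.loss_le t L ht hL).trans (h.surrogate_le t L ht hL)

theorem surrogate_abs_le (h : IsOnlineSurrogate ℓ S X r C c R) {t : ℕ} {L : E} (ht : 1 ≤ t)
    (hL : ‖L‖ ≤ R) : |S t L| ≤ C := by
  rw [abs_of_nonneg ((h.loss_nonneg t L ht hL).trans (h.loss_le t L ht hL))]
  exact h.surrogate_le t L ht hL

/-- The iterates move slowly: they minimize strongly convex functions that change little. -/
theorem norm_sub_le (h : IsOnlineSurrogate ℓ S X r C c R) {n m : ℕ} (hn : 1 ≤ n) (hnm : n ≤ m) :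
    ‖X m - X n‖ ≤ C / c * (1 - (n : ℝ) / m) := by
  have hm := hn.trans hnm
  have h1 := h.growth m (X n) hm (h.norm_le n hn)
  have h2 := h.growth n (X m) hn (h.norm_le m hm)
  have h3 := abs_avg_sub_avg_le (v := fun t => S t (X n) - S t (X m))
    (fun t ht => h.lip_surrogate t _ _ ht (h.norm_le n hn) (h.norm_le m hm)) hn hnm
  rw [avg_sub, avg_sub, norm_sub_rev] at h3
  rw [norm_sub_rev] at h1
  have h4 := (le_abs_self _).trans h3
  have h5 : c * ‖X m - X n‖ ^ 2 ≤ C * ‖X m - X n‖ * (1 - (n : ℝ) / m) := by linarith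
  rcases (norm_nonneg (X m - X n)).eq_or_lt with h6 | h6
  · rw [← h6]
    have hm0 : (0 : ℝ) < m := by exact_mod_cast hm
    have : 0 ≤ 1 - (n : ℝ) / m := sub_nonneg.2 ((div_le_one hm0).2 (by exact_mod_cast hnm))
    have := h.C_nonneg
    have := h.c_pos
    positivity
  · rw [div_mul_eq_mul_div, le_div_iff₀ h.c_pos]
    refine le_of_mul_le_mul_right ?_ h6
    linarith

/-- The gap between the surrogate and the empirical loss at the current iterate. -/
noncomputable def gap (ℓ S : ℕ → E → ℝ) (X : ℕ → E) (T : ℕ) : ℝ :=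
  avg (fun t => S t (X T)) T - avg (fun t => ℓ t (X T)) T

theorem gap_nonneg (h : IsOnlineSurrogate ℓ S X r C c R) {T : ℕ} (hT : 1 ≤ T) :
    0 ≤ gap ℓ S X T :=
  sub_nonneg.2 (avg_mono fun t ht => h.loss_le t _ ht (h.norm_le T hT))

theorem abs_gap_sub_le (h : IsOnlineSurrogate ℓ S X r C c R) {n m : ℕ} (hn : 1 ≤ n)
    (hnm : n ≤ m) :
    |gap ℓ S X m - gap ℓ S X n| ≤ 2 * (C * (C / c) + 2 * C) * (1 - (n : ℝ) / m) := by
  have hm := hn.trans hnm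
  have hX := mul_le_mul_of_nonneg_left (h.norm_sub_le hn hnm) h.C_nonneg
  have key : ∀ f : ℕ → E → ℝ, (∀ t L, 1 ≤ t → ‖L‖ ≤ R → |f t L| ≤ C) →
      (∀ t L L', 1 ≤ t → ‖L‖ ≤ R → ‖L'‖ ≤ R → |f t L - f t L'| ≤ C * ‖L - L'‖) →
      |avg (fun t => f t (X m)) m - avg (fun t => f t (X n)) n|
        ≤ (C * (C / c) + 2 * C) * (1 - (n : ℝ) / m) := by
    intro f hf hlip
    have h1 := abs_avg_le hm (v := fun t => f t (X m) - f t (X n))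
      (fun t ht => hlip t _ _ ht (h.norm_le m hm) (h.norm_le n hn))
    rw [avg_sub] at h1
    have h2 := abs_avg_sub_avg_le (v := fun t => f t (X n))
      (fun t ht => hf t _ ht (h.norm_le n hn)) hn hnm
    have h3 := abs_sub_le (avg (fun t => f t (X m)) m) (avg (fun t => f t (X n)) m)
      (avg (fun t => f t (X n)) n)
    linarith
  have h1 := key S (fun t L ht hL => h.surrogate_abs_le ht hL) h.lip_surrogate
  have h2 := key ℓ (fun t L ht hL => h.loss_le_const ht hL) h.lip_loss
  have h3 : gap ℓ S X m - gap ℓ S X n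
      = (avg (fun t => S t (X m)) m - avg (fun t => S t (X n)) n)
        - (avg (fun t => ℓ t (X m)) m - avg (fun t => ℓ t (X n)) n) := by
    simp only [gap]; ring
  rw [h3]
  exact (abs_sub _ _).trans (by linarith)

/-- Descent over the block of times `n < t ≤ m`: the minimal value of the surrogates decreases by
the relative length of the block times the gap, up to the fluctuation of the empirical loss and a
term quadratic in the relative length. -/
theorem descent (h : IsOnlineSurrogate ℓ S X r C c R) {n m : ℕ} (hn : 1 ≤ n) (hnm : n ≤ m) :
    avg (fun t => S t (X m)) m + r (X m) + (1 - (n : ℝ) / m) * gap ℓ S X n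
      ≤ avg (fun t => S t (X n)) n + r (X n)
        + (avg (fun t => ℓ t (X n)) m - avg (fun t => ℓ t (X n)) n)
        + 2 * C * (C / c) * (1 - (n : ℝ) / m) ^ 2 := by
  have hm := hn.trans hnm
  have hm0 : (0 : ℝ) < m := by exact_mod_cast hm
  have hn0 : (0 : ℝ) < n := by exact_mod_cast hn
  set θ := 1 - (n : ℝ) / m with hθ
  have hCc : 0 ≤ C / c := div_nonneg h.C_nonneg h.c_pos.le
  have h1 := h.growth m (X n) hm (h.norm_le n hn)
  have h2 : 0 ≤ c * ‖X n - X m‖ ^ 2 := mul_nonneg h.c_pos.le (sq_nonneg _)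
  have h3 : ∀ t ∈ Finset.Ioc n m, S t (X n) ≤ ℓ t (X n) + 2 * C * (C / c) * θ := by
    intro t ht
    obtain ⟨hnt, htm⟩ := Finset.mem_Ioc.1 ht
    obtain ⟨j, rfl⟩ : ∃ j, t = j + 1 := ⟨t - 1, by omega⟩
    have hnj : n ≤ j := by omega
    have hj : 1 ≤ j := hn.trans hnj
    have hj0 : (0 : ℝ) < j := by exact_mod_cast hj
    have hS := (le_abs_self _).trans (h.lip_surrogate (j + 1) (X n) (X j) (by omega)
      (h.norm_le n hn) (h.norm_le j hj))
    have hl := (le_abs_self _).trans (h.lip_loss (j + 1) (X j) (X n) (by omega)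
      (h.norm_le j hj) (h.norm_le n hn))
    have hθj : 1 - (n : ℝ) / j ≤ θ := by
      have hjm : (j : ℝ) ≤ m := by exact_mod_cast (by omega : j ≤ m)
      rw [hθ]
      gcongr
    have hX := mul_le_mul_of_nonneg_left
      ((h.norm_sub_le hn hnj).trans (mul_le_mul_of_nonneg_left hθj hCc)) h.C_nonneg
    rw [h.tight j hj, norm_sub_rev] at hS
    linarith
  have h4 : ∑ t ∈ Finset.Ioc n m, S t (X n)
      ≤ ∑ t ∈ Finset.Ioc n m, ℓ t (X n) + ((m : ℝ) - n) * (2 * C * (C / c) * θ) := by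
    refine (Finset.sum_le_sum h3).trans (le_of_eq ?_)
    rw [Finset.sum_add_distrib, Finset.sum_const, Nat.card_Ioc, nsmul_eq_mul, Nat.cast_sub hnm]
  have h5 := mul_le_mul_of_nonneg_left h4 (inv_pos.2 hm0).le
  have h6 : (m : ℝ)⁻¹ * (((m : ℝ) - n) * (2 * C * (C / c) * θ)) = 2 * C * (C / c) * θ ^ 2 := by
    have : (m : ℝ)⁻¹ * ((m : ℝ) - n) = θ := by rw [hθ]; field_simp
    rw [← mul_assoc, this]; ring
  have h7 := avg_eq_add_sum_Ioc (fun t => S t (X n)) hn hnm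
  have h8 := avg_eq_add_sum_Ioc (fun t => ℓ t (X n)) hn hnm
  have h9 : (n : ℝ) / m = 1 - θ := by rw [hθ]; ring
  rw [h9] at h7 h8
  rw [mul_add, h6] at h5
  simp only [gap]
  linarith

/-- The gap closes, provided that the empirical losses converge uniformly and summably fast along
the `q`-th powers. Over the blocks between consecutive `q`-th powers the descent inequality makes
the gaps summable against the relative lengths of the blocks, which are of the order `1 / k`. -/
theorem tendsto_gap (h : IsOnlineSurrogate ℓ S X r C c R) {q : ℕ} (hq : 1 ≤ q) {β : ℕ → ℝ}
    (hβ : Summable β)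
    (hβe : ∀ k L, ‖L‖ ≤ R → |avg (fun t => ℓ t L) ((k + 1) ^ q) - e L| ≤ β k) :
    Tendsto (gap ℓ S X) atTop (𝓝 0) := by
  have hCc : 0 ≤ C / c := div_nonneg h.C_nonneg h.c_pos.le
  have hC := h.C_nonneg
  have hn : ∀ k : ℕ, 1 ≤ (k + 1) ^ q := fun k => Nat.one_le_pow _ _ (Nat.succ_pos _)
  have hmono : ∀ k : ℕ, (k + 1) ^ q ≤ (k + 1 + 1) ^ q := fun k =>
    Nat.pow_le_pow_left (Nat.le_succ _) q
  set B := 2 * (C * (C / c) + 2 * C) with hB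
  have hB0 : 0 ≤ B := by positivity
  set v : ℕ → ℝ := fun k => avg (fun t => S t (X ((k + 1) ^ q))) ((k + 1) ^ q)
    + r (X ((k + 1) ^ q)) with hv
  set w : ℕ → ℝ := fun k => β k + β (k + 1) + 2 * C * (C / c) * q ^ 2 * (((k : ℝ) + 2) ^ 2)⁻¹
    with hw
  have hsq : Summable fun k : ℕ => (((k : ℝ) + 2) ^ 2)⁻¹ := by
    have := (summable_nat_add_iff 2).2 (Real.summable_nat_pow_inv.2 one_lt_two)
    simpa using this
  have hwsum : Summable w :=
    (hβ.add ((summable_nat_add_iff 1).2 hβ)).add (hsq.mul_left _)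
  have hβ0 : ∀ k, 0 ≤ β k := fun k =>
    (abs_nonneg _).trans (hβe k (X 1) (h.norm_le 1 le_rfl))
  have hw0 : ∀ k, 0 ≤ w k := fun k => by
    have := hβ0 k
    have := hβ0 (k + 1)
    positivity
  have hv0 : ∀ k, 0 ≤ v k := fun k => by
    have h1 : avg (fun _ => (0 : ℝ)) ((k + 1) ^ q)
        ≤ avg (fun t => S t (X ((k + 1) ^ q))) ((k + 1) ^ q) := avg_mono fun t ht =>
      (h.loss_nonneg t _ ht (h.norm_le _ (hn k))).trans (h.loss_le t _ ht (h.norm_le _ (hn k)))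
    rw [avg_const _ (hn k)] at h1
    exact add_nonneg h1 (h.reg_nonneg _)
  have hstep : ∀ k, gap ℓ S X ((k + 1) ^ q) / ((k : ℝ) + 2) ≤ v k - v (k + 1) + w k := by
    intro k
    have hk : (0 : ℝ) < (k : ℝ) + 2 := by positivity
    have h1 := h.descent (hn k) (hmono k)
    have h2 := one_sub_pow_div_pow_le q k
    have h3 := inv_le_one_sub_pow_div_pow hq k
    set θ := 1 - (((k + 1) ^ q : ℕ) : ℝ) / (((k + 1 + 1) ^ q : ℕ) : ℝ)
    have h4 : gap ℓ S X ((k + 1) ^ q) / ((k : ℝ) + 2) ≤ θ * gap ℓ S X ((k + 1) ^ q) := by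
      rw [div_eq_inv_mul]
      exact mul_le_mul_of_nonneg_right h3 (h.gap_nonneg (hn k))
    have h5 : 2 * C * (C / c) * θ ^ 2 ≤ 2 * C * (C / c) * q ^ 2 * (((k : ℝ) + 2) ^ 2)⁻¹ := by
      have h6 : θ ^ 2 ≤ (q / ((k : ℝ) + 2)) ^ 2 := pow_le_pow_left₀ ((by positivity : (0 : ℝ) ≤
        ((k : ℝ) + 2)⁻¹).trans h3) h2 2
      refine (mul_le_mul_of_nonneg_left h6 (by positivity)).trans (le_of_eq ?_)
      rw [div_pow]; ring
    have h6 := neg_le_of_abs_le (hβe k (X ((k + 1) ^ q)) (h.norm_le _ (hn k)))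
    have h7 := (le_abs_self _).trans (hβe (k + 1) (X ((k + 1) ^ q)) (h.norm_le _ (hn k)))
    simp only [hv, hw]
    linarith
  have hsum : Summable fun k : ℕ => gap ℓ S X ((k + 1) ^ q) / ((k : ℝ) + 2) := by
    refine summable_of_sum_range_le (c := v 0 + ∑' k, w k) (fun k => ?_) fun K => ?_
    · have := h.gap_nonneg (hn k)
      positivity
    · refine (Finset.sum_le_sum fun k _ => hstep k).trans ?_
      rw [Finset.sum_add_distrib, Finset.sum_range_sub']
      have := hwsum.sum_le_tsum (Finset.range K) (fun k _ => hw0 k)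
      linarith [hv0 K]
  have hlim : Tendsto (fun k => gap ℓ S X ((k + 1) ^ q)) atTop (𝓝 0) := by
    refine tendsto_zero_of_summable_div (B := B * q) (fun k => h.gap_nonneg (hn k)) (fun k => ?_)
      hsum
    refine (h.abs_gap_sub_le (hn k) (hmono k)).trans ?_
    rw [mul_div_assoc]
    exact mul_le_mul_of_nonneg_left (one_sub_pow_div_pow_le q k) hB0
  have hsmall : Tendsto (fun k : ℕ => B * (q / ((k : ℝ) + 2))) atTop (𝓝 0) := by
    have h1 : Tendsto (fun k : ℕ => (q : ℝ) / ((k : ℝ) + 2)) atTop (𝓝 0) :=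
      tendsto_const_nhds.div_atTop
        (tendsto_atTop_add_const_right _ _ tendsto_natCast_atTop_atTop)
    simpa using h1.const_mul B
  refine Metric.tendsto_nhds.2 fun ε hε => eventually_of_eventually_block hq ?_
  filter_upwards [hlim.eventually_lt_const (half_pos hε), hsmall.eventually_lt_const (half_pos hε)]
    with k hk1 hk2 T hT1 hT2
  have hT := (hn k).trans hT1
  have hT0 : (0 : ℝ) < T := by exact_mod_cast hT
  have h1 := (le_abs_self _).trans (h.abs_gap_sub_le (hn k) hT1)
  have h2 : 1 - (((k + 1) ^ q : ℕ) : ℝ) / T ≤ q / ((k : ℝ) + 2) := by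
    refine le_trans ?_ (one_sub_pow_div_pow_le q k)
    have : (T : ℝ) ≤ (((k + 1 + 1) ^ q : ℕ) : ℝ) := by exact_mod_cast hT2
    gcongr
  have h3 := mul_le_mul_of_nonneg_left h2 hB0
  rw [Real.dist_eq, sub_zero, abs_of_nonneg (h.gap_nonneg hT)]
  linarith

end IsOnlineSurrogate

end Surrogate

/-! ### Differentiability and stationarity -/

section Stationary

/-- An expectation of locally Lipschitz functions, almost all of which are differentiable at `x₀`,
is differentiable at `x₀`. -/
theorem differentiableAt_integral_of_lipschitz {E : Type*} [NormedAddCommGroup E]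
    [NormedSpace ℝ E] [FiniteDimensional ℝ E] {Ω : Type*} [MeasurableSpace Ω] {P : Measure Ω}
    [IsFiniteMeasure P] {F : E → Ω → ℝ} {x₀ : E} {Λ : ℝ}
    (hF : ∀ x, AEStronglyMeasurable (F x) P) (hint : Integrable (F x₀) P)
    (hlip : ∀ᵐ ω ∂P, ∀ x ∈ Metric.ball x₀ 1, |F x ω - F x₀ ω| ≤ Λ * ‖x - x₀‖)
    (hdiff : ∀ᵐ ω ∂P, DifferentiableAt ℝ (fun x => F x ω) x₀) :
    DifferentiableAt ℝ (fun x => ∫ ω, F x ω ∂P) x₀ := by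
  let F' : Ω → E →L[ℝ] ℝ := fun ω => fderiv ℝ (fun x => F x ω) x₀
  -- the derivative is a limit of difference quotients, hence measurable
  have happly : ∀ v, AEStronglyMeasurable (fun ω => F' ω v) P := by
    intro v
    refine aestronglyMeasurable_of_tendsto_ae atTop (f := fun (n : ℕ) ω =>
      (n : ℝ) • (F (x₀ + (n : ℝ)⁻¹ • v) ω - F x₀ ω)) (fun n =>
        ((hF (x₀ + (n : ℝ)⁻¹ • v)).sub (hF x₀)).const_smul (n : ℝ)) ?_
    filter_upwards [hdiff] with ω hω
    exact hω.hasFDerivAt.lim v (by simpa using tendsto_natCast_atTop_atTop)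
  have hF' : AEStronglyMeasurable F' P := by
    let b := Module.finBasis ℝ E
    have h1 : F' = fun ω => ∑ i, F' ω (b i) • LinearMap.toContinuousLinearMap (b.coord i) := by
      ext ω v
      have h2 := congrArg (F' ω) (b.sum_repr v)
      rw [map_sum] at h2
      rw [← h2]
      simp [mul_comm]
    rw [h1]
    exact Finset.aestronglyMeasurable_fun_sum _ fun i _ => (happly (b i)).smul_const _
  exact (hasFDerivAt_integral_of_dominated_loc_of_lip' (bound := fun _ => Λ)
    (Metric.ball_mem_nhds x₀ one_pos) (fun x _ => hF x) hint hF' hlip (integrable_const _)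
    (hdiff.mono fun ω hω => hω.hasFDerivAt)).2.differentiableAt

theorem hasFDerivAt_zero_of_le_add_sq {E : Type*} [NormedAddCommGroup E] [InnerProductSpace ℝ E]
    {f : E → ℝ} {x : E} {C : ℝ} (hf : DifferentiableAt ℝ f x)
    (h : ∀ y, f y ≤ f x + C * ‖y - x‖ ^ 2) : HasFDerivAt f (0 : E →L[ℝ] ℝ) x := by
  have h1 : HasFDerivAt (fun y => C * ‖y - x‖ ^ 2) (0 : E →L[ℝ] ℝ) x := by
    have := ((((hasFDerivAt_id x).sub_const x).norm_sq).const_mul C)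
    simpa using this
  have h2 := hf.hasFDerivAt.sub h1
  have h3 : IsLocalMax (fun y => f y - C * ‖y - x‖ ^ 2) x := by
    refine Eventually.of_forall fun y => ?_
    have := h y
    simp only [sub_self, norm_zero, ne_eq, OfNat.ofNat_ne_zero, not_false_eq_true, zero_pow,
      mul_zero, sub_zero]
    linarith
  have h4 := h3.hasFDerivAt_eq_zero h2
  rw [sub_zero] at h4
  rw [← h4]
  exact hf.hasFDerivAt

theorem differentiableAt_sum_const_mul_norm_sq {E : Type*} [NormedAddCommGroup E]
    [InnerProductSpace ℝ E] {ι : Type*} [Fintype ι] (lam : ℝ) (x : E) :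
    DifferentiableAt ℝ (fun y => ∑ _i : ι, lam * ‖y‖ ^ 2) x := by
  have h1 : DifferentiableAt ℝ (fun y : E => lam * ‖y‖ ^ 2) x :=
    (differentiableAt_id.norm_sq ℝ).const_mul lam
  exact DifferentiableAt.fun_sum fun i _ => h1

/-- A bounded sequence whose limit points belong to `s` approaches `s`. -/
theorem tendsto_infEDist_of_subseq_mem {E : Type*} [PseudoMetricSpace E] [ProperSpace E]
    {X : ℕ → E} {s : Set E} {K : Set E} (hK : Bornology.IsBounded K)
    (hX : ∀ T, X T ∈ K)
    (h : ∀ (φ : ℕ → ℕ) x, StrictMono φ → Tendsto (X ∘ φ) atTop (𝓝 x) → x ∈ s) :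
    Tendsto (fun T => Metric.infEDist (X T) s) atTop (𝓝 0) := by
  refine ENNReal.tendsto_nhds_zero.2 fun ε hε => ?_
  by_contra hcon
  obtain ⟨ψ, hψ, hψε⟩ := extraction_of_frequently_atTop (not_eventually.1 hcon)
  obtain ⟨x, -, φ, hφ, hlim⟩ := tendsto_subseq_of_bounded hK (fun n => hX (ψ n))
  have hx : x ∈ s := h (ψ ∘ φ) x (hψ.comp hφ) hlim
  have h1 : Tendsto (fun n => edist (X (ψ (φ n))) x) atTop (𝓝 0) :=
    tendsto_iff_edist_tendsto_0.1 hlim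
  obtain ⟨n, hn⟩ := (h1.eventually_le_const hε).exists
  exact hψε (φ n) ((Metric.infEDist_le_edist_of_mem hx).trans hn)

end Stationary

/-! ### The algorithm as an online surrogate scheme -/

section Run

open CoLLA

variable {N d u : ℕ} {mu lam A B S₀ : ℝ} {α : ℕ → Fin N → Fin d → ℝ}
  {Γ : ℕ → Fin N → Matrix (Fin d) (Fin d) ℝ} {s : ℕ → Fin N → Fin u → ℝ} {X : ℕ → Dict d u}

theorem sum_localObjective_eq (T : ℕ) (L : Dict d u) :
    ∑ i, localObjective mu lam α Γ s T i L
      = avg (fun t => ∑ i, lassoObjective mu (α t i) (Γ t i) L (s t i)) T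
        + ∑ _i : Fin N, lam * ‖L‖ ^ 2 := by
  simp only [localObjective, avg, Finset.sum_add_distrib]
  rw [← Finset.mul_sum, Finset.sum_comm]

theorem localQuad_le (hbd : ∀ t i, IsBoundedTask A B (α t i) (Γ t i))
    (hs : ∀ t i, 1 ≤ t → ∑ j, |s t i j| ≤ S₀) {T : ℕ} (hT : 1 ≤ T) (i : Fin N) (h : Dict d u) :
    localQuad lam Γ s T i h ≤ (B * S₀ ^ 2 + lam) * ‖h‖ ^ 2 := by
  have h1 : avg (fun t => (h *ᵥ s t i) ⬝ᵥ (Γ t i *ᵥ (h *ᵥ s t i))) T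
      ≤ avg (fun _ => B * S₀ ^ 2 * ‖h‖ ^ 2) T :=
    avg_mono fun t ht => (hbd t i).quad_le h (hs t i ht)
  rw [avg_const _ hT] at h1
  unfold localQuad
  unfold avg at h1
  linarith

/-- Quadratic growth and quadratic upper bound of the sum of the local objectives around its
minimizer. -/
theorem sum_localObjective_bounds (hbd : ∀ t i, IsBoundedTask A B (α t i) (Γ t i))
    (hs : ∀ t i, 1 ≤ t → ∑ j, |s t i j| ≤ S₀) {T : ℕ} (hT : 1 ≤ T) {Y : Dict d u}
    (hY : ∀ L, ∑ i, localObjective mu lam α Γ s T i Y ≤ ∑ i, localObjective mu lam α Γ s T i L)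
    (L : Dict d u) :
    ∑ i, localObjective mu lam α Γ s T i Y + N * lam * ‖L - Y‖ ^ 2
        ≤ ∑ i, localObjective mu lam α Γ s T i L ∧
      ∑ i, localObjective mu lam α Γ s T i L
        ≤ ∑ i, localObjective mu lam α Γ s T i Y + N * (B * S₀ ^ 2 + lam) * ‖L - Y‖ ^ 2 := by
  have hquad := IsQuadratic.sum (s := Finset.univ) fun i _ =>
    isQuadratic_localObjective (mu := mu) (lam := lam) (α := α) (s := s)
      (fun t i => (hbd t i).posSemidef) T i
  have h1 := hquad.add Y (L - Y)
  rw [add_sub_cancel, hquad.deriv_eq_zero_of_isMin hY, add_zero] at h1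
  rw [h1]
  constructor
  · have h2 : ∑ _i : Fin N, lam * ‖L - Y‖ ^ 2 ≤ ∑ i, localQuad lam Γ s T i (L - Y) :=
      Finset.sum_le_sum fun i _ => le_localQuad (fun t i => (hbd t i).posSemidef) T i _
    simp only [Finset.sum_const, Finset.card_univ, Fintype.card_fin, nsmul_eq_mul] at h2
    linarith
  · have h2 : ∑ i, localQuad lam Γ s T i (L - Y)
        ≤ ∑ _i : Fin N, (B * S₀ ^ 2 + lam) * ‖L - Y‖ ^ 2 :=
      Finset.sum_le_sum fun i _ => localQuad_le hbd hs hT i _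
    simp only [Finset.sum_const, Finset.card_univ, Fintype.card_fin, nsmul_eq_mul] at h2
    linarith

/-- The minimizers are bounded, by comparison with the zero dictionary. -/
theorem norm_minimizer_le (hN : 0 < N) (hmu : 0 ≤ mu) (hlam : 0 < lam)
    (hbd : ∀ t i, IsBoundedTask A B (α t i) (Γ t i))
    (hs : ∀ t i, 1 ≤ t → ∑ j, |s t i j| ≤ S₀) {T : ℕ} (hT : 1 ≤ T) {Y : Dict d u}
    (hY : ∀ L, ∑ i, localObjective mu lam α Γ s T i Y ≤ ∑ i, localObjective mu lam α Γ s T i L) :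
    ‖Y‖ ≤ √((B * A ^ 2 + mu * S₀) / lam) := by
  have hN' : (0 : ℝ) < N := by exact_mod_cast hN
  refine Real.le_sqrt_of_sq_le ?_
  rw [le_div_iff₀ hlam]
  have h1 : ∑ _i : Fin N, lam * ‖Y‖ ^ 2 ≤ ∑ i, localObjective mu lam α Γ s T i Y :=
    Finset.sum_le_sum fun i _ => le_localObjective hmu (fun t i => (hbd t i).posSemidef) T i Y
  have h2 := h1.trans (hY 0)
  have h3 : avg (fun t => ∑ i, lassoObjective mu (α t i) (Γ t i) (0 : Dict d u) (s t i)) T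
      ≤ avg (fun _ => ∑ _i : Fin N, (B * A ^ 2 + mu * S₀)) T := by
    refine avg_mono fun t ht => Finset.sum_le_sum fun i _ => ?_
    have := (hbd t i).lassoObjective_le hmu (R := 0) (L := (0 : Dict d u)) (by simp) (hs t i ht)
    simpa using this
  rw [avg_const _ hT] at h3
  rw [sum_localObjective_eq] at h2
  simp only [Finset.sum_const, Finset.card_univ, Fintype.card_fin, nsmul_eq_mul, norm_zero, ne_eq,
    OfNat.ofNat_ne_zero, not_false_eq_true, zero_pow, mul_zero, add_zero] at h2 h3
  have h4 := h2.trans h3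
  have h5 := le_of_mul_le_mul_left h4 hN'
  linarith

/-- The sparse codes being fixed, the LASSO objectives are surrogates of the task losses for an
online majorization-minimization scheme that produces the common dictionaries `X T`. -/
theorem exists_isOnlineSurrogate (hN : 0 < N) (hmu : 0 < mu) (hlam : 0 < lam)
    (hbd : ∀ t i, IsBoundedTask A B (α t i) (Γ t i))
    (hs : ∀ t i, 1 ≤ t → ∑ j, |s t i j| ≤ B * A ^ 2 / mu)
    (hcode : ∀ T i, 1 ≤ T → IsLassoSolution mu (α (T + 1) i) (Γ (T + 1) i) (X T) (s (T + 1) i))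
    (hmin : ∀ T, 1 ≤ T → ∀ L, ∑ i, localObjective mu lam α Γ s T i (X T)
      ≤ ∑ i, localObjective mu lam α Γ s T i L) :
    ∃ C R, IsOnlineSurrogate (fun t L => ∑ i, taskLoss mu (α t i) (Γ t i) L)
      (fun t L => ∑ i, lassoObjective mu (α t i) (Γ t i) L (s t i)) X
      (fun L => ∑ _i : Fin N, lam * ‖L‖ ^ 2) C (N * lam) R := by
  have hN' : (0 : ℝ) < N := by exact_mod_cast hN
  set S₀ := B * A ^ 2 / mu with hS₀
  set R := √((B * A ^ 2 + mu * S₀) / lam) with hR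
  have hR0 : 0 ≤ R := Real.sqrt_nonneg _
  have hA := (hbd 0 ⟨0, hN⟩).nonneg_left
  have hB := (hbd 0 ⟨0, hN⟩).nonneg_right
  have hS0 : 0 ≤ S₀ := by positivity
  set C₁ := B * (A + R * S₀) ^ 2 + mu * S₀ with hC₁
  set C₂ := 2 * B * S₀ * (A + R * S₀) with hC₂
  have hC₁0 : 0 ≤ C₁ := by positivity
  have hC₂0 : 0 ≤ C₂ := by positivity
  have hlip : ∀ f : Fin N → Dict d u → ℝ, ∀ L L' : Dict d u,
      (∀ i, |f i L - f i L'| ≤ C₂ * ‖L - L'‖) →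
      |∑ i, f i L - ∑ i, f i L'| ≤ N * (C₁ + C₂) * ‖L - L'‖ := by
    intro f L L' hf
    rw [← Finset.sum_sub_distrib]
    refine (Finset.abs_sum_le_sum_abs _ _).trans ((Finset.sum_le_sum fun i _ => hf i).trans ?_)
    rw [Finset.sum_const, Finset.card_univ, Fintype.card_fin, nsmul_eq_mul]
    exact (mul_le_mul_of_nonneg_left (mul_le_mul_of_nonneg_right
      (by linarith : C₂ ≤ C₁ + C₂) (norm_nonneg (L - L'))) hN'.le).trans
      (le_of_eq (mul_assoc _ _ _).symm)
  refine ⟨N * (C₁ + C₂), R, ?_⟩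
  exact
    { c_pos := by positivity
      C_nonneg := by positivity
      norm_le := fun T hT => norm_minimizer_le hN hmu.le hlam hbd hs hT (hmin T hT)
      loss_nonneg := fun t L _ _ => Finset.sum_nonneg fun i _ =>
        taskLoss_nonneg hmu.le (hbd t i).posSemidef L
      loss_le := fun t L _ _ => Finset.sum_le_sum fun i _ =>
        taskLoss_le hmu.le (hbd t i).posSemidef L _
      surrogate_le := fun t L ht hL => by
        refine (Finset.sum_le_sum fun i _ =>
          (hbd t i).lassoObjective_le hmu.le hL (hs t i ht)).trans ?_
        rw [Finset.sum_const, Finset.card_univ, Fintype.card_fin, nsmul_eq_mul]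
        exact mul_le_mul_of_nonneg_left (by linarith) hN'.le
      lip_loss := fun t L L' _ hL hL' =>
        hlip (fun i L => taskLoss mu (α t i) (Γ t i) L) L L' fun i =>
          (hbd t i).abs_taskLoss_sub_le hmu hL hL'
      lip_surrogate := fun t L L' ht hL hL' =>
        hlip (fun i L => lassoObjective mu (α t i) (Γ t i) L (s t i)) L L' fun i =>
          (hbd t i).abs_lassoObjective_sub_le hL hL' (hs t i ht)
      tight := fun t ht => Finset.sum_congr rfl fun i _ => ((hcode t i ht).taskLoss_eq).symm
      reg_nonneg := fun L => Finset.sum_nonneg fun i _ => by positivity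
      growth := fun T L hT _ => by
        have := (sum_localObjective_bounds hbd hs hT (hmin T hT) L).1
        rwa [sum_localObjective_eq, sum_localObjective_eq] at this }

/-- The regularized empirical loss is bounded above by a paraboloid that touches it, up to the
surrogate gap, at the current dictionary. -/
theorem avg_taskLoss_le_add_gap (hmu : 0 < mu)
    (hbd : ∀ t i, IsBoundedTask A B (α t i) (Γ t i))
    (hs : ∀ t i, 1 ≤ t → ∑ j, |s t i j| ≤ S₀)
    (hmin : ∀ T, 1 ≤ T → ∀ L, ∑ i, localObjective mu lam α Γ s T i (X T)
      ≤ ∑ i, localObjective mu lam α Γ s T i L) {T : ℕ} (hT : 1 ≤ T) (L : Dict d u) :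
    avg (fun t => ∑ i, taskLoss mu (α t i) (Γ t i) L) T + ∑ _i : Fin N, lam * ‖L‖ ^ 2
      ≤ avg (fun t => ∑ i, taskLoss mu (α t i) (Γ t i) (X T)) T
        + ∑ _i : Fin N, lam * ‖X T‖ ^ 2
        + IsOnlineSurrogate.gap (fun t L => ∑ i, taskLoss mu (α t i) (Γ t i) L)
          (fun t L => ∑ i, lassoObjective mu (α t i) (Γ t i) L (s t i)) X T
        + N * (B * S₀ ^ 2 + lam) * ‖L - X T‖ ^ 2 := by
  have h1 := (sum_localObjective_bounds hbd hs hT (hmin T hT) L).2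
  rw [sum_localObjective_eq, sum_localObjective_eq] at h1
  have h2 : avg (fun t => ∑ i, taskLoss mu (α t i) (Γ t i) L) T
      ≤ avg (fun t => ∑ i, lassoObjective mu (α t i) (Γ t i) L (s t i)) T :=
    avg_mono fun t _ => Finset.sum_le_sum fun i _ => taskLoss_le hmu.le (hbd t i).posSemidef L _
  simp only [IsOnlineSurrogate.gap]
  linarith

end Run

/-! ### The empirical and the expected risk -/

section Risk

open CoLLA

variable {N d u M : ℕ} {loss : TaskData d M → (Fin d → ℝ) → ℝ} {gam mu lam A B : ℝ}

/-- The sum over the agents of the losses `F_i(L)` of the tasks with data `y`. -/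
noncomputable def totalLoss (loss : TaskData d M → (Fin d → ℝ) → ℝ) (gam mu : ℝ)
    (y : Fin N → TaskData d M) (L : Dict d u) : ℝ :=
  ∑ i, taskLoss mu (ridgeEstimator loss gam (y i)) (lossHessian loss gam (y i)) L

theorem empiricalRisk_eq (y : ℕ → Fin N → TaskData d M) (T : ℕ) (L : Dict d u) :
    empiricalRisk loss gam mu lam y T L
      = avg (fun t => totalLoss loss gam mu (y t) L) T + ∑ _i : Fin N, lam * ‖L‖ ^ 2 := rfl

theorem abs_totalLoss_le (hmu : 0 < mu) {y : Fin N → TaskData d M}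
    (hy : ∀ i, IsBoundedTask A B (ridgeEstimator loss gam (y i)) (lossHessian loss gam (y i)))
    (L : Dict d u) : |totalLoss loss gam mu y L| ≤ N * (B * A ^ 2) := by
  have h1 : 0 ≤ totalLoss loss gam mu y L :=
    Finset.sum_nonneg fun i _ => taskLoss_nonneg hmu.le (hy i).posSemidef L
  rw [abs_of_nonneg h1]
  refine (Finset.sum_le_sum fun i _ => (hy i).taskLoss_le_const hmu.le L).trans (le_of_eq ?_)
  simp

theorem abs_totalLoss_sub_le (hmu : 0 < mu) {y : Fin N → TaskData d M}
    (hy : ∀ i, IsBoundedTask A B (ridgeEstimator loss gam (y i)) (lossHessian loss gam (y i)))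
    {R : ℝ} {L L' : Dict d u} (hL : ‖L‖ ≤ R) (hL' : ‖L'‖ ≤ R) :
    |totalLoss loss gam mu y L - totalLoss loss gam mu y L'|
      ≤ N * (2 * B * (B * A ^ 2 / mu) * (A + R * (B * A ^ 2 / mu))) * ‖L - L'‖ := by
  unfold totalLoss
  rw [← Finset.sum_sub_distrib]
  refine (Finset.abs_sum_le_sum_abs _ _).trans
    ((Finset.sum_le_sum fun i _ => (hy i).abs_taskLoss_sub_le hmu hL hL').trans (le_of_eq ?_))
  simp [mul_assoc]

variable {Ω : Type*} [MeasurableSpace Ω] {P : Measure Ω}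
  {x : ℕ → Ω → Fin N → TaskData d M}

theorem exists_measurable_totalLoss (hmu : 0 < mu) (hgam : 0 < gam)
    (hconv : ∀ x, ConvexOn ℝ Set.univ (loss x))
    (hcont : Continuous fun p : TaskData d M × (Fin d → ℝ) => loss p.1 p.2)
    (hhess : Continuous fun p : TaskData d M × (Fin d → ℝ) => iteratedFDeriv ℝ 2 (loss p.1) p.2)
    (L : Dict d u) :
    ∃ g : (Fin N → TaskData d M) → ℝ, Measurable g ∧
      ∀ y, (∀ i, (lossHessian loss gam (y i)).PosSemidef) → totalLoss loss gam mu y L = g y := by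
  obtain ⟨g, hg, hgy⟩ := exists_measurable_taskLoss (mu := mu) hmu.le hgam hconv hcont hhess L
  refine ⟨fun y => ∑ i, g (y i), by fun_prop, fun y hy => ?_⟩
  exact Finset.sum_congr rfl fun i _ => hgy _ (hy i)

/-- The standing assumptions on the random data: i.i.d. in time, almost surely uniformly bounded,
with measurable losses. -/
structure IsTaskProcess (P : Measure Ω) (loss : TaskData d M → (Fin d → ℝ) → ℝ) (gam mu A B : ℝ)
    (u : ℕ) (x : ℕ → Ω → Fin N → TaskData d M) : Prop where
  mu_pos : 0 < mu
  measurable : ∀ t, Measurable (x t)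
  indep : iIndepFun x P
  ident : ∀ t, IdentDistrib (x t) (x 1) P P
  bounded : ∀ᵐ ω ∂P, ∀ t i, IsBoundedTask A B (ridgeEstimator loss gam (x t ω i))
    (lossHessian loss gam (x t ω i))
  exists_measurable : ∀ L : Dict d u, ∃ g : (Fin N → TaskData d M) → ℝ, Measurable g ∧
    ∀ y, (∀ i, (lossHessian loss gam (y i)).PosSemidef) → totalLoss loss gam mu y L = g y

namespace IsTaskProcess

theorem aemeasurable (h : IsTaskProcess P loss gam mu A B u x) (t : ℕ) (L : Dict d u) :
    AEMeasurable (fun ω => totalLoss loss gam mu (x t ω) L) P := by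
  obtain ⟨g, hg, hgy⟩ := h.exists_measurable L
  refine ⟨fun ω => g (x t ω), hg.comp (h.measurable t), ?_⟩
  filter_upwards [h.bounded] with ω hω
  exact hgy _ fun i => (hω t i).posSemidef

theorem identDistrib (h : IsTaskProcess P loss gam mu A B u x) (t : ℕ) (L : Dict d u) :
    IdentDistrib (fun ω => totalLoss loss gam mu (x t ω) L)
      (fun ω => totalLoss loss gam mu (x 1 ω) L) P P := by
  obtain ⟨g, hg, hgy⟩ := h.exists_measurable L
  have h1 : ∀ t, (fun ω => totalLoss loss gam mu (x t ω) L) =ᵐ[P] g ∘ x t := fun t => by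
    filter_upwards [h.bounded] with ω hω
    exact hgy _ fun i => (hω t i).posSemidef
  exact (IdentDistrib.of_ae_eq (h.aemeasurable t L) (h1 t)).trans
    (((h.ident t).comp hg).trans (IdentDistrib.of_ae_eq (h.aemeasurable 1 L) (h1 1)).symm)

theorem iIndepFun (h : IsTaskProcess P loss gam mu A B u x) (L : Dict d u) :
    ProbabilityTheory.iIndepFun (fun t ω => totalLoss loss gam mu (x t ω) L) P := by
  obtain ⟨g, hg, hgy⟩ := h.exists_measurable L
  refine (h.indep.comp (fun _ => g) (fun _ => hg)).congr fun t => ?_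
  filter_upwards [h.bounded] with ω hω
  exact (hgy _ fun i => (hω t i).posSemidef).symm

variable [IsProbabilityMeasure P]

theorem integrable (h : IsTaskProcess P loss gam mu A B u x) (t : ℕ) (L : Dict d u) :
    Integrable (fun ω => totalLoss loss gam mu (x t ω) L) P := by
  refine Integrable.of_bound (h.aemeasurable t L).aestronglyMeasurable (N * (B * A ^ 2)) ?_
  filter_upwards [h.bounded] with ω hω
  exact abs_totalLoss_le h.mu_pos (hω t) L

theorem integrable_empiricalRisk (h : IsTaskProcess P loss gam mu A B u x) (T : ℕ) (L : Dict d u) :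
    Integrable (fun ω => empiricalRisk loss gam mu lam (fun t => x t ω) T L) P :=
  ((integrable_finsetSum _ fun t _ => h.integrable t L).const_mul _).add (integrable_const _)

theorem expectedRisk_eq (h : IsTaskProcess P loss gam mu A B u x) {T : ℕ} (hT : 1 ≤ T) :
    (expectedRisk P loss gam mu lam x T : Dict d u → ℝ)
      = fun L => ∫ ω, totalLoss loss gam mu (x 1 ω) L ∂P + ∑ _i : Fin N, lam * ‖L‖ ^ 2 := by
  have hT0 : (T : ℝ) ≠ 0 := by positivity
  ext L
  simp only [expectedRisk, empiricalRisk_eq, avg]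
  rw [integral_add ((integrable_finsetSum _ fun t _ => h.integrable t L).const_mul _)
    (integrable_const _)]
  rw [integral_const_mul, integral_finsetSum _ fun t _ => h.integrable t L]
  simp only [fun t => (h.identDistrib t L).integral_eq, Finset.sum_const, Nat.card_Icc,
    nsmul_eq_mul]
  simp [hT0]

theorem abs_integral_sub_le (h : IsTaskProcess P loss gam mu A B u x) {R : ℝ} {L L' : Dict d u}
    (hL : ‖L‖ ≤ R) (hL' : ‖L'‖ ≤ R) :
    |∫ ω, totalLoss loss gam mu (x 1 ω) L ∂P - ∫ ω, totalLoss loss gam mu (x 1 ω) L' ∂P|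
      ≤ N * (2 * B * (B * A ^ 2 / mu) * (A + R * (B * A ^ 2 / mu))) * ‖L - L'‖ := by
  rw [← integral_sub (h.integrable 1 L) (h.integrable 1 L')]
  have h1 := norm_integral_le_of_norm_le_const (μ := P)
    (f := fun ω => totalLoss loss gam mu (x 1 ω) L - totalLoss loss gam mu (x 1 ω) L')
    (C := N * (2 * B * (B * A ^ 2 / mu) * (A + R * (B * A ^ 2 / mu))) * ‖L - L'‖) ?_
  · rwa [probReal_univ, mul_one] at h1
  filter_upwards [h.bounded] with ω hω
  exact abs_totalLoss_sub_le h.mu_pos (hω 1) hL hL'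

/-- Almost surely, the empirical losses converge to the expected loss summably fast along a
sequence of powers, locally uniformly in the dictionary. -/
theorem ae_exists_rate (h : IsTaskProcess P loss gam mu A B u x) :
    ∀ᵐ ω ∂P, ∀ R : ℕ, ∃ β : ℕ → ℝ, Summable β ∧ ∀ k (L : Dict d u), ‖L‖ ≤ R →
      |avg (fun t => totalLoss loss gam mu (x t ω) L) ((k + 1) ^ (2 * (d * u) + 4))
        - ∫ ω, totalLoss loss gam mu (x 1 ω) L ∂P| ≤ β k := by
  have hmse := fun T (hT : 1 ≤ T) (L : Dict d u) => integral_sq_mean_sub_le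
    (fun t => h.aemeasurable t L) (h.iIndepFun L) (fun t => h.identDistrib t L)
    (C := N * (B * A ^ 2))
    (fun t => by filter_upwards [h.bounded] with ω hω; exact abs_totalLoss_le h.mu_pos (hω t) L) hT
  refine ae_exists_summable_bound (a := fun T ω L =>
    avg (fun t => totalLoss loss gam mu (x t ω) L) T - ∫ ω, totalLoss loss gam mu (x 1 ω) L ∂P)
    (fun T hT L => (hmse T hT L).1) (fun T hT L => (hmse T hT L).2) fun R => ?_
  set Λ := |N * (2 * B * (B * A ^ 2 / mu) * (A + R * (B * A ^ 2 / mu)))| with hΛ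
  refine ⟨2 * Λ, by positivity, ?_⟩
  filter_upwards [h.bounded] with ω hω T hT L L' hL hL'
  have hle := mul_le_mul_of_nonneg_right
    (le_abs_self (N * (2 * B * (B * A ^ 2 / mu) * (A + R * (B * A ^ 2 / mu)))))
    (norm_nonneg (L - L'))
  have h1 := abs_avg_le hT (v := fun t => totalLoss loss gam mu (x t ω) L
    - totalLoss loss gam mu (x t ω) L')
    (fun t _ => (abs_totalLoss_sub_le h.mu_pos (hω t) hL hL').trans hle)
  rw [avg_sub] at h1
  have h2 := (h.abs_integral_sub_le hL hL').trans hle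
  rw [sub_sub_sub_comm]
  exact (abs_sub _ _).trans (by linarith)

/-- The expected loss is differentiable at every dictionary at which the LASSO problems have unique
solutions. -/
theorem differentiableAt_integral (h : IsTaskProcess P loss gam mu A B u x) {L : Dict d u}
    (huniq : ∀ᵐ ω ∂P, ∀ i, ∃! v, IsLassoSolution mu (ridgeEstimator loss gam (x 1 ω i))
      (lossHessian loss gam (x 1 ω i)) L v) :
    DifferentiableAt ℝ (fun L => ∫ ω, totalLoss loss gam mu (x 1 ω) L ∂P) L := by
  refine differentiableAt_integral_of_lipschitz
    (F := fun L ω => totalLoss loss gam mu (x 1 ω) L)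
    (Λ := N * (2 * B * (B * A ^ 2 / mu) * (A + (‖L‖ + 1) * (B * A ^ 2 / mu))))
    (fun X => (h.aemeasurable 1 X).aestronglyMeasurable) (h.integrable 1 L) ?_ ?_
  · filter_upwards [h.bounded] with ω hω X hX
    refine abs_totalLoss_sub_le h.mu_pos (hω 1) ?_ (by linarith)
    have h1 := norm_sub_norm_le X L
    rw [Metric.mem_ball, dist_eq_norm] at hX
    linarith
  · filter_upwards [h.bounded, huniq] with ω hω hu
    refine DifferentiableAt.fun_sum fun i _ => ?_
    obtain ⟨v, hv, hv'⟩ := hu i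
    exact (hω 1 i).differentiableAt_taskLoss h.mu_pos hv hv'

end IsTaskProcess

end Risk

/-! ### Convergence of the algorithm -/

section Convergence

open CoLLA

variable {N d u M : ℕ} {loss : TaskData d M → (Fin d → ℝ) → ℝ} {gam mu lam A B : ℝ}
  {Ω : Type*} [MeasurableSpace Ω] {P : Measure Ω} [IsProbabilityMeasure P]
  {x : ℕ → Ω → Fin N → TaskData d M}

/-- The empirical risk converges to the expected risk locally uniformly. -/
theorem IsTaskProcess.tendstoLocallyUniformly (h : IsTaskProcess P loss gam mu A B u x) :
    ∀ᵐ ω ∂P, TendstoLocallyUniformly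
      (fun T (L : Dict d u) => empiricalRisk loss gam mu lam (fun t => x t ω) T L
        - expectedRisk P loss gam mu lam x T L) (fun _ => 0) atTop := by
  filter_upwards [h.bounded, h.ae_exists_rate] with ω hω hrate
  refine Metric.tendstoLocallyUniformly_iff.2 fun ε hε L => ?_
  obtain ⟨β, hβ, hβe⟩ := hrate ⌈‖L‖ + 1⌉₊
  refine ⟨Metric.ball L 1, Metric.ball_mem_nhds L one_pos, ?_⟩
  filter_upwards [eventually_forall_abs_avg_sub_lt (C := N * (B * A ^ 2))
    (fun t L _ => abs_totalLoss_le h.mu_pos (hω t) L) (by omega) hβ hβe hε,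
    eventually_ge_atTop 1] with T hT hT1 Y hY
  have h1 : ‖Y‖ ≤ (⌈‖L‖ + 1⌉₊ : ℝ) := by
    have h2 := norm_sub_norm_le Y L
    rw [Metric.mem_ball, dist_eq_norm] at hY
    have h3 := Nat.le_ceil (‖L‖ + 1)
    linarith
  rw [h.expectedRisk_eq hT1, empiricalRisk_eq, add_sub_add_right_eq_sub, dist_zero_left,
    Real.norm_eq_abs]
  exact hT Y h1

/-- A function which, along a sequence `X n → x`, is bounded above by paraboloids touching it at
`X n` up to errors `b n → 0`, is bounded above by a paraboloid touching it at `x`. -/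
theorem le_add_sq_of_tendsto {E : Type*} [NormedAddCommGroup E] {f : E → ℝ} {X : ℕ → E} {x y : E}
    {b : ℕ → ℝ} {C : ℝ} (hX : Tendsto X atTop (𝓝 x)) (hf : ContinuousAt f x)
    (hb : Tendsto b atTop (𝓝 0))
    (h : ∀ᶠ n in atTop, f y ≤ f (X n) + b n + C * ‖y - X n‖ ^ 2) :
    f y ≤ f x + C * ‖y - x‖ ^ 2 := by
  have h1 : Tendsto (fun n => f (X n) + b n + C * ‖y - X n‖ ^ 2) atTop
      (𝓝 (f x + 0 + C * ‖y - x‖ ^ 2)) :=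
    ((hf.tendsto.comp hX).add hb).add (((hX.const_sub y).norm.pow 2).const_mul C)
  rw [add_zero] at h1
  exact ge_of_tendsto h1 h

/-- On the event where the losses converge at a summable rate, the common dictionaries `X T`
approach the stationary points of the expected risk. -/
theorem IsTaskProcess.tendsto_infEDist (h : IsTaskProcess P loss gam mu A B u x)
    (hN : 0 < N) (hlam : 0 < lam) {ω : Ω}
    (hbd : ∀ t i, IsBoundedTask A B (ridgeEstimator loss gam (x t ω i))
      (lossHessian loss gam (x t ω i)))
    (hrate : ∀ R : ℕ, ∃ β : ℕ → ℝ, Summable β ∧ ∀ k (L : Dict d u), ‖L‖ ≤ R →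
      |avg (fun t => totalLoss loss gam mu (x t ω) L) ((k + 1) ^ (2 * (d * u) + 4))
        - ∫ ω, totalLoss loss gam mu (x 1 ω) L ∂P| ≤ β k)
    {s : ℕ → Fin N → Fin u → ℝ} {X : ℕ → Dict d u}
    (hs : ∀ t i, 1 ≤ t → ∑ j, |s t i j| ≤ B * A ^ 2 / mu)
    (hcode : ∀ T i, 1 ≤ T → IsLassoSolution mu (ridgeEstimator loss gam (x (T + 1) ω i))
      (lossHessian loss gam (x (T + 1) ω i)) (X T) (s (T + 1) i))
    (hmin : ∀ T, 1 ≤ T → ∀ L,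
      ∑ i, localObjective mu lam (fun t i => ridgeEstimator loss gam (x t ω i))
        (fun t i => lossHessian loss gam (x t ω i)) s T i (X T)
      ≤ ∑ i, localObjective mu lam (fun t i => ridgeEstimator loss gam (x t ω i))
        (fun t i => lossHessian loss gam (x t ω i)) s T i L)
    (huniq : ∀ Y, MapClusterPt Y atTop X → ∀ᵐ ω ∂P, ∀ i,
      ∃! v, IsLassoSolution mu (ridgeEstimator loss gam (x 1 ω i))
        (lossHessian loss gam (x 1 ω i)) Y v) :
    Tendsto (fun T => Metric.infEDist (X T)
      (stationaryPoints (expectedRisk P loss gam mu lam x T))) atTop (𝓝 0) := by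
  have hmu := h.mu_pos
  set e : Dict d u → ℝ := fun L => ∫ ω, totalLoss loss gam mu (x 1 ω) L ∂P with he
  set r : Dict d u → ℝ := fun L => ∑ _i : Fin N, lam * ‖L‖ ^ 2 with hr
  obtain ⟨C, R, hsur⟩ := exists_isOnlineSurrogate hN hmu hlam hbd hs hcode hmin
  obtain ⟨β, hβ, hβe⟩ := hrate ⌈R⌉₊
  have hq : 1 ≤ 2 * (d * u) + 4 := by omega
  have hR : R ≤ (⌈R⌉₊ : ℝ) := Nat.le_ceil R
  have hgap := hsur.tendsto_gap (e := e) hq hβ fun k L hL => hβe k L (hL.trans hR)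
  have hfix : ∀ᶠ T in atTop,
      expectedRisk P loss gam mu lam x T = fun L : Dict d u => e L + r L := by
    filter_upwards [eventually_ge_atTop 1] with T hT using h.expectedRisk_eq hT
  -- the sequence is shifted since nothing is known about `X 0`
  have hmain : Tendsto (fun T => Metric.infEDist (X (T + 1))
      (stationaryPoints fun L : Dict d u => e L + r L)) atTop (𝓝 0) := by
    refine tendsto_infEDist_of_subseq_mem (X := fun T => X (T + 1)) (K := Metric.closedBall 0 R)
      Metric.isBounded_closedBall
      (fun T => by simpa using hsur.norm_le (T + 1) (Nat.le_add_left 1 T)) fun φ Y hφ hlim => ?_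
    set ψ : ℕ → ℕ := fun n => φ n + 1 with hψ
    have hψ1 : ∀ n, 1 ≤ ψ n := fun n => Nat.le_add_left 1 _
    have hψt : Tendsto ψ atTop atTop := (tendsto_add_atTop_nat 1).comp hφ.tendsto_atTop
    have hlim' : Tendsto (fun n => X (ψ n)) atTop (𝓝 Y) := hlim
    have hdiff : DifferentiableAt ℝ e Y := h.differentiableAt_integral
      (huniq Y (hlim'.mapClusterPt.of_comp hψt))
    have hdiff2 : DifferentiableAt ℝ (fun L => e L + r L) Y :=
      hdiff.add (differentiableAt_sum_const_mul_norm_sq lam Y)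
    have hzero := hasFDerivAt_zero_of_le_add_sq (C := N * (B * (B * A ^ 2 / mu) ^ 2 + lam)) hdiff2
      fun L => ?_
    · exact hzero
    -- the touching paraboloids at `X T` pass to the limit, the errors being uniformly small
    set R' : ℕ := ⌈max R ‖L‖⌉₊ with hR'
    have hR1 : R ≤ R' := (le_max_left _ _).trans (Nat.le_ceil _)
    have hR2 : ‖L‖ ≤ R' := (le_max_right _ _).trans (Nat.le_ceil _)
    obtain ⟨β', hβ', hβe'⟩ := hrate R'
    have herr : ∀ Y : ℕ → Dict d u, (∀ n, ‖Y n‖ ≤ R') → Tendsto (fun n =>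
        avg (fun t => totalLoss loss gam mu (x t ω) (Y n)) (ψ n) - e (Y n)) atTop (𝓝 0) := by
      intro Y hY
      refine Metric.tendsto_nhds.2 fun ε hε => ?_
      filter_upwards [hψt.eventually (eventually_forall_abs_avg_sub_lt (C := N * (B * A ^ 2))
        (fun t L _ => abs_totalLoss_le hmu (hbd t) L) hq hβ' hβe' hε)] with n hn
      rw [dist_zero_right, Real.norm_eq_abs]
      exact hn _ (hY n)
    have hb := ((herr (fun n => X (ψ n)) fun n => (hsur.norm_le _ (hψ1 n)).trans hR1).sub
      (herr (fun _ => L) fun _ => hR2)).add (hgap.comp hψt)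
    rw [sub_zero, add_zero] at hb
    refine le_add_sq_of_tendsto hlim' hdiff2.continuousAt hb (Eventually.of_forall fun n => ?_)
    have h1 := avg_taskLoss_le_add_gap hmu hbd hs hmin (hψ1 n) L
    simp only [Function.comp_apply, totalLoss]
    simp only [hr]
    linarith
  refine ((tendsto_add_atTop_iff_nat (f := fun T => Metric.infEDist (X T)
    (stationaryPoints fun L : Dict d u => e L + r L)) 1).1 hmain).congr' ?_
  filter_upwards [hfix] with T hT
  rw [hT]

end Convergence

theorem mainTheorem2 {N d u M : ℕ}
    -- the connected communication graph of the agents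
    (G : SimpleGraph (Fin N)) (hG : G.Connected)
    -- the regularization parameters and the penalty parameter
    (gam mu lam rho : ℝ) (hgam : 0 < gam) (hmu : 0 < mu) (hlam : 0 < lam) (hrho : 0 < rho)
    -- the loss, convex and twice continuously differentiable in the task parameter
    (loss : CoLLA.TaskData d M → (Fin d → ℝ) → ℝ)
    (hloss_convex : ∀ x, ConvexOn ℝ Set.univ (loss x))
    (hloss_smooth : ∀ x, ContDiff ℝ 2 (loss x))
    (hloss_cont : Continuous fun p : CoLLA.TaskData d M × (Fin d → ℝ) => loss p.1 p.2)
    (hloss_hess : Continuous fun p : CoLLA.TaskData d M × (Fin d → ℝ) =>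
      iteratedFDeriv ℝ 2 (loss p.1) p.2)
    -- the random tasks, independent and identically distributed in time
    {Ω : Type*} [MeasurableSpace Ω] (P : Measure Ω) [IsProbabilityMeasure P]
    (x : ℕ → Ω → Fin N → CoLLA.TaskData d M)
    (hx_meas : ∀ t, Measurable (x t)) (hx_indep : iIndepFun x P)
    (hx_ident : ∀ t, IdentDistrib (x t) (x 1) P P)
    -- (A) the data distribution has compact support
    (K : Fin N → Set (CoLLA.TaskData d M)) (hK : ∀ i, IsCompact (K i))
    (hxK : ∀ t i, ∀ᵐ ω ∂P, x t ω i ∈ K i)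
    -- the loss Hessians are positive definite
    (hΓ : ∀ i, ∀ y ∈ K i, (CoLLA.lossHessian loss gam y).PosDef)
    -- the run of the algorithm
    (L₀ : Fin N → CoLLA.Dict d u) (Z₀ : CoLLA.Edge G → CoLLA.Dict d u)
    (s : Ω → ℕ → Fin N → Fin u → ℝ)
    (Lk : Ω → ℕ → ℕ → Fin N → CoLLA.Dict d u) (Zk : Ω → ℕ → ℕ → CoLLA.Edge G → CoLLA.Dict d u)
    (L : Ω → ℕ → Fin N → CoLLA.Dict d u) (Z : Ω → ℕ → CoLLA.Edge G → CoLLA.Dict d u)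
    (hrun : ∀ᵐ ω ∂P, CoLLA.IsRun G mu lam rho L₀ Z₀
      (fun t i => CoLLA.ridgeEstimator loss gam (x t ω i))
      (fun t i => CoLLA.lossHessian loss gam (x t ω i))
      (s ω) (Lk ω) (Zk ω) (L ω) (Z ω))
    -- the local objectives are strongly convex with moduli `η i`, and the penalty parameter is in
    -- the admissible range `0 < rho < 2 η i / (3 (N - 1) ‖E_i‖²)`, where `‖E_i‖² = |N(i)|`
    (η : Fin N → ℝ)
    (hη : ∀ᵐ ω ∂P, ∀ T, 1 ≤ T → ∀ i, StrongConvexOn Set.univ (η i)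
      (CoLLA.localObjective mu lam
        (fun t i => CoLLA.ridgeEstimator loss gam (x t ω i))
        (fun t i => CoLLA.lossHessian loss gam (x t ω i)) (s ω) T i))
    (hrho_small : ∀ i, 3 * ((N : ℝ) - 1) * ((G.neighborSet i).ncard : ℝ) * rho < 2 * η i)
    -- (B) LASSO solutions are unique, at the dictionaries of the run and at their limit points
    (hB : ∀ᵐ ω ∂P, ∀ i, ∀ X ∈ closure (Set.range fun T => L ω T i), ∀ y ∈ K i,
      ∃! v, CoLLA.IsLassoSolution mu (CoLLA.ridgeEstimator loss gam y)
        (CoLLA.lossHessian loss gam y) X v)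
    -- (C) the matrices `L_iᵀ Γ L_i` met in the run are positive definite
    (hC : ∀ᵐ ω ∂P, ∀ T i,
      ((L ω T i)ᵀ * CoLLA.lossHessian loss gam (x (T + 1) ω i) * L ω T i).PosDef) :
    -- the expected risk is well defined
    (∀ T (X : CoLLA.Dict d u), Integrable
      (fun ω => CoLLA.empiricalRisk loss gam mu lam (fun t => x t ω) T X) P) ∧
    -- the inner loops converge to a dictionary common to all agents
    (∀ᵐ ω ∂P, ∀ T, 1 ≤ T → ∀ i,
      Tendsto (fun k => Lk ω T k i) atTop (𝓝 (L ω T i)) ∧ ∀ j, L ω T i = L ω T j) ∧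
    -- the empirical and the expected risk converge to each other
    (∀ᵐ ω ∂P, TendstoLocallyUniformly
      (fun T (X : CoLLA.Dict d u) => CoLLA.empiricalRisk loss gam mu lam (fun t => x t ω) T X
        - CoLLA.expectedRisk P loss gam mu lam x T X) (fun _ => 0) atTop) ∧
    -- the dictionary approaches the set of stationary points of the expected risk
    (∀ᵐ ω ∂P, ∀ i, Tendsto (fun T => Metric.infEDist (L ω T i)
      (CoLLA.stationaryPoints (CoLLA.expectedRisk P loss gam mu lam x T))) atTop (𝓝 0)) := by
  have hN : 0 < N := by
    obtain ⟨i⟩ := hG.nonempty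
    exact i.pos
  obtain ⟨A, B, hAB⟩ := exists_isBoundedTask hgam hloss_convex hloss_cont hloss_hess hK
    fun i y hy => (hΓ i y hy).posSemidef
  have hmem : ∀ᵐ ω ∂P, ∀ t i, x t ω i ∈ K i := ae_all_iff.2 fun t => ae_all_iff.2 (hxK t)
  have hproc : IsTaskProcess P loss gam mu A B u x :=
    { mu_pos := hmu
      measurable := hx_meas
      indep := hx_indep
      ident := hx_ident
      bounded := hmem.mono fun ω hω t i => hAB i _ (hω t i)
      exists_measurable :=
        exists_measurable_totalLoss hmu hgam hloss_convex hloss_cont hloss_hess }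
  have hinner : ∀ᵐ ω ∂P, ∀ T, ∃ X : CoLLA.Dict d u,
      (∀ i, Tendsto (fun k => Lk ω (T + 1) k i) atTop (𝓝 X)) ∧ (∀ i, L ω (T + 1) i = X) ∧
      ∀ Y, ∑ i, CoLLA.localObjective mu lam (fun t i => CoLLA.ridgeEstimator loss gam (x t ω i))
          (fun t i => CoLLA.lossHessian loss gam (x t ω i)) (s ω) (T + 1) i X
        ≤ ∑ i, CoLLA.localObjective mu lam (fun t i => CoLLA.ridgeEstimator loss gam (x t ω i))
          (fun t i => CoLLA.lossHessian loss gam (x t ω i)) (s ω) (T + 1) i Y := by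
    filter_upwards [hproc.bounded, hrun, hη] with ω hω hrunω hηω T
    exact hrunω.exists_tendsto hG hmu.le hlam hrho (fun t i => (hω t i).posSemidef) hηω
      hrho_small T
  refine ⟨fun T X => hproc.integrable_empiricalRisk T X, ?_, hproc.tendstoLocallyUniformly, ?_⟩
  · filter_upwards [hinner] with ω hω T hT i
    obtain ⟨T, rfl⟩ := Nat.exists_eq_add_of_le' hT
    obtain ⟨X, hX, hLX, -⟩ := hω T
    exact ⟨hLX i ▸ hX i, fun j => (hLX i).trans (hLX j).symm⟩
  · filter_upwards [hinner, hproc.bounded, hproc.ae_exists_rate, hrun, hB]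
      with ω hω hbd hrate hrunω hBω i
    have hcons : ∀ T, 1 ≤ T → ∀ j, L ω T j = L ω T i := fun T hT j => by
      obtain ⟨T, rfl⟩ := Nat.exists_eq_add_of_le' hT
      obtain ⟨X, -, hLX, -⟩ := hω T
      rw [hLX i, hLX j]
    refine hproc.tendsto_infEDist hN hlam hbd hrate (s := s ω) (X := fun T => L ω T i)
      (fun t j ht => ?_) (fun T j hT => ?_) (fun T hT => ?_) fun Y hY => ?_
    · obtain ⟨t, rfl⟩ := Nat.exists_eq_add_of_le' ht
      exact (hbd (t + 1) j).sum_abs_solution_le hmu (hrunω.code t j)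
    · have := hrunω.code T j
      rwa [hcons T hT j] at this
    · obtain ⟨T, rfl⟩ := Nat.exists_eq_add_of_le' hT
      obtain ⟨X, -, hLX, hmin⟩ := hω T
      rwa [← hLX i] at hmin
    · -- a cluster point of the dictionaries of agent `i` is one of the dictionaries of every agent
      filter_upwards [hmem] with ω' hω' j
      refine hBω j Y ?_ _ (hω' 1 j)
      refine mem_closure_iff_clusterPt.2 (ClusterPt.mono hY (le_principal_iff.2 (mem_map.2 ?_)))
      filter_upwards [eventually_ge_atTop 1] with T hT using ⟨T, hcons T hT j⟩
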